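/- **Theorem 2.** Consider the Subset Selection problem $$\min\ \|Mx + c\mu - b\| \quad\text{s.t.}\quad x\in\mathbb R^{d},\ \mu\in\mathbb R,\ |\{i : x_i\neq 0\}|\le\sigma,$$ where $\|\cdot\|$ is the Euclidean norm and the input consists of a rational matrix $M\in\mathbb Q^{n\times d}$, rational vectors $b,c\in\mathbb Q^n$ and a natural number $\sigma$. Assume that $d=n+k$ and $M=(A\mid C)$, where $A\in\mathbb Q^{n\times n}$ is a diagonal matrix and $C\in\mathbb Q^{n\times k}$ is arbitrary. There is an algorithm that, for every fixed $k$, finds an optimal solution of this problem in time polynomial in the bit size of the input $(M,c,b,\sigma)$. Moreover, the algorithm solves $O(2^k n^{2(k+1)})$ linear least squares problems (that is, for some constant $K$ independent of $k$, $n$ and the data, at most $K\,2^k n^{2(k+1)}$ of them whenever $n\ge 1$). Each of these is obtained from the Subset Selection problem by choosing a set of at most $\sigma$ of the variables $x_i$, setting the other $x_i$ to zero and dropping the cardinality constraint, and the optimal solution returned is the solution found for one of them. The least squares problems are themselves solved by a polynomial-time subroutine, whose running time is included in the total. -/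

import Mathlib

namespace SubsetSelection

open Matrix

/-! ### Machine model

Programs act on finite binary trees whose leaves are rational numbers.  Every elementary step is
charged at least the bit size of its argument and of its result (logarithmic cost), so that, up to a
polynomial, the time counted here is Turing machine time. -/

/-- Data: binary trees with rational leaves. -/
inductive Data : Type
  | num (q : ℚ) : Data
  | pair (a b : Data) : Data

/-- Bit size: numerators and denominators are written in binary. -/
def Data.size : Data → ℕ
  | .num q => 1 + Nat.size q.num.natAbs + Nat.size q.den
  | .pair a b => 1 + a.size + b.size

/-- The elementary operations. -/
inductive Op : Type
  | id | fst | snd | isPair | add | sub | mul | div | le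

/-- The value of an elementary operation; `0` where the argument does not have the right shape.
The truth values are `1` and `0`. -/
def Op.eval : Op → Data → Data
  | .id, v => v
  | .fst, .pair a _ => a
  | .snd, .pair _ b => b
  | .isPair, .pair _ _ => .num 1
  | .add, .pair (.num p) (.num q) => .num (p + q)
  | .sub, .pair (.num p) (.num q) => .num (p - q)
  | .mul, .pair (.num p) (.num q) => .num (p * q)
  | .div, .pair (.num p) (.num q) => .num (p / q)
  | .le, .pair (.num p) (.num q) => if p ≤ q then .num 1 else .num 0
  | _, _ => .num 0

/-- Programs.  `seq f g` runs `f` and then `g`; `pair f g` runs both on the same argument and pairs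
the results; `cond c f g` and `loop c f` branch and iterate on the test `c`, where every value but the
number `0` counts as true; `call` passes the argument to a fixed subroutine. -/
inductive Program : Type
  | op (o : Op) : Program
  | const (d : Data) : Program
  | pair (f g : Program) : Program
  | seq (f g : Program) : Program
  | cond (c f g : Program) : Program
  | loop (c f : Program) : Program
  | call : Program

/-- `Run sub P v w t l`: when subroutine calls are answered according to `sub` (argument, result,
time), the program `P` terminates on `v` with result `w` in time `t`, and `l` is the list of its
subroutine calls (argument, result), in order.  The rules are syntax-directed. -/
inductive Run (sub : Data → Data → ℕ → Prop) :
    Program → Data → Data → ℕ → List (Data × Data) → Prop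
  | op (o : Op) (v : Data) : Run sub (.op o) v (o.eval v) (1 + v.size + (o.eval v).size) []
  | const (d v : Data) : Run sub (.const d) v d (1 + v.size + d.size) []
  | pair {f g : Program} {v a b : Data} {s t : ℕ} {l m : List (Data × Data)} :
      Run sub f v a s l → Run sub g v b t m →
        Run sub (.pair f g) v (.pair a b) (1 + s + t) (l ++ m)
  | seq {f g : Program} {v a b : Data} {s t : ℕ} {l m : List (Data × Data)} :
      Run sub f v a s l → Run sub g a b t m → Run sub (.seq f g) v b (1 + s + t) (l ++ m)
  | condTrue {c f g : Program} {v a b : Data} {s t : ℕ} {l m : List (Data × Data)} :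
      Run sub c v a s l → a ≠ .num 0 → Run sub f v b t m →
        Run sub (.cond c f g) v b (1 + s + t) (l ++ m)
  | condFalse {c f g : Program} {v b : Data} {s t : ℕ} {l m : List (Data × Data)} :
      Run sub c v (.num 0) s l → Run sub g v b t m →
        Run sub (.cond c f g) v b (1 + s + t) (l ++ m)
  | loopStop {c f : Program} {v : Data} {s : ℕ} {l : List (Data × Data)} :
      Run sub c v (.num 0) s l → Run sub (.loop c f) v v (1 + s) l
  | loopStep {c f : Program} {v a u w : Data} {s t r : ℕ} {l m k : List (Data × Data)} :
      Run sub c v a s l → a ≠ .num 0 → Run sub f v u t m → Run sub (.loop c f) u w r k →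
        Run sub (.loop c f) v w (1 + s + t + r) (l ++ m ++ k)
  | call {v w : Data} {t : ℕ} : sub v w t → Run sub .call v w (1 + v.size + w.size + t) [(v, w)]

/-- `P` terminates on `v` with result `w` in time `t`, without any subroutine call. -/
def RunPlain (P : Program) (v w : Data) (t : ℕ) : Prop :=
  Run (fun _ _ _ => False) P v w t []

/-- `P` terminates on `v` with result `w`, where each `call` executes the program `S` and the running
time of `S` is charged; `t` is the total time and `l` the list of the calls. -/
def RunWith (S P : Program) (v w : Data) (t : ℕ) (l : List (Data × Data)) : Prop :=
  Run (RunPlain S) P v w t l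

/-- Programs are deterministic: result, time and calls are determined by the argument. -/
theorem Run.deterministic {sub : Data → Data → ℕ → Prop}
    (hsub : ∀ v w t w' t', sub v w t → sub v w' t' → w = w' ∧ t = t')
    {P : Program} {v w w' : Data} {t t' : ℕ} {l l' : List (Data × Data)}
    (h : Run sub P v w t l) (h' : Run sub P v w' t' l') : w = w' ∧ t = t' ∧ l = l' := by
  induction h generalizing w' t' l' with
  | op | const => cases h'; simp
  | pair _ _ ih1 ih2 =>
    cases h' with
    | pair h1 h2 =>
      obtain ⟨rfl, rfl, rfl⟩ := ih1 h1
      obtain ⟨rfl, rfl, rfl⟩ := ih2 h2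
      simp
  | seq _ _ ih1 ih2 =>
    cases h' with
    | seq h1 h2 =>
      obtain ⟨rfl, rfl, rfl⟩ := ih1 h1
      obtain ⟨rfl, rfl, rfl⟩ := ih2 h2
      simp
  | condTrue _ ha _ ih1 ih2 =>
    cases h' with
    | condTrue h1 _ h2 =>
      obtain ⟨rfl, rfl, rfl⟩ := ih1 h1
      obtain ⟨rfl, rfl, rfl⟩ := ih2 h2
      simp
    | condFalse h1 _ => exact absurd (ih1 h1).1 ha
  | condFalse _ _ ih1 ih2 =>
    cases h' with
    | condTrue h1 ha _ => exact absurd (ih1 h1).1.symm ha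
    | condFalse h1 h2 =>
      obtain ⟨-, rfl, rfl⟩ := ih1 h1
      obtain ⟨rfl, rfl, rfl⟩ := ih2 h2
      simp
  | loopStop _ ih1 =>
    cases h' with
    | loopStop h1 =>
      obtain ⟨-, rfl, rfl⟩ := ih1 h1
      simp
    | loopStep h1 ha _ _ => exact absurd (ih1 h1).1.symm ha
  | loopStep _ ha _ _ ih1 ih2 ih3 =>
    cases h' with
    | loopStop h1 => exact absurd (ih1 h1).1 ha
    | loopStep h1 _ h2 h3 =>
      obtain ⟨rfl, rfl, rfl⟩ := ih1 h1
      obtain ⟨rfl, rfl, rfl⟩ := ih2 h2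
      obtain ⟨rfl, rfl, rfl⟩ := ih3 h3
      simp
  | call h1 =>
    cases h' with
    | call h2 =>
      obtain ⟨rfl, rfl⟩ := hsub _ _ _ _ _ h1 h2
      simp

/-! ### Encodings -/

/-- A list as a tree; the empty list is `0`. -/
def encList : List Data → Data
  | [] => .num 0
  | a :: l => .pair a (encList l)

/-- A rational vector as the list of its entries. -/
def encVec {m : ℕ} (v : Fin m → ℚ) : Data :=
  encList (List.ofFn fun i => .num (v i))

/-- A rational matrix as the list of its columns (all entries are written down). -/
def encMatrix {m d : ℕ} (M : Matrix (Fin m) (Fin d) ℚ) : Data :=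
  encList (List.ofFn fun j => encVec fun i => M i j)

/-- The data of the problem `min ‖B z - y‖`. -/
def encLeastSquares {m q : ℕ} (B : Matrix (Fin m) (Fin q) ℚ) (y : Fin m → ℚ) : Data :=
  .pair (encMatrix B) (encVec y)

/-- The data of a Subset Selection problem. -/
def encInstance {m d : ℕ} (M : Matrix (Fin m) (Fin d) ℚ) (c b : Fin m → ℚ) (σ : ℕ) : Data :=
  .pair (encMatrix M) (.pair (encVec c) (.pair (encVec b) (.num σ)))

/-- A pair `(x, μ)`. -/
def encSolution {d : ℕ} (x : Fin d → ℚ) (μ : ℚ) : Data :=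
  .pair (encVec x) (.num μ)

/-! ### Linear least squares -/

/-- The Euclidean norm `‖B z - y‖`, for rational data and real `z`. -/
noncomputable def leastSquaresObjective {m q : ℕ} (B : Matrix (Fin m) (Fin q) ℚ) (y : Fin m → ℚ)
    (z : Fin q → ℝ) : ℝ :=
  ‖WithLp.toLp 2 (B.map (fun a : ℚ => (a : ℝ)) *ᵥ z - fun i => (y i : ℝ))‖

/-- `S` is an algorithm that solves all linear least squares problems with rational data in time
polynomial in the bit size of the data. -/
def SolvesLeastSquaresInPolyTime (S : Program) : Prop :=
  ∃ p : Polynomial ℕ, ∀ (m q : ℕ) (B : Matrix (Fin m) (Fin q) ℚ) (y : Fin m → ℚ),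
    ∃ (z : Fin q → ℚ) (t : ℕ),
      RunPlain S (encLeastSquares B y) (encVec z) t ∧
      t ≤ p.eval (encLeastSquares B y).size ∧
      ∀ w : Fin q → ℝ,
        leastSquaresObjective B y (fun j => (z j : ℝ)) ≤ leastSquaresObjective B y w

/-! ### Subset Selection -/

/-- The Euclidean norm `‖M x + μ c - b‖`, for rational data and real `x`, `μ`. -/
noncomputable def objective {m d : ℕ} (M : Matrix (Fin m) (Fin d) ℚ) (c b : Fin m → ℚ)
    (x : Fin d → ℝ) (μ : ℝ) : ℝ :=
  ‖WithLp.toLp 2 (M.map (fun a : ℚ => (a : ℝ)) *ᵥ x + μ • (fun i => (c i : ℝ)) -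
    fun i => (b i : ℝ))‖

/-- `(x, μ)` is an optimal solution of the problem of minimizing `‖M x + μ c - b‖` over all real
`x` and `μ` such that `x` has at most `σ` nonzero entries. -/
def IsOptimal {m d : ℕ} (M : Matrix (Fin m) (Fin d) ℚ) (c b : Fin m → ℚ) (σ : ℕ)
    (x : Fin d → ℝ) (μ : ℝ) : Prop :=
  (Function.support x).ncard ≤ σ ∧
    ∀ (y : Fin d → ℝ) (ν : ℝ), (Function.support y).ncard ≤ σ →
      objective M c b x μ ≤ objective M c b y ν

/-- The matrix `(A | C)`. -/
def blockRow {n k : ℕ} (A : Matrix (Fin n) (Fin n) ℚ) (C : Matrix (Fin n) (Fin k) ℚ) :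
    Matrix (Fin n) (Fin (n + k)) ℚ :=
  (fromCols A C).submatrix id finSumFinEquiv.symm

/-- The matrix with the columns `s 0, …, s (r - 1)` of `M`, followed by the column `c`. -/
def restrictCols {m d r : ℕ} (M : Matrix (Fin m) (Fin d) ℚ) (c : Fin m → ℚ) (s : Fin r ↪ Fin d) :
    Matrix (Fin m) (Fin (r + 1)) ℚ :=
  Matrix.of fun i => Fin.snoc (α := fun _ => ℚ) (fun j => M i (s j)) (c i)

/-- Every call `(argument, result)` in the list `l` asks for the least squares problem obtained from
the Subset Selection problem by fixing a set of at most `σ` variables `x_j`, setting all the other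
`x_j` to zero and dropping the cardinality constraint (`μ` stays free). -/
def CallsAreRestrictions {m d : ℕ} (M : Matrix (Fin m) (Fin d) ℚ) (c b : Fin m → ℚ) (σ : ℕ)
    (l : List (Data × Data)) : Prop :=
  ∀ e ∈ l, ∃ (r : ℕ) (s : Fin r ↪ Fin d), r ≤ σ ∧ e.1 = encLeastSquares (restrictCols M c s) b

/-- `(x, μ)` is the extension by zero of the solution of one of the least squares problems in `l`. -/
def ObtainedFromCalls {m d : ℕ} (M : Matrix (Fin m) (Fin d) ℚ) (c b : Fin m → ℚ)
    (l : List (Data × Data)) (x : Fin d → ℚ) (μ : ℚ) : Prop :=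
  ∃ (r : ℕ) (s : Fin r ↪ Fin d) (z : Fin (r + 1) → ℚ),
    (encLeastSquares (restrictCols M c s) b, encVec z) ∈ l ∧
      (∀ j, x (s j) = z j.castSucc) ∧ (∀ i, i ∉ Set.range s → x i = 0) ∧ μ = z (Fin.last r)

end SubsetSelection

/-! The algorithm lists candidate supports for `x`, one of which contains the support of an optimal
solution, solves the least squares problem on each of them, and returns the best solution.

**Few supports suffice.** Fix which columns of `C` may be used (a vector `J`, `2 ^ k` choices) and
consider the residual `rᵢ = bᵢ - μ cᵢ - (C z)ᵢ` of row `i` as a linear functional of the point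
`(1, -μ, -z)`.  As `A` is diagonal, the variable `xᵢ` can only be used to cancel `rᵢ`, and only if
`A i i ≠ 0`.  For given `μ` and `z` it is therefore best to cancel the largest `rᵢ²` among these
rows, as many as the cardinality constraint leaves.  So only the order of the numbers `|rᵢ|` matters,
that is, the signs of the functionals `rₐ ± r_b`, and a support that is optimal for all points of a
cell of the arrangement of the hyperplanes `rₐ ± r_b = 0` is found from one sign vector.
`sum_le_sum_of_rank_lt`, `select_spec` and `exists_mask` carry this part.

**Enumerating the cells.** The cells are found by repeated restriction (`exists_leaf_cover`): if a
point `p` is not in the cell of the base point `(1, δ, δ², …)`, `δ` small, move from `p` towards the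
base point until the first separating hyperplane is met, restrict all functionals to that hyperplane
by eliminating a variable (`child`), and go on inside of it.  After `k + 1` restrictions no variable
is left, so the hyperplanes met, at most `k + 1` of them, are enough to name the cell.  The signs of
the functionals are determined lexicographically, first at the base point of the last flat, where
this vanishes by their derivatives along the directions that lead back out of the hyperplanes.  The
pair of indices `(a, b)` stands for the hyperplane `rₐ = r_b` if `a < b`, for `rₐ = -r_b` if `b < a`,
and for no restriction if `a = b`, so there are `n ^ 2` choices at each of the `k + 1` levels, and
with the zero support this makes `1 + 2 ^ k * n ^ (2 * (k + 1))` candidates (`length_masks`), at most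
`2 * (2 ^ k * n ^ (2 * (k + 1)))` for `n ≥ 1`.

**Least squares.** The subroutine solves the normal equations `BᵀB z = Bᵀ y` with the
Faddeev–LeVerrier recursion, a polynomial formula without any case distinction for pivots.  For the
symmetric matrix `G = BᵀB` of any rank, the last nonzero coefficient of the recursion and the matrix
that belongs to it give a solution (`flBest_normal_eq`), and all intermediate numbers have common
denominators and numerators of polynomial bit size.

**Running times.** Programs are not written out.  `PTC rel X f calls` says that some program computes
`f` on the arguments in question, with polynomial running time and the stated subroutine calls, and
these properties are closed under the constructions that the algorithm uses; the essential one is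
the fold over a list (`PTC.fold`), which needs a bound for the intermediate accumulators. -/

namespace SubsetSelection

open Matrix

/-! ### Sizes, lists and running times -/

/-- The value of a polynomial with natural coefficients is monotone in the argument. -/
theorem poly_mono (p : Polynomial ℕ) {a b : ℕ} (h : a ≤ b) : p.eval a ≤ p.eval b := by
  induction p using Polynomial.induction_on' with
  | add p q hp hq => simpa using add_le_add hp hq
  | monomial n c =>
    simp only [Polynomial.eval_monomial]
    exact Nat.mul_le_mul_left _ (Nat.pow_le_pow_left h n)

namespace Data

/-- The height-size of a tree: as `Data.size`, except that a leaf counts with the logarithm of the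
height of its rational number.  It is equivalent to `Data.size`, and it is subadditive under sums of
rational numbers up to a constant, which `Data.size` is not. -/
def ht : Data → ℕ
  | .num q => 1 + max (Nat.size q.num.natAbs) (Nat.size q.den)
  | .pair a b => 1 + a.ht + b.ht

theorem ht_le_size (v : Data) : v.ht ≤ v.size := by
  induction v with
  | num q => simp only [ht, size]; omega
  | pair a b iha ihb => simp only [ht, size]; omega

theorem size_le_ht (v : Data) : v.size ≤ 2 * v.ht := by
  induction v with
  | num q => simp only [ht, size]; omega
  | pair a b iha ihb => simp only [ht, size]; omega

theorem two_le_ht (v : Data) : 2 ≤ v.ht := by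
  induction v with
  | num q =>
    have : 0 < Nat.size q.den := Nat.size_pos.2 q.den_pos
    simp only [ht]; omega
  | pair a b iha ihb => simp only [ht]; omega

/-- First component, `0` for a leaf. -/
def fst : Data → Data
  | .pair a _ => a
  | .num _ => .num 0

/-- Second component, `0` for a leaf. -/
def snd : Data → Data
  | .pair _ b => b
  | .num _ => .num 0

@[simp] theorem fst_pair (a b : Data) : (Data.pair a b).fst = a := rfl
@[simp] theorem snd_pair (a b : Data) : (Data.pair a b).snd = b := rfl
@[simp] theorem ht_pair (a b : Data) : (Data.pair a b).ht = 1 + a.ht + b.ht := rfl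

theorem ht_num_zero : (Data.num 0).ht = 2 := by simp [ht]

theorem ht_num_one : (Data.num 1).ht = 2 := by simp [ht]

theorem ht_fst_le (v : Data) : v.fst.ht ≤ v.ht := by
  cases v with
  | num q => exact ht_num_zero.le.trans (two_le_ht _)
  | pair a b => simp only [fst_pair, ht_pair]; omega

theorem ht_snd_le (v : Data) : v.snd.ht ≤ v.ht := by
  cases v with
  | num q => exact ht_num_zero.le.trans (two_le_ht _)
  | pair a b => simp only [snd_pair, ht_pair]; omega

/-- The entries of a tree that is read as a list, whatever leaf it ends with. -/
def toList : Data → List Data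
  | .num _ => []
  | .pair a l => a :: l.toList

@[simp] theorem toList_pair (a l : Data) : (Data.pair a l).toList = a :: l.toList := rfl
@[simp] theorem toList_num (q : ℚ) : (Data.num q).toList = [] := rfl

@[simp] theorem toList_encList (l : List Data) : (encList l).toList = l := by
  induction l with
  | nil => rfl
  | cons a l ih => simp [encList, ih]

theorem length_toList_le (v : Data) : v.toList.length ≤ v.ht := by
  induction v with
  | num q => simp
  | pair a l _ ih => simp; omega

theorem ht_le_of_mem_toList {a v : Data} (h : a ∈ v.toList) : a.ht ≤ v.ht := by
  induction v with
  | num q => simp at h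
  | pair b l _ ih =>
    rcases List.mem_cons.1 h with rfl | h
    · simp; omega
    · have := ih h; simp; omega

/-- The entries of a list contribute additively to its height-size. -/
theorem ht_encList (l : List Data) : (encList l).ht = 2 + (l.map fun a => a.ht + 1).sum := by
  induction l with
  | nil => simp [encList, ht_num_zero]
  | cons a l ih => simp [encList, ih]; omega

/-- The leaf at the end of a tree that is read as a list. -/
def listEnd : Data → Data
  | .num q => .num q
  | .pair _ l => l.listEnd

theorem ht_listEnd_le (v : Data) : v.listEnd.ht ≤ v.ht := by
  induction v with
  | num q => exact le_rfl
  | pair a l _ ih => simp only [listEnd, ht_pair]; omega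

/-- Branching on a value, where every value but the number `0` counts as true. -/
def cond : Data → Data → Data → Data
  | .num q, a, b => if q = 0 then b else a
  | .pair _ _, a, _ => a

theorem cond_zero (a b : Data) : cond (.num 0) a b = b := by simp [cond]

theorem cond_of_ne {c : Data} (h : c ≠ .num 0) (a b : Data) : cond c a b = a := by
  cases c with
  | num q => simp [cond, show q ≠ 0 from fun h' => h (by rw [h'])]
  | pair _ _ => rfl

theorem ht_cond_le (c a b : Data) : (cond c a b).ht ≤ max a.ht b.ht := by
  by_cases h : c = .num 0
  · simp [h, cond_zero]
  · simp [cond_of_ne h]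

end Data

/-- The running time bounds the size of the argument and of the result. -/
theorem Run.size_le {rel : Data → Data → ℕ → Prop} {P : Program} {v w : Data} {t : ℕ}
    {l : List (Data × Data)} (h : Run rel P v w t l) : v.size ≤ t ∧ w.size ≤ t := by
  induction h <;> (try simp only [Data.size]) <;> omega

variable {rel : Data → Data → ℕ → Prop} {ι : Type}

/-- `PTC rel X f calls`: one program computes `f` on all the sets `X i` with the list `calls v` of
subroutine calls on `v`, and for each `i` its running time on `X i` is bounded by a polynomial,
which may depend on `i`. -/
def PTC (rel : Data → Data → ℕ → Prop) (X : ι → Set Data) (f : Data → Data)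
    (calls : Data → List (Data × Data)) : Prop :=
  ∃ P : Program, ∀ i, ∃ p : Polynomial ℕ, ∀ v ∈ X i, ∃ t, Run rel P v (f v) t (calls v) ∧
    t ≤ p.eval v.ht

/-- `f` is computable without subroutine calls by one program on all the sets `X i`, with running
time polynomial on each of them. -/
def PT (rel : Data → Data → ℕ → Prop) (X : ι → Set Data) (f : Data → Data) : Prop :=
  PTC rel X f fun _ => []

/-- `f` is computable in polynomial time on all data. -/
def PTu (rel : Data → Data → ℕ → Prop) (f : Data → Data) : Prop :=
  PT rel (fun _ : Unit => Set.univ) f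

theorem PTC.ht_le {X : ι → Set Data} {f : Data → Data} {cf : Data → List (Data × Data)}
    (h : PTC rel X f cf) (i : ι) :
    ∃ p : Polynomial ℕ, ∀ v ∈ X i, (f v).ht ≤ p.eval v.ht := by
  obtain ⟨P, hP⟩ := h
  obtain ⟨p, hp⟩ := hP i
  refine ⟨p, fun v hv => ?_⟩
  obtain ⟨t, ht, htp⟩ := hp v hv
  exact ((Data.ht_le_size _).trans ht.size_le.2).trans htp

theorem PTu.ht_le {f : Data → Data} (h : PTu rel f) :
    ∃ p : Polynomial ℕ, ∀ v, (f v).ht ≤ p.eval v.ht := by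
  obtain ⟨p, hp⟩ := PTC.ht_le h ()
  exact ⟨p, fun v => hp v trivial⟩

theorem PTC.seq {X Y : ι → Set Data} {f g : Data → Data} {cf cg : Data → List (Data × Data)}
    (hg : PTC rel Y g cg) (hf : PTC rel X f cf) (hXY : ∀ i, ∀ v ∈ X i, f v ∈ Y i) :
    PTC rel X (fun v => g (f v)) (fun v => cf v ++ cg (f v)) := by
  have hht := hf.ht_le
  obtain ⟨P, hP⟩ := hf
  obtain ⟨Q, hQ⟩ := hg
  refine ⟨.seq P Q, fun i => ?_⟩
  obtain ⟨r, hr⟩ := hht i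
  obtain ⟨p, hp⟩ := hP i
  obtain ⟨q, hq⟩ := hQ i
  refine ⟨1 + p + q.comp r, fun v hv => ?_⟩
  obtain ⟨s, hs, hsp⟩ := hp v hv
  obtain ⟨t, ht, htq⟩ := hq _ (hXY i v hv)
  refine ⟨_, .seq hs ht, ?_⟩
  have := htq.trans (poly_mono q (hr v hv))
  simp only [Polynomial.eval_add, Polynomial.eval_one, Polynomial.eval_comp]
  omega

theorem PTC.mk_pair {X : ι → Set Data} {f g : Data → Data} {cf cg : Data → List (Data × Data)}
    (hf : PTC rel X f cf) (hg : PTC rel X g cg) :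
    PTC rel X (fun v => .pair (f v) (g v)) (fun v => cf v ++ cg v) := by
  obtain ⟨P, hP⟩ := hf
  obtain ⟨Q, hQ⟩ := hg
  refine ⟨.pair P Q, fun i => ?_⟩
  obtain ⟨p, hp⟩ := hP i
  obtain ⟨q, hq⟩ := hQ i
  refine ⟨1 + p + q, fun v hv => ?_⟩
  obtain ⟨s, hs, hsp⟩ := hp v hv
  obtain ⟨t, ht, htq⟩ := hq _ hv
  refine ⟨_, .pair hs ht, ?_⟩
  simp only [Polynomial.eval_add, Polynomial.eval_one]
  omega

theorem PT.comp_on {X Y : ι → Set Data} {f g : Data → Data} (hg : PT rel Y g) (hf : PT rel X f)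
    (hXY : ∀ i, ∀ v ∈ X i, f v ∈ Y i) : PT rel X (fun v => g (f v)) :=
  PTC.seq hg hf hXY

theorem PTu.on {f : Data → Data} (h : PTu rel f) (X : ι → Set Data) : PT rel X f := by
  obtain ⟨P, hP⟩ := h
  refine ⟨P, fun i => ?_⟩
  obtain ⟨p, hp⟩ := hP ()
  exact ⟨p, fun v _ => hp v trivial⟩

theorem PTu.comp {X : ι → Set Data} {f g : Data → Data} (hg : PTu rel g) (hf : PT rel X f) :
    PT rel X (fun v => g (f v)) :=
  PT.comp_on (hg.on fun _ => Set.univ) hf fun _ _ _ => trivial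

theorem PT.pair {X : ι → Set Data} {f g : Data → Data} (hf : PT rel X f) (hg : PT rel X g) :
    PT rel X (fun v => .pair (f v) (g v)) :=
  PTC.mk_pair hf hg

/-- A polynomial-time function of two arguments, applied to two polynomial-time functions. -/
theorem PTu.comp₂ {X : ι → Set Data} {F : Data → Data → Data} {f g : Data → Data}
    (hF : PTu rel fun w => F w.fst w.snd) (hf : PT rel X f) (hg : PT rel X g) :
    PT rel X (fun v => F (f v) (g v)) :=
  hF.comp (hf.pair hg)

/-- A polynomial-time function of three arguments, applied to three polynomial-time functions. -/
theorem PTu.comp₃ {X : ι → Set Data} {F : Data → Data → Data → Data} {f g h : Data → Data}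
    (hF : PTu rel fun w => F w.fst w.snd.fst w.snd.snd) (hf : PT rel X f) (hg : PT rel X g)
    (hh : PT rel X h) : PT rel X (fun v => F (f v) (g v) (h v)) :=
  hF.comp (hf.pair (hg.pair hh))

theorem PT.const {X : ι → Set Data} (d : Data) : PT rel X fun _ => d := by
  refine ⟨.const d, fun i => ⟨1 + 2 * Polynomial.X + (d.size : Polynomial ℕ), fun v _ =>
    ⟨_, .const d v, ?_⟩⟩⟩
  have := v.size_le_ht
  simp
  omega

theorem PTu.op (o : Op) (p : Polynomial ℕ) (h : ∀ v, (o.eval v).ht ≤ p.eval v.ht) :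
    PTu rel o.eval := by
  refine ⟨.op o, fun i => ⟨1 + 2 * Polynomial.X + 2 * p, fun v _ => ⟨_, .op o v, ?_⟩⟩⟩
  have h1 := v.size_le_ht
  have h2 := (o.eval v).size_le_ht
  have h3 := h v
  simp
  omega

theorem PT.id {X : ι → Set Data} : PT rel X fun v => v :=
  (PTu.op .id .X fun v => by simp [Op.eval]).on X

theorem PT.fst {X : ι → Set Data} {f : Data → Data} (hf : PT rel X f) :
    PT rel X fun v => (f v).fst := by
  have h : Op.fst.eval = Data.fst := by
    funext v; cases v <;> rfl
  exact (h ▸ PTu.op .fst .X fun v => by simpa [h] using v.ht_fst_le : PTu rel Data.fst).comp hf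

theorem PT.snd {X : ι → Set Data} {f : Data → Data} (hf : PT rel X f) :
    PT rel X fun v => (f v).snd := by
  have h : Op.snd.eval = Data.snd := by
    funext v; cases v <;> rfl
  exact (h ▸ PTu.op .snd .X fun v => by simpa [h] using v.ht_snd_le : PTu rel Data.snd).comp hf

theorem PT.cond {X : ι → Set Data} {c f g : Data → Data} (hc : PT rel X c) (hf : PT rel X f)
    (hg : PT rel X g) : PT rel X fun v => Data.cond (c v) (f v) (g v) := by
  obtain ⟨R, hR⟩ := hc
  obtain ⟨P, hP⟩ := hf
  obtain ⟨Q, hQ⟩ := hg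
  refine ⟨.cond R P Q, fun i => ?_⟩
  obtain ⟨r, hr⟩ := hR i
  obtain ⟨p, hp⟩ := hP i
  obtain ⟨q, hq⟩ := hQ i
  refine ⟨1 + r + p + q, fun v hv => ?_⟩
  obtain ⟨u, hu, hur⟩ := hr v hv
  obtain ⟨s, hs, hsp⟩ := hp v hv
  obtain ⟨t, ht, htq⟩ := hq v hv
  simp only [Polynomial.eval_add, Polynomial.eval_one]
  by_cases h : c v = .num 0
  · rw [h] at hu
    refine ⟨1 + u + t, ?_, by omega⟩
    simpa [h, Data.cond_zero] using Run.condFalse (f := P) hu ht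
  · refine ⟨1 + u + s, ?_, by omega⟩
    simpa [Data.cond_of_ne h] using Run.condTrue (g := Q) hu h hs

/-- `1` for a pair and `0` for a leaf. -/
def Data.isPair : Data → Data
  | .num _ => .num 0
  | .pair _ _ => .num 1

theorem PT.isPair {X : ι → Set Data} {f : Data → Data} (hf : PT rel X f) :
    PT rel X fun v => (f v).isPair := by
  have h : Op.isPair.eval = Data.isPair := by
    funext v; cases v <;> rfl
  refine (h ▸ PTu.op .isPair .X fun v => ?_ : PTu rel Data.isPair).comp hf
  have := v.two_le_ht
  rw [h, Polynomial.eval_X]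
  cases v
  · exact Data.ht_num_zero.trans_le this
  · exact Data.ht_num_one.trans_le this

/-- The subroutine calls of a fold over a list, when the step on the argument `v`, accumulator `a` and
entry `x` makes the calls `cf (v, (a, x))`. -/
def foldCalls (f : Data → Data → Data → Data) (cf : Data → List (Data × Data)) (v : Data) :
    List Data → Data → List (Data × Data)
  | [], _ => []
  | x :: l, a => cf (.pair v (.pair a x)) ++ foldCalls f cf v l (f v a x)

/-- Folding over a list.  The time is polynomial when the step is polynomial and all intermediate
accumulators have polynomial size. -/
theorem PTC.fold {X Y : ι → Set Data} {f : Data → Data → Data → Data}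
    {cf : Data → List (Data × Data)} {l a : Data → Data}
    (hf : PTC rel Y (fun w => f w.fst w.snd.fst w.snd.snd) cf) (hl : PT rel X l) (ha : PT rel X a)
    (hY : ∀ i, ∀ v ∈ X i, ∀ l₁ x l₂, (l v).toList = l₁ ++ x :: l₂ →
      Data.pair v (.pair (l₁.foldl (f v) (a v)) x) ∈ Y i)
    (hB : ∀ i, ∃ p : Polynomial ℕ, ∀ v ∈ X i, ∀ l₁ l₂, (l v).toList = l₁ ++ l₂ →
      (l₁.foldl (f v) (a v)).ht ≤ p.eval v.ht) :
    PTC rel X (fun v => (l v).toList.foldl (f v) (a v))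
      (fun v => foldCalls f cf v (l v).toList (a v)) := by
  -- The loop runs on states `(v, (remaining list, accumulator))`.
  have hc : PTu rel fun s => s.snd.fst.isPair := .isPair (.fst (.snd .id))
  have harr : PTu rel fun s => .pair s.fst (.pair s.snd.snd s.snd.fst.fst) :=
    .pair (.fst .id) (.pair (.snd (.snd .id)) (.fst (.fst (.snd .id))))
  have hv : PTu rel fun s => s.fst := .fst .id
  have htail : PTu rel fun s => s.snd.fst.snd := .snd (.fst (.snd .id))
  have hlht := PTC.ht_le hl
  have hinit : PT rel X fun v => .pair v (.pair (l v) (a v)) := .pair .id (.pair hl ha)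
  have hfin : PTu rel fun s => s.snd.snd := .snd (.snd .id)
  obtain ⟨F, hF⟩ := hf
  obtain ⟨C, hC⟩ := hc
  obtain ⟨A, hA⟩ := harr
  obtain ⟨V, hV⟩ := hv
  obtain ⟨T, hT⟩ := htail
  obtain ⟨I, hI⟩ := hinit
  obtain ⟨E, hE⟩ := hfin
  refine ⟨.seq I (.seq (.loop C (.pair V (.pair T (.seq A F)))) E), fun i => ?_⟩
  obtain ⟨pF, hF⟩ := hF i
  obtain ⟨pC, hC⟩ := hC ()
  obtain ⟨pA, hA⟩ := hA ()
  obtain ⟨pV, hV⟩ := hV ()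
  obtain ⟨pT, hT⟩ := hT ()
  obtain ⟨pI, hI⟩ := hI i
  obtain ⟨pE, hE⟩ := hE ()
  obtain ⟨pl, hpl⟩ := hlht i
  obtain ⟨pB, hB⟩ := hB i
  -- A bound for the size of a state and of the argument of the step.
  let b : Polynomial ℕ := 2 + .X + pl + pB
  let τ : Polynomial ℕ := 4 + pC.comp b + pV.comp b + pT.comp b + pA.comp b + pF.comp b
  have key : ∀ v ∈ X i, ∀ (d : Data) (acc : Data),
      d.ht ≤ pl.eval v.ht →
      (∀ l₁ l₂, d.toList = l₁ ++ l₂ → (l₁.foldl (f v) acc).ht ≤ pB.eval v.ht) →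
      (∀ l₁ x l₂, d.toList = l₁ ++ x :: l₂ →
        Data.pair v (.pair (l₁.foldl (f v) acc) x) ∈ Y i) →
      ∃ t, Run rel (.loop C (.pair V (.pair T (.seq A F)))) (.pair v (.pair d acc))
        (.pair v (.pair d.listEnd (d.toList.foldl (f v) acc))) t
        (foldCalls f cf v d.toList acc) ∧ t ≤ (d.toList.length + 1) * τ.eval v.ht := by
    intro v hv d
    induction d with
    | num q =>
      intro acc hd h1 _
      obtain ⟨tc, hc, htc⟩ := hC (.pair v (.pair (.num q) acc)) trivial
      refine ⟨1 + tc, .loopStop hc, ?_⟩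
      have h2 := h1 [] [] (by simp)
      have h3 : (Data.pair v (.pair (.num q) acc)).ht ≤ b.eval v.ht := by
        simp only [List.foldl_nil] at h2
        simp [b]; omega
      have h4 := htc.trans (poly_mono pC h3)
      simp [τ] at h4 ⊢
      omega
    | pair x d _ ih =>
      intro acc hd h1 h2
      have hd' : d.ht + x.ht + 1 ≤ pl.eval v.ht := by simp at hd; omega
      have hacc : acc.ht ≤ pB.eval v.ht := by simpa using h1 [] (x :: d.toList) (by simp)
      have hs : (Data.pair v (.pair (.pair x d) acc)).ht ≤ b.eval v.ht := by
        simp [b]; omega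
      have hw : (Data.pair v (.pair acc x)).ht ≤ b.eval v.ht := by
        simp [b]; omega
      obtain ⟨tc, hc, htc⟩ := hC (.pair v (.pair (.pair x d) acc)) trivial
      obtain ⟨tv, hv', htv⟩ := hV (.pair v (.pair (.pair x d) acc)) trivial
      obtain ⟨tt, htt', htt⟩ := hT (.pair v (.pair (.pair x d) acc)) trivial
      obtain ⟨ta, ha', hta⟩ := hA (.pair v (.pair (.pair x d) acc)) trivial
      obtain ⟨tf, hf', htf⟩ := hF (.pair v (.pair acc x)) (h2 [] x d.toList (by simp))
      obtain ⟨t, ht, htt2⟩ := ih (f v acc x) (by omega)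
        (fun l₁ l₂ h => h1 (x :: l₁) l₂ (by simp [h]))
        (fun l₁ y l₂ h => h2 (x :: l₁) y l₂ (by simp [h]))
      refine ⟨_, .loopStep hc (by simp [Data.isPair]) (.pair hv' (.pair htt' (.seq ha' hf'))) ht, ?_⟩
      have e1 := htc.trans (poly_mono pC hs)
      have e2 := htv.trans (poly_mono pV hs)
      have e3 := htt.trans (poly_mono pT hs)
      have e4 := hta.trans (poly_mono pA hs)
      have e5 := htf.trans (poly_mono pF hw)
      have e6 : 4 + tc + tv + tt + ta + tf ≤ τ.eval v.ht := by
        simp only [τ, Polynomial.eval_add, Polynomial.eval_comp, Polynomial.eval_ofNat]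
        omega
      simp only [Data.toList_pair, List.length_cons]
      rw [add_mul _ 1]
      omega
  let bE : Polynomial ℕ := 2 + .X + pl + pB
  refine ⟨2 + pI + (pl + 1) * τ + pE.comp bE, fun v hv => ?_⟩
  obtain ⟨ti, hi, hti⟩ := hI v hv
  obtain ⟨t, ht, htt⟩ := key v hv (l v) (a v) (hpl v hv) (hB v hv) (hY i v hv)
  obtain ⟨te, he, hte⟩ := hE (.pair v (.pair (l v).listEnd ((l v).toList.foldl (f v) (a v)))) trivial
  refine ⟨_, by simpa using Run.seq hi (.seq ht he), ?_⟩
  have h1 := hpl v hv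
  have h2 := (l v).ht_listEnd_le
  have h3 := hB v hv (l v).toList [] (by simp)
  have h4 : (Data.pair v (.pair (l v).listEnd ((l v).toList.foldl (f v) (a v)))).ht ≤
      bE.eval v.ht := by
    simp [bE]; omega
  have h5 := hte.trans (poly_mono pE h4)
  have h6 : ((l v).toList.length + 1) * τ.eval v.ht ≤ (pl.eval v.ht + 1) * τ.eval v.ht :=
    Nat.mul_le_mul_right _ (by have := (l v).length_toList_le; omega)
  simp only [Polynomial.eval_add, Polynomial.eval_mul, Polynomial.eval_one, Polynomial.eval_comp,
    Polynomial.eval_ofNat] at h5 ⊢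
  omega

theorem foldCalls_nil (f : Data → Data → Data → Data) (v : Data) (l : List Data) (a : Data) :
    foldCalls f (fun _ => []) v l a = [] := by
  induction l generalizing a with
  | nil => rfl
  | cons x l ih => simp [foldCalls, ih]

/-- Folding with a polynomial-time step whose intermediate accumulators have polynomial size. -/
theorem PT.fold {X : ι → Set Data} {f : Data → Data → Data → Data} {l a : Data → Data}
    (hf : PTu rel (fun w => f w.fst w.snd.fst w.snd.snd)) (hl : PT rel X l) (ha : PT rel X a)
    (hB : ∀ i, ∃ p : Polynomial ℕ, ∀ v ∈ X i, ∀ l₁ l₂, (l v).toList = l₁ ++ l₂ →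
      (l₁.foldl (f v) (a v)).ht ≤ p.eval v.ht) :
    PT rel X (fun v => (l v).toList.foldl (f v) (a v)) := by
  have := PTC.fold (Y := fun _ => Set.univ) (hf.on _) hl ha (fun _ _ _ _ _ _ _ => trivial) hB
  simpa [PT, foldCalls_nil] using this

/-- Folding with a polynomial-time step that increases the size of the accumulator by an amount
independent of the accumulator. -/
theorem PT.fold_add {X : ι → Set Data} {f : Data → Data → Data → Data} {l a : Data → Data}
    (hf : PTu rel (fun w => f w.fst w.snd.fst w.snd.snd))
    (hg : ∃ g : Polynomial ℕ, ∀ v acc x, (f v acc x).ht ≤ acc.ht + g.eval (v.ht + x.ht))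
    (hl : PT rel X l) (ha : PT rel X a) :
    PT rel X (fun v => (l v).toList.foldl (f v) (a v)) := by
  refine PT.fold hf hl ha fun i => ?_
  obtain ⟨g, hg⟩ := hg
  obtain ⟨pl, hpl⟩ := PTC.ht_le hl i
  obtain ⟨pa, hpa⟩ := PTC.ht_le ha i
  refine ⟨pa + pl * g.comp (.X + pl), fun v hv l₁ l₂ h => ?_⟩
  have hlen : l₁.length ≤ pl.eval v.ht := by
    have h1 := congrArg List.length h
    have h2 := (l v).length_toList_le
    have h3 := hpl v hv
    simp at h1
    omega
  have hmem : ∀ x ∈ l₁, x.ht ≤ pl.eval v.ht := fun x hx =>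
    (Data.ht_le_of_mem_toList (by rw [h]; simp [hx])).trans (hpl v hv)
  have key : ∀ (l₁ : List Data) (acc : Data), (∀ x ∈ l₁, x.ht ≤ pl.eval v.ht) →
      (l₁.foldl (f v) acc).ht ≤ acc.ht + l₁.length * g.eval (v.ht + pl.eval v.ht) := by
    intro l₁
    induction l₁ with
    | nil => simp
    | cons x l₁ ih =>
      intro acc hm
      have h1 := ih (f v acc x) fun y hy => hm y (by simp [hy])
      have h2 := hg v acc x
      have h3 := poly_mono g (show v.ht + x.ht ≤ v.ht + pl.eval v.ht by
        have := hm x (by simp); omega)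
      simp only [List.foldl_cons, List.length_cons, add_mul]
      omega
  have h1 := key l₁ (a v) hmem
  have h2 := hpa v hv
  have h3 : l₁.length * g.eval (v.ht + pl.eval v.ht) ≤
      pl.eval v.ht * g.eval (v.ht + pl.eval v.ht) := Nat.mul_le_mul_right _ hlen
  simp
  omega

/-- Folding over a list whose length is bounded on each of the sets `X i`: any polynomial-time step
will do. -/
theorem PT.fold_bounded {X : ι → Set Data} {f : Data → Data → Data → Data} {l a : Data → Data}
    (hf : PTu rel (fun w => f w.fst w.snd.fst w.snd.snd)) (hl : PT rel X l) (ha : PT rel X a)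
    (hK : ∀ i, ∃ K : ℕ, ∀ v ∈ X i, (l v).toList.length ≤ K) :
    PT rel X (fun v => (l v).toList.foldl (f v) (a v)) := by
  refine PT.fold hf hl ha fun i => ?_
  obtain ⟨pf, hpf⟩ := hf.ht_le
  obtain ⟨pl, hpl⟩ := PTC.ht_le hl i
  obtain ⟨pa, hpa⟩ := PTC.ht_le ha i
  obtain ⟨K, hK⟩ := hK i
  have key : ∀ k : ℕ, ∃ p : Polynomial ℕ, ∀ v ∈ X i, ∀ l₁ l₂, (l v).toList = l₁ ++ l₂ →
      l₁.length ≤ k → (l₁.foldl (f v) (a v)).ht ≤ p.eval v.ht := by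
    intro k
    induction k with
    | zero =>
      refine ⟨pa, fun v hv l₁ l₂ _ h => ?_⟩
      rw [List.length_eq_zero_iff.1 (Nat.le_zero.1 h)]
      exact hpa v hv
    | succ k ih =>
      obtain ⟨p, hp⟩ := ih
      refine ⟨pa + pf.comp (2 + .X + p + pl), fun v hv l₁ l₂ h hlen => ?_⟩
      rcases List.eq_nil_or_concat l₁ with rfl | ⟨l₃, x, rfl⟩
      · have := hpa v hv; simp; omega
      · have h1 := hp v hv l₃ (x :: l₂) (by simp [h]) (by simpa using hlen)
        have h2 : x.ht ≤ pl.eval v.ht :=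
          (Data.ht_le_of_mem_toList (by rw [h]; simp)).trans (hpl v hv)
        have h3 := hpf (.pair v (.pair (l₃.foldl (f v) (a v)) x))
        have h4 := poly_mono pf (show (Data.pair v (.pair (l₃.foldl (f v) (a v)) x)).ht ≤
          2 + v.ht + p.eval v.ht + pl.eval v.ht by simp; omega)
        simp at h3 h4 ⊢
        omega
  obtain ⟨p, hp⟩ := key K
  refine ⟨p, fun v hv l₁ l₂ h => hp v hv l₁ l₂ h ?_⟩
  have h1 := congrArg List.length h
  have h2 := hK v hv
  simp at h1
  omega

/-! ### Arithmetic and list operations in polynomial time -/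

namespace Data

/-- Sum of two numbers, `0` on other arguments; similarly for the next four operations. -/
def add (a b : Data) : Data := Op.add.eval (.pair a b)
/-- Difference of two numbers. -/
def sub (a b : Data) : Data := Op.sub.eval (.pair a b)
/-- Product of two numbers. -/
def mul (a b : Data) : Data := Op.mul.eval (.pair a b)
/-- Quotient of two numbers. -/
def div (a b : Data) : Data := Op.div.eval (.pair a b)
/-- Comparison of two numbers. -/
def le (a b : Data) : Data := Op.le.eval (.pair a b)

@[simp] theorem add_num (p q : ℚ) : add (.num p) (.num q) = .num (p + q) := rfl
@[simp] theorem sub_num (p q : ℚ) : sub (.num p) (.num q) = .num (p - q) := rfl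
@[simp] theorem mul_num (p q : ℚ) : mul (.num p) (.num q) = .num (p * q) := rfl
@[simp] theorem div_num (p q : ℚ) : div (.num p) (.num q) = .num (p / q) := rfl
@[simp] theorem le_num (p q : ℚ) : le (.num p) (.num q) = .num (if p ≤ q then 1 else 0) := by
  simp only [le, Op.eval]; split <;> rfl

/-- A rational number given as a fraction has at most the height-size of that fraction. -/
theorem ht_num_le_of_eq_div {q : ℚ} {a b : ℤ} (hb : b ≠ 0) (h : q = a / b) {k : ℕ}
    (ha' : a.natAbs < 2 ^ k) (hb' : b.natAbs < 2 ^ k) : (Data.num q).ht ≤ 1 + k := by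
  have e : q = Rat.divInt a b := by rw [h, Rat.divInt_eq_div]
  have h1 : q.den ∣ b.natAbs := by
    have := Rat.den_dvd a b
    rw [← e] at this
    exact Int.natCast_dvd.1 this
  have hden : q.den ≤ b.natAbs := Nat.le_of_dvd (Int.natAbs_pos.2 hb) h1
  have hnum : q.num.natAbs ≤ a.natAbs := by
    rcases eq_or_ne a 0 with rfl | ha
    · simp [h]
    · have := Rat.num_dvd a hb
      rw [← e] at this
      exact Nat.le_of_dvd (Int.natAbs_pos.2 ha) (Int.natAbs_dvd_natAbs.2 this)
  simp only [ht]
  have h2 : Nat.size q.num.natAbs ≤ k := Nat.size_le.2 (hnum.trans_lt ha')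
  have h3 : Nat.size q.den ≤ k := Nat.size_le.2 (hden.trans_lt hb')
  omega

/-- Numerator and denominator of a number, bounded through its height-size. -/
theorem exists_height (q : ℚ) : ∃ k : ℕ, (Data.num q).ht = 1 + k ∧ q.num.natAbs < 2 ^ k ∧
    (q.den : ℤ).natAbs < 2 ^ k := by
  refine ⟨max (Nat.size q.num.natAbs) (Nat.size q.den), rfl, ?_, ?_⟩
  · exact Nat.size_le.1 (le_max_left _ _)
  · exact Nat.size_le.1 (le_max_right _ _)

/-- Numerators of a sum: `a * d + c * b` has at most one bit more than the factors together. -/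
theorem natAbs_add_mul_lt {a b c d : ℤ} {k l : ℕ} (ha : a.natAbs < 2 ^ k) (hb : b.natAbs < 2 ^ k)
    (hc : c.natAbs < 2 ^ l) (hd : d.natAbs < 2 ^ l) : (a * d + c * b).natAbs < 2 ^ (k + l + 1) := by
  have h1 : a.natAbs * d.natAbs ≤ 2 ^ k * 2 ^ l := Nat.mul_le_mul ha.le hd.le
  have h2 : c.natAbs * b.natAbs < 2 ^ l * 2 ^ k :=
    Nat.mul_lt_mul'' hc hb
  have h3 := Int.natAbs_add_le (a * d) (c * b)
  rw [Int.natAbs_mul, Int.natAbs_mul] at h3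
  have h4 : 2 ^ (k + l + 1) = 2 ^ k * 2 ^ l + 2 ^ l * 2 ^ k := by ring
  omega

theorem natAbs_mul_lt {a b : ℤ} {k l : ℕ} (ha : a.natAbs < 2 ^ k) (hb : b.natAbs < 2 ^ l) :
    (a * b).natAbs < 2 ^ (k + l + 1) := by
  have h2 : a.natAbs * b.natAbs < 2 ^ k * 2 ^ l := Nat.mul_lt_mul'' ha hb
  rw [Int.natAbs_mul, pow_succ, pow_add]
  omega

theorem ht_add_num (p q : ℚ) : (Data.num (p + q)).ht ≤ (Data.num p).ht + (Data.num q).ht := by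
  obtain ⟨k, hk, h1, h2⟩ := exists_height p
  obtain ⟨l, hl, h3, h4⟩ := exists_height q
  have := ht_num_le_of_eq_div (q := p + q) (a := p.num * q.den + q.num * p.den)
    (b := p.den * q.den) (by simp)
    (by
      have h5 : (p.den : ℚ) ≠ 0 := by simp
      have h6 : (q.den : ℚ) ≠ 0 := by simp
      nth_rw 1 [← Rat.num_div_den p, ← Rat.num_div_den q]
      push_cast
      field_simp)
    (natAbs_add_mul_lt h1 h2 h3 h4) (natAbs_mul_lt h2 h4)
  omega

theorem ht_neg_num (q : ℚ) : (Data.num (-q)).ht = (Data.num q).ht := by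
  simp [ht]

theorem ht_mul_num (p q : ℚ) : (Data.num (p * q)).ht ≤ (Data.num p).ht + (Data.num q).ht := by
  obtain ⟨k, hk, h1, h2⟩ := exists_height p
  obtain ⟨l, hl, h3, h4⟩ := exists_height q
  have := ht_num_le_of_eq_div (q := p * q) (a := p.num * q.num)
    (b := p.den * q.den) (by simp)
    (by
      have h5 : (p.den : ℚ) ≠ 0 := by simp
      have h6 : (q.den : ℚ) ≠ 0 := by simp
      nth_rw 1 [← Rat.num_div_den p, ← Rat.num_div_den q]
      push_cast
      field_simp)
    (natAbs_mul_lt h1 h3) (natAbs_mul_lt h2 h4)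
  omega

theorem ht_inv_num (q : ℚ) : (Data.num q⁻¹).ht ≤ (Data.num q).ht := by
  rcases eq_or_ne q 0 with rfl | hq
  · simp
  obtain ⟨l, hl, h3, h4⟩ := exists_height q
  have := ht_num_le_of_eq_div (q := q⁻¹) (a := q.den) (b := q.num) (by simpa using hq)
    (by
      nth_rw 1 [← Rat.num_div_den q]
      simp)
    h4 h3
  omega

theorem ht_add_le (a b : Data) : (add a b).ht ≤ a.ht + b.ht := by
  rcases a with p | _ <;> rcases b with q | _
  · exact ht_add_num p q
  all_goals exact ht_num_zero.trans_le ((two_le_ht _).trans (Nat.le_add_right _ _))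

theorem ht_sub_le (a b : Data) : (sub a b).ht ≤ a.ht + b.ht := by
  rcases a with p | _ <;> rcases b with q | _
  · rw [sub_num, sub_eq_add_neg, ← ht_neg_num q]
    exact ht_add_num p (-q)
  all_goals exact ht_num_zero.trans_le ((two_le_ht _).trans (Nat.le_add_right _ _))

theorem ht_mul_le (a b : Data) : (mul a b).ht ≤ a.ht + b.ht := by
  rcases a with p | _ <;> rcases b with q | _
  · exact ht_mul_num p q
  all_goals exact ht_num_zero.trans_le ((two_le_ht _).trans (Nat.le_add_right _ _))

theorem ht_div_le (a b : Data) : (div a b).ht ≤ a.ht + b.ht := by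
  rcases a with p | _ <;> rcases b with q | _
  · rw [div_num, div_eq_mul_inv]
    exact (ht_mul_num p q⁻¹).trans (Nat.add_le_add_left (ht_inv_num q) _)
  all_goals exact ht_num_zero.trans_le ((two_le_ht _).trans (Nat.le_add_right _ _))

theorem ht_le_le (a b : Data) : (le a b).ht ≤ 2 := by
  rcases a with p | _ <;> rcases b with q | _
  · rw [le_num]; split
    · exact ht_num_one.le
    · exact ht_num_zero.le
  all_goals exact ht_num_zero.le

end Data

theorem PTu.op₂ (o : Op) (F : Data → Data → Data) (hF : F = fun a b => o.eval (.pair a b))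
    (h : ∀ a b, (F a b).ht ≤ a.ht + b.ht) {X : ι → Set Data} {f g : Data → Data}
    (ho : ∀ q, o.eval (.num q) = .num 0 ∨ o.eval (.num q) = .num q)
    (hf : PT rel X f) (hg : PT rel X g) : PT rel X fun v => F (f v) (g v) := by
  subst hF
  refine PTu.comp (g := o.eval) (PTu.op o .X fun v => ?_) (hf.pair hg)
  rw [Polynomial.eval_X]
  cases v with
  | num q =>
    rcases ho q with h' | h' <;> rw [h']
    exact Data.ht_num_zero.trans_le (Data.two_le_ht _)
  | pair a b => have := h a b; simp at this ⊢; omega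

section
variable {X : ι → Set Data} {f g h : Data → Data}

theorem PT.add (hf : PT rel X f) (hg : PT rel X g) : PT rel X fun v => (f v).add (g v) :=
  PTu.op₂ .add _ rfl Data.ht_add_le (fun _ => .inl rfl) hf hg

theorem PT.sub (hf : PT rel X f) (hg : PT rel X g) : PT rel X fun v => (f v).sub (g v) :=
  PTu.op₂ .sub _ rfl Data.ht_sub_le (fun _ => .inl rfl) hf hg

theorem PT.mul (hf : PT rel X f) (hg : PT rel X g) : PT rel X fun v => (f v).mul (g v) :=
  PTu.op₂ .mul _ rfl Data.ht_mul_le (fun _ => .inl rfl) hf hg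

theorem PT.div (hf : PT rel X f) (hg : PT rel X g) : PT rel X fun v => (f v).div (g v) :=
  PTu.op₂ .div _ rfl Data.ht_div_le (fun _ => .inl rfl) hf hg

theorem PT.le (hf : PT rel X f) (hg : PT rel X g) : PT rel X fun v => (f v).le (g v) :=
  PTu.op₂ .le _ rfl (fun a b => (Data.ht_le_le a b).trans
    (by have := a.two_le_ht; change 2 ≤ _; omega)) (fun _ => .inl rfl) hf hg

end

namespace Data

/-- Reversal of a list. -/
def reverse (d : Data) : Data := encList d.toList.reverse
/-- Applying a function to all entries of a list. -/
def map (f : Data → Data) (d : Data) : Data := encList (d.toList.map f)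
/-- Concatenation of two lists. -/
def append (a b : Data) : Data := encList (a.toList ++ b.toList)
/-- Sum of a list of numbers. -/
def sum (d : Data) : Data := d.toList.foldl add (.num 0)
/-- Combining two lists entry by entry. -/
def zipWith (f : Data → Data → Data) (a b : Data) : Data :=
  encList (List.zipWith f a.toList b.toList)
/-- Truth value: only the number `0` is false. -/
def truth : Data → Bool
  | .num q => decide (q ≠ 0)
  | .pair _ _ => true
/-- The entries of a list on which `f` does not return the number `0`. -/
def filter (f : Data → Data) (d : Data) : Data :=
  encList (d.toList.filter fun x => (f x).truth)
/-- Concatenation of a list of lists. -/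
def flatten (d : Data) : Data := encList (d.toList.flatMap toList)
/-- The list of the numbers below the length of a list. -/
def iota (d : Data) : Data := encList ((List.range d.toList.length).map fun i : ℕ => .num i)
/-- The first entry of a list that is not the number `0`; the number `0` if there is none. -/
def lead (d : Data) : Data := d.toList.foldl (fun a x => cond a a x) (.num 0)
/-- The last entry of a list. -/
def last (d : Data) : Data := d.toList.foldl (fun _ x => x) (.num 0)
/-- The list `b` without as many entries as `a` has. -/
def dropLen (a b : Data) : Data := a.toList.foldl (fun d _ => d.snd) b

theorem cond_eq_ite (c a b : Data) : cond c a b = if c.truth then a else b := by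
  rcases c with q | _
  · by_cases h : q = 0 <;> simp [cond, truth, h]
  · rfl

theorem foldl_pair (l : List Data) (d : List Data) :
    l.foldl (fun acc x => Data.pair x acc) (encList d) = encList (l.reverse ++ d) := by
  induction l generalizing d with
  | nil => rfl
  | cons x l ih => simpa [encList] using ih (x :: d)

theorem foldl_pair_zero (l : List Data) :
    l.foldl (fun acc x => Data.pair x acc) (.num 0) = encList l.reverse := by
  simpa [encList] using foldl_pair l []

theorem foldl_map_pair (f : Data → Data) (l : List Data) :
    l.foldl (fun acc x => Data.pair (f x) acc) (.num 0) = encList (l.map f).reverse := by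
  rw [← foldl_pair_zero, List.foldl_map]

theorem ht_encList_toList_le (d : Data) : (encList d.toList).ht ≤ d.ht := by
  induction d with
  | num q => exact ht_num_zero.trans_le (two_le_ht _)
  | pair a l _ ih => simp [encList]; omega

theorem ht_append_le (a b : Data) : (append a b).ht ≤ a.ht + b.ht := by
  have h1 := ht_encList_toList_le a
  have h2 := ht_encList_toList_le b
  simp only [append, ht_encList, List.map_append, List.sum_append] at *
  omega

end Data

section
variable {X : ι → Set Data} {l a b : Data → Data}

theorem PT.reverse (hl : PT rel X l) : PT rel X fun v => (l v).reverse := by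
  have := PT.fold_add (rel := rel) (X := X) (f := fun _ acc x => .pair x acc) (l := l)
    (a := fun _ => .num 0) (.pair (.snd (.snd .id)) (.fst (.snd .id)))
    ⟨1 + .X, fun v acc x => by simp; omega⟩ hl (.const _)
  simpa only [Data.foldl_pair_zero] using! this

theorem PT.map {f : Data → Data → Data} (hf : PTu rel fun w => f w.fst w.snd) (hl : PT rel X l) :
    PT rel X fun v => (l v).map (f v) := by
  obtain ⟨p, hp⟩ := hf.ht_le
  have := PT.reverse <| PT.fold_add (rel := rel) (X := X)
    (f := fun v acc x => .pair (f v x) acc) (l := l) (a := fun _ => .num 0)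
    (.pair (hf.comp₂ (.fst .id) (.snd (.snd .id))) (.fst (.snd .id)))
    ⟨1 + p.comp (1 + .X), fun v acc x => by
      have := hp (.pair v x)
      simp [add_assoc] at this ⊢; omega⟩ hl (.const _)
  simpa only [Data.foldl_map_pair, Data.reverse, Data.toList_encList, List.reverse_reverse] using!
    this

theorem PT.append (ha : PT rel X a) (hb : PT rel X b) : PT rel X fun v => (a v).append (b v) := by
  have := PT.fold_add (rel := rel) (X := X) (f := fun _ acc x => .pair x acc)
    (.pair (.snd (.snd .id)) (.fst (.snd .id)))
    ⟨1 + .X, fun v acc x => by simp; omega⟩ ha.reverse hb.reverse.reverse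
  simpa only [Data.foldl_pair, Data.reverse, Data.toList_encList, List.reverse_reverse] using! this

theorem PT.sum (hl : PT rel X l) : PT rel X fun v => (l v).sum :=
  PT.fold_add (f := fun _ acc x => acc.add x) (.add (.fst (.snd .id)) (.snd (.snd .id)))
    ⟨.X, fun v acc x => by have := acc.ht_add_le x; simp; omega⟩ hl (.const _)

theorem PT.lead (hl : PT rel X l) : PT rel X fun v => (l v).lead :=
  PT.fold_add (f := fun _ acc x => Data.cond acc acc x)
    (.cond (.fst (.snd .id)) (.fst (.snd .id)) (.snd (.snd .id)))
    ⟨.X, fun v acc x => by have := Data.ht_cond_le acc acc x; simp; omega⟩ hl (.const _)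

theorem PT.last (hl : PT rel X l) : PT rel X fun v => (l v).last :=
  PT.fold_add (f := fun _ _ x => x) (.snd (.snd .id))
    ⟨.X, fun v acc x => by simp; omega⟩ hl (.const _)

theorem PT.dropLen (ha : PT rel X a) (hb : PT rel X b) :
    PT rel X fun v => (a v).dropLen (b v) :=
  PT.fold_add (f := fun _ acc _ => acc.snd) (.snd (.fst (.snd .id)))
    ⟨0, fun v acc x => by simpa using acc.ht_snd_le⟩ ha hb

theorem PT.filter {f : Data → Data → Data} (hf : PTu rel fun w => f w.fst w.snd)
    (hl : PT rel X l) : PT rel X fun v => (l v).filter (f v) := by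
  have := PT.reverse <| PT.fold_add (rel := rel) (X := X)
    (f := fun v acc x => Data.cond (f v x) (.pair x acc) acc) (l := l) (a := fun _ => .num 0)
    (.cond (hf.comp₂ (.fst .id) (.snd (.snd .id))) (.pair (.snd (.snd .id)) (.fst (.snd .id)))
      (.fst (.snd .id)))
    ⟨1 + .X, fun v acc x => by
      have := Data.ht_cond_le (f v x) (.pair x acc) acc
      simp at this ⊢; omega⟩ hl (.const _)
  have h : ∀ v (d m : List Data), d.foldl
      (fun acc x => Data.cond (f v x) (.pair x acc) acc) (encList m) =
      encList ((d.filter fun x => (f v x).truth).reverse ++ m) := by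
    intro v d
    induction d with
    | nil => simp
    | cons x d ih =>
      intro m
      rw [List.foldl_cons, Data.cond_eq_ite]
      by_cases hx : (f v x).truth
      · simpa [hx, encList] using ih (x :: m)
      · simpa [hx] using ih m
  have h' : ∀ v (d : List Data), d.foldl
      (fun acc x => Data.cond (f v x) (.pair x acc) acc) (.num 0) =
      encList (d.filter fun x => (f v x).truth).reverse := by
    intro v d; simpa [encList] using h v d []
  simpa only [h', Data.reverse, Data.toList_encList, List.reverse_reverse] using! this

theorem PT.flatten (hl : PT rel X l) : PT rel X fun v => (l v).flatten := by
  have := PT.fold_add (rel := rel) (X := X) (f := fun _ acc x => Data.append x acc)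
    (a := fun _ => .num 0) (.append (.snd (.snd .id)) (.fst (.snd .id)))
    ⟨.X, fun v acc x => by have := x.ht_append_le acc; simp; omega⟩ hl.reverse (.const _)
  have h : ∀ (d : List Data), d.reverse.foldl (fun acc x => Data.append x acc) (.num 0) =
      encList (d.flatMap Data.toList) := by
    intro d
    induction d with
    | nil => rfl
    | cons x d ih => rw [List.reverse_cons, List.foldl_append, ih]; simp [Data.append]
  simpa only [h, Data.reverse, Data.toList_encList] using! this

/-- Pairing up two lists. -/
theorem PT.zip (ha : PT rel X a) (hb : PT rel X b) :
    PT rel X fun v => (a v).zipWith .pair (b v) := by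
  let f : Data → Data → Data → Data := fun _ acc x => Data.cond acc.fst.isPair
    (.pair acc.fst.snd (.pair (.pair x acc.fst.fst) acc.snd)) acc
  have hf : PTu rel (fun w => f w.fst w.snd.fst w.snd.snd) :=
    .cond (.isPair (.fst (.fst (.snd .id))))
      (.pair (.snd (.fst (.fst (.snd .id)))) (.pair (.pair (.snd (.snd .id))
        (.fst (.fst (.fst (.snd .id))))) (.snd (.fst (.snd .id))))) (.fst (.snd .id))
  have := PT.reverse <| PT.snd <| PT.fold_add (rel := rel) (X := X) hf
    ⟨2 + .X, fun v acc x => by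
      simp only [f]
      rcases acc with q | ⟨(q | ⟨y, r⟩), o⟩ <;>
        (simp [Data.cond, Data.isPair, Data.fst]; try omega)⟩ ha (hb.pair (.const (.num 0)))
  have h : ∀ v (d : List Data) (r : Data) (o : List Data),
      (d.foldl (f v) (.pair r (encList o))).snd =
      encList ((List.zipWith .pair d r.toList).reverse ++ o) := by
    intro v d
    induction d with
    | nil => simp
    | cons x d ih =>
      intro r o
      cases r with
      | num q =>
        have : ∀ d : List Data, d.foldl (f v) (.pair (.num q) (encList o)) =
            .pair (.num q) (encList o) := by
          intro d
          induction d with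
          | nil => rfl
          | cons y d ih => simp [f, Data.isPair, Data.cond]; exact ih
        rw [this]
        simp
      | pair y r =>
        have h := ih r (.pair x y :: o)
        simpa [f, Data.isPair, Data.cond, encList] using h
  have h' : ∀ v (d : List Data) (r : Data),
      (d.foldl (f v) (.pair r (.num 0))).snd =
      encList (List.zipWith .pair d r.toList).reverse := by
    intro v d r; simpa [encList] using h v d r []
  simpa only [h', Data.reverse, Data.toList_encList, List.reverse_reverse] using! this

theorem PT.zipWith {f : Data → Data → Data → Data}
    (hf : PTu rel fun w => f w.fst w.snd.fst w.snd.snd) (ha : PT rel X a) (hb : PT rel X b) :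
    PT rel X fun v => (a v).zipWith (f v) (b v) := by
  have := PT.map (f := fun v w => f v w.fst w.snd)
    (hf.comp₃ (.fst .id) (.fst (.snd .id)) (.snd (.snd .id))) (PT.zip ha hb)
  simpa only [Data.map, Data.zipWith, Data.toList_encList, List.map_zipWith, Data.fst_pair,
    Data.snd_pair] using! this

theorem Data.ht_num_natCast_le (n : ℕ) : (Data.num n).ht ≤ n + 2 := by
  have : Nat.size n ≤ n := Nat.size_le.2 Nat.lt_two_pow_self
  simp [Data.ht]
  omega

theorem PT.iota (hl : PT rel X l) : PT rel X fun v => (l v).iota := by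
  let f : Data → Data → Data → Data := fun _ acc _ =>
    .pair (acc.fst.add (.num 1)) (.pair acc.fst acc.snd)
  have hf : PTu rel (fun w => f w.fst w.snd.fst w.snd.snd) :=
    .pair (.add (.fst (.fst (.snd .id))) (.const _))
      (.pair (.fst (.fst (.snd .id))) (.snd (.fst (.snd .id))))
  have h : ∀ v (d : List Data), d.foldl (f v) (.pair (.num 0) (.num 0)) =
      .pair (.num d.length) (encList ((List.range d.length).map fun i : ℕ => Data.num i).reverse) := by
    intro v d
    induction d using List.reverseRecOn with
    | nil => rfl
    | append_singleton d x ih => simp [ih, f, List.range_succ, encList]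
  have := PT.reverse <| PT.snd <| PT.fold (rel := rel) (X := X) hf hl
    (.const (.pair (.num 0) (.num 0))) fun i => by
      obtain ⟨p, hp⟩ := PTC.ht_le hl i
      refine ⟨5 + p + p * (3 + p), fun v hv l₁ l₂ hd => ?_⟩
      have hlen : l₁.length ≤ p.eval v.ht := by
        have h1 := congrArg List.length hd
        have h2 := (l v).length_toList_le
        have h3 := hp v hv
        simp at h1
        omega
      rw [h v, Data.ht_pair, Data.ht_encList]
      have h1 : (((List.range l₁.length).map fun i : ℕ => Data.num i).reverse.map
          fun a => a.ht + 1).sum ≤ l₁.length * (3 + l₁.length) := by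
        refine (List.sum_le_card_nsmul _ (3 + l₁.length) ?_).trans (by simp)
        intro x hx
        simp at hx
        obtain ⟨i, hi, rfl⟩ := hx
        have := Data.ht_num_natCast_le i
        omega
      have h2 := Data.ht_num_natCast_le l₁.length
      have h3 : l₁.length * (3 + l₁.length) ≤ p.eval v.ht * (3 + p.eval v.ht) :=
        Nat.mul_le_mul hlen (by omega)
      simp only [Polynomial.eval_add, Polynomial.eval_mul, Polynomial.eval_ofNat]
      omega
  simpa only [h, Data.reverse, Data.toList_encList, List.reverse_reverse, Data.snd_pair] using! this

end

namespace Data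

section
variable (f : Data → Data) (g : Data → Data → Data) (l m : List Data)

@[simp] theorem map_encList : (encList l).map f = encList (l.map f) := by simp [map]
@[simp] theorem append_encList : (encList l).append (encList m) = encList (l ++ m) := by
  simp [append]
@[simp] theorem zipWith_encList :
    (encList l).zipWith g (encList m) = encList (List.zipWith g l m) := by simp [zipWith]
@[simp] theorem reverse_encList : (encList l).reverse = encList l.reverse := by simp [reverse]

end

theorem sum_encList_num (l : List ℚ) : (encList (l.map .num)).sum = .num l.sum := by
  have : ∀ (l : List ℚ) (q : ℚ), (l.map Data.num).foldl add (.num q) = .num (q + l.sum) := by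
    intro l
    induction l with
    | nil => simp
    | cons x l ih => intro q; simp [ih, add_assoc]
  simpa [sum] using! this l 0

theorem dropLen_encList (l m : List Data) :
    (encList l).dropLen (encList m) = encList (m.drop l.length) := by
  simp only [dropLen, toList_encList]
  induction l generalizing m with
  | nil => simp
  | cons x l ih =>
    cases m with
    | nil => simpa [encList, snd] using ih []
    | cons y m => simpa [encList] using ih m

end Data

/-! ### The Faddeev–LeVerrier recursion -/

section FaddeevLeVerrier

variable {q : ℕ} {F : Type*} [Field F]

/-- The matrices `M₀ = 1`, `Mₖ₊₁ = cₖ₊₁ - G Mₖ` with `cₖ₊₁ = tr (G Mₖ) / (k + 1)`; the numbers `cₖ`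
are the elementary symmetric functions of the eigenvalues of `G`. -/
def flMatrix (G : Matrix (Fin q) (Fin q) F) : ℕ → Matrix (Fin q) (Fin q) F
  | 0 => 1
  | k + 1 => (trace (G * flMatrix G k) / ((k : F) + 1)) • (1 : Matrix (Fin q) (Fin q) F) -
      G * flMatrix G k

/-- The number `cₖ₊₁ = tr (G Mₖ) / (k + 1)`. -/
def flCoeff (G : Matrix (Fin q) (Fin q) F) (k : ℕ) : F :=
  trace (G * flMatrix G k) / ((k : F) + 1)

theorem flMatrix_succ (G : Matrix (Fin q) (Fin q) F) (k : ℕ) :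
    flMatrix G (k + 1) = flCoeff G k • (1 : Matrix (Fin q) (Fin q) F) - G * flMatrix G k := rfl

theorem flMatrix_map (G : Matrix (Fin q) (Fin q) ℚ) (k : ℕ) :
    flMatrix (G.map fun a : ℚ => (a : ℝ)) k = (flMatrix G k).map fun a : ℚ => (a : ℝ) := by
  induction k with
  | zero => ext i j; by_cases h : i = j <;> simp [flMatrix, Matrix.one_apply, h]
  | succ k ih =>
    have h : (G.map fun a : ℚ => (a : ℝ)) * flMatrix (G.map fun a : ℚ => (a : ℝ)) k =
        (G * flMatrix G k).map fun a : ℚ => (a : ℝ) := by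
      rw [ih]; ext i j; simp [Matrix.mul_apply]
    rw [flMatrix, flMatrix, h]
    ext i j
    by_cases h : i = j <;> simp [h, trace]

theorem flCoeff_map (G : Matrix (Fin q) (Fin q) ℚ) (k : ℕ) :
    flCoeff (G.map fun a : ℚ => (a : ℝ)) k = ((flCoeff G k : ℚ) : ℝ) := by
  have h : (G.map fun a : ℚ => (a : ℝ)) * flMatrix (G.map fun a : ℚ => (a : ℝ)) k =
      (G * flMatrix G k).map fun a : ℚ => (a : ℝ) := by
    rw [flMatrix_map]; ext i j; simp [Matrix.mul_apply]
  rw [flCoeff, flCoeff, h]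
  simp [trace]

theorem flMatrix_transpose {G : Matrix (Fin q) (Fin q) F} (hG : Gᵀ = G) (k : ℕ) :
    (flMatrix G k)ᵀ = flMatrix G k ∧ G * flMatrix G k = flMatrix G k * G := by
  induction k with
  | zero => simp [flMatrix]
  | succ k ih =>
    constructor
    · rw [flMatrix_succ, transpose_sub, transpose_smul, transpose_one, transpose_mul, ih.1, hG, ih.2]
    · rw [flMatrix_succ, mul_sub, sub_mul, mul_assoc, ← ih.2]
      simp

end FaddeevLeVerrier

section Eigenvalues

variable {q : ℕ} (lam : Fin q → ℝ)

/-- The elementary symmetric functions of `q` numbers. -/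
noncomputable def elemSymm (k : ℕ) : ℝ := (Finset.univ.val.map lam).esymm k

/-- The polynomials `p₀ = 1`, `pₖ₊₁ = eₖ₊₁ - X pₖ`, for the elementary symmetric functions `eₖ`. -/
noncomputable def flPoly : ℕ → Polynomial ℝ
  | 0 => 1
  | k + 1 => .C (elemSymm lam (k + 1)) - .X * flPoly k

theorem elemSymm_zero : elemSymm lam 0 = 1 := by simp [elemSymm, Multiset.esymm]

theorem eval_flPoly (k : ℕ) (x : ℝ) :
    (flPoly lam k).eval x = ∑ j ∈ Finset.range (k + 1), (-1) ^ j * elemSymm lam (k - j) * x ^ j := by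
  induction k with
  | zero => simp [flPoly, elemSymm_zero]
  | succ k ih =>
    rw [Finset.sum_range_succ']
    simp only [flPoly, Polynomial.eval_sub, Polynomial.eval_C, Polynomial.eval_mul,
      Polynomial.eval_X, ih, Nat.add_sub_add_right, Finset.mul_sum]
    rw [sub_eq_neg_add, ← Finset.sum_neg_distrib]
    congr 1
    · refine Finset.sum_congr rfl fun j _ => ?_
      ring
    · simp

/-- Newton's identities, in the form needed for the recursion. -/
theorem sum_mul_eval_flPoly (k : ℕ) :
    ∑ i, lam i * (flPoly lam k).eval (lam i) = ((k : ℝ) + 1) * elemSymm lam (k + 1) := by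
  have h := congrArg (MvPolynomial.aeval lam) (MvPolynomial.mul_esymm_eq_sum (Fin q) ℝ (k + 1))
  have e1 : ∀ n, MvPolynomial.aeval lam (MvPolynomial.esymm (Fin q) ℝ n) = elemSymm lam n :=
    fun n => MvPolynomial.aeval_esymm_eq_multiset_esymm _ _ _ _
  have e2 : ∀ n, MvPolynomial.aeval lam (MvPolynomial.psum (Fin q) ℝ n) = ∑ i, lam i ^ n := by
    intro n; simp [MvPolynomial.psum]
  simp only [map_mul, map_sum, map_pow, map_neg, map_one, map_natCast, e1, e2] at h
  rw [Finset.sum_filter, Finset.Nat.sum_antidiagonal_eq_sum_range_succ_mk, Finset.sum_range_succ]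
    at h
  push_cast at h
  rw [h]
  simp only [lt_irrefl, if_false, add_zero, eval_flPoly, Finset.mul_sum]
  rw [Finset.sum_comm, ← Finset.sum_range_reflect]
  refine Finset.sum_congr rfl fun j hj => ?_
  have hj : j ≤ k := Nat.lt_succ_iff.1 (Finset.mem_range.1 hj)
  have h1 : k + 1 - 1 - j = k - j := by omega
  have h2 : k - (k - j) = j := by omega
  have h3 : k + 1 - j = (k - j) + 1 := by omega
  rw [if_pos (by omega), h1, h2, h3, Finset.mul_sum]
  have h4 : (-1 : ℝ) ^ (k + 1 + 1) * (-1) ^ j = (-1) ^ (k - j) := by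
    obtain ⟨m, rfl⟩ := Nat.exists_eq_add_of_le hj
    rw [Nat.add_sub_cancel_left, ← pow_add, show j + m + 1 + 1 + j = m + 2 * (j + 1) by ring,
      pow_add, pow_mul]
    simp
  refine Finset.sum_congr rfl fun i _ => ?_
  rw [← h4]
  ring

/-- If `e_r` is the last elementary symmetric function that does not vanish, then `p_r` vanishes at
all nonzero arguments. -/
theorem eval_flPoly_eq_zero {r : ℕ} (hr : r ≤ q)
    (h : ∀ j, r < j → j ≤ q → elemSymm lam j = 0) (i : Fin q) :
    lam i * (flPoly lam r).eval (lam i) = 0 := by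
  have h1 := congrArg (Polynomial.eval (lam i))
    (Multiset.prod_X_sub_X_eq_sum_esymm (Finset.univ.val.map lam))
  have h2 : Polynomial.eval (lam i) (((Finset.univ.val.map lam).map fun t =>
      Polynomial.X - Polynomial.C t).prod) = 0 := by
    rw [Polynomial.eval_multiset_prod, Multiset.prod_eq_zero_iff]
    simp only [Multiset.map_map, Multiset.mem_map]
    exact ⟨i, by simp, by simp⟩
  rw [h2, Polynomial.eval_finsetSum] at h1
  simp only [Multiset.card_map, Finset.card_val, Finset.card_univ, Fintype.card_fin,
    Polynomial.eval_mul, Polynomial.eval_pow, Polynomial.eval_neg, Polynomial.eval_one,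
    Polynomial.eval_C, Polynomial.eval_X] at h1
  obtain ⟨s, rfl⟩ := Nat.exists_eq_add_of_le hr
  have h3 : ∑ j ∈ Finset.range (r + s + 1), (-1 : ℝ) ^ j * (elemSymm lam j * lam i ^ (r + s - j)) =
      ∑ j ∈ Finset.range (r + 1), (-1 : ℝ) ^ j * (elemSymm lam j * lam i ^ (r + s - j)) := by
    symm
    refine Finset.sum_subset (by intro j; simp; omega) fun j hj hj' => ?_
    simp at hj hj'
    rw [h j (by omega) (by omega)]
    simp
  have h4 : ∑ j ∈ Finset.range (r + 1), (-1 : ℝ) ^ j * (elemSymm lam j * lam i ^ (r + s - j)) =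
      lam i ^ s * (-1) ^ r * (flPoly lam r).eval (lam i) := by
    rw [eval_flPoly, Finset.mul_sum, ← Finset.sum_range_reflect]
    refine Finset.sum_congr rfl fun j hj => ?_
    have hj : j ≤ r := Nat.lt_succ_iff.1 (Finset.mem_range.1 hj)
    obtain ⟨m, rfl⟩ := Nat.exists_eq_add_of_le hj
    have e1 : j + m + 1 - 1 - j = m := by omega
    have e2 : j + m + s - m = s + j := by omega
    have e3 : j + m - j = m := by omega
    have e4 : (-1 : ℝ) ^ (j + m) * (-1) ^ j = (-1) ^ m := by
      rw [← pow_add, show j + m + j = m + 2 * j by ring, pow_add, pow_mul]; simp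
    rw [e1, e2, e3, ← e4, pow_add]
    ring
  have h5 : lam i ^ s * (-1) ^ r * (flPoly lam r).eval (lam i) = 0 := by
    rw [← h4, ← h3]; exact h1.symm
  rcases mul_eq_zero.1 h5 with h6 | h6
  · rcases mul_eq_zero.1 h6 with h7 | h7
    · simp [eq_zero_of_pow_eq_zero h7]
    · simp at h7
  · simp [h6]

end Eigenvalues

section Symmetric

variable {q : ℕ}

/-- A real symmetric matrix is diagonalizable: traces of polynomials in it are sums over the
eigenvalues, and a polynomial that vanishes at the eigenvalues annihilates the matrix. -/
theorem exists_eigenvalues {G : Matrix (Fin q) (Fin q) ℝ} (hG : Gᵀ = G) :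
    ∃ lam : Fin q → ℝ, ∀ p : Polynomial ℝ,
      trace (Polynomial.aeval G p) = ∑ i, p.eval (lam i) ∧
      ((∀ i, p.eval (lam i) = 0) → Polynomial.aeval G p = 0) := by
  have hH : G.IsHermitian := by
    rw [Matrix.IsHermitian, conjTranspose_eq_transpose_of_trivial, hG]
  refine ⟨hH.eigenvalues, fun p => ?_⟩
  have h1 := hH.spectral_theorem
  set U := hH.eigenvectorUnitary
  set e := (Unitary.conjStarAlgAut ℝ (Matrix (Fin q) (Fin q) ℝ) U)
  have h2 : Polynomial.aeval G p =
      e (diagonal fun i => p.eval (hH.eigenvalues i)) := by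
    have h3 : diagonal (fun i => p.eval (hH.eigenvalues i)) =
        Polynomial.aeval (diagonal (RCLike.ofReal ∘ hH.eigenvalues) : Matrix (Fin q) (Fin q) ℝ) p := by
      have := Polynomial.aeval_algHom_apply (diagonalAlgHom (n := Fin q) (α := ℝ) ℝ)
        (hH.eigenvalues) p
      have h4 : Polynomial.aeval hH.eigenvalues p = fun i => p.eval (hH.eigenvalues i) := by
        funext i
        simp
      rw [h4] at this
      exact this.symm
    conv_lhs => rw [h1]
    rw [h3]
    exact Polynomial.aeval_algHom_apply e.toAlgEquiv.toAlgHom _ p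
  constructor
  · rw [h2, Unitary.conjStarAlgAut_apply, trace_mul_cycle]
    simp [trace]
  · intro hp
    rw [h2]
    simp [hp]

theorem flMatrix_eq_aeval {G : Matrix (Fin q) (Fin q) ℝ} {lam : Fin q → ℝ}
    (h : ∀ p : Polynomial ℝ, trace (Polynomial.aeval G p) = ∑ i, p.eval (lam i)) (k : ℕ) :
    flMatrix G k = Polynomial.aeval G (flPoly lam k) ∧ flCoeff G k = elemSymm lam (k + 1) := by
  have hc : ∀ k, flMatrix G k = Polynomial.aeval G (flPoly lam k) →
      flCoeff G k = elemSymm lam (k + 1) := by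
    intro k hk
    have h1 := h (.X * flPoly lam k)
    simp only [map_mul, Polynomial.aeval_X, Polynomial.eval_mul, Polynomial.eval_X,
      sum_mul_eval_flPoly] at h1
    rw [flCoeff, hk, h1]
    field_simp
  induction k with
  | zero => exact ⟨by simp [flMatrix, flPoly], hc 0 (by simp [flMatrix, flPoly])⟩
  | succ k ih =>
    have : flMatrix G (k + 1) = Polynomial.aeval G (flPoly lam (k + 1)) := by
      rw [flMatrix_succ, ih.2, ih.1, flPoly]
      simp [Algebra.algebraMap_eq_smul_one]
    exact ⟨this, hc _ this⟩

/-- After `k` steps: the last pair `(Mⱼ, cⱼ₊₁)` with `cⱼ₊₁ ≠ 0`, initially `(1, 1)`. -/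
def flBest (G : Matrix (Fin q) (Fin q) ℚ) : ℕ → Matrix (Fin q) (Fin q) ℚ × ℚ
  | 0 => (1, 1)
  | k + 1 => if flCoeff G k = 0 then flBest G k else (flMatrix G k, flCoeff G k)

theorem flBest_eq (G : Matrix (Fin q) (Fin q) ℚ) (k : ℕ) :
    ∃ r ≤ k, (∀ j, r ≤ j → j < k → flCoeff G j = 0) ∧
      ((r = 0 ∧ flBest G k = (1, 1)) ∨
        ∃ s, r = s + 1 ∧ flCoeff G s ≠ 0 ∧ flBest G k = (flMatrix G s, flCoeff G s)) := by
  induction k with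
  | zero => exact ⟨0, le_rfl, by omega, .inl ⟨rfl, rfl⟩⟩
  | succ k ih =>
    by_cases hc : flCoeff G k = 0
    · obtain ⟨r, hr, h1, h2⟩ := ih
      refine ⟨r, by omega, fun j hj hjk => ?_, by simpa [flBest, hc] using h2⟩
      rcases Nat.lt_succ_iff_lt_or_eq.1 hjk with h | rfl
      · exact h1 j hj h
      · exact hc
    · exact ⟨k + 1, le_rfl, by omega, .inr ⟨k, rfl, hc, by simp [flBest, hc]⟩⟩

/-- The outcome `(M, c)` of the recursion for a symmetric matrix `G` is a multiple of an inverse of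
`G` on the range of `G`. -/
theorem flBest_spec {G : Matrix (Fin q) (Fin q) ℚ} (hG : Gᵀ = G) :
    (flBest G q).2 ≠ 0 ∧ (flBest G q).1ᵀ = (flBest G q).1 ∧
      ((flBest G q).2 • (1 : Matrix (Fin q) (Fin q) ℚ) - G * (flBest G q).1) * G = 0 := by
  have hG' : (G.map fun a : ℚ => (a : ℝ))ᵀ = G.map fun a : ℚ => (a : ℝ) := by
    rw [← transpose_map, hG]
  obtain ⟨lam, hlam⟩ := exists_eigenvalues hG'
  have hfl := flMatrix_eq_aeval fun p => (hlam p).1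
  obtain ⟨r, hr, h0, h1⟩ := flBest_eq G q
  have hz : ∀ i, lam i * (flPoly lam r).eval (lam i) = 0 := by
    refine eval_flPoly_eq_zero lam hr fun j hj hjq => ?_
    obtain ⟨j, rfl⟩ : ∃ m, j = m + 1 := ⟨j - 1, by omega⟩
    rw [← (hfl j).2, flCoeff_map, h0 j (by omega) (by omega), Rat.cast_zero]
  have hM : flMatrix G r * G = 0 := by
    have h2 : flMatrix (G.map fun a : ℚ => (a : ℝ)) r * (G.map fun a : ℚ => (a : ℝ)) = 0 := by
      have := (hlam (flPoly lam r * .X)).2 fun i => by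
        simpa [mul_comm] using hz i
      simpa [(hfl r).1] using this
    rw [flMatrix_map] at h2
    ext i j
    have h3 := congrFun (congrFun h2 i) j
    simp only [Matrix.mul_apply, Matrix.map_apply, Matrix.zero_apply] at h3 ⊢
    exact_mod_cast h3
  rcases h1 with ⟨rfl, h1⟩ | ⟨s, rfl, h2, h1⟩
  · rw [h1]
    have : G = 0 := by simpa [flMatrix] using hM
    simp [this]
  · rw [h1]
    exact ⟨h2, (flMatrix_transpose hG s).1, by rw [← flMatrix_succ, hM]⟩

/-- Least squares by the Faddeev–LeVerrier recursion: with the outcome `(M, c)` for `BᵀB`, the vector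
`M Bᵀ y / c` solves the normal equations. -/
theorem flBest_normal_eq {m : ℕ} (B : Matrix (Fin m) (Fin q) ℚ) (y : Fin m → ℚ) :
    Bᵀ *ᵥ (B *ᵥ ((flBest (Bᵀ * B) q).2⁻¹ • ((flBest (Bᵀ * B) q).1ᵀ *ᵥ (Bᵀ *ᵥ y)))) = Bᵀ *ᵥ y := by
  have hG : (Bᵀ * B)ᵀ = Bᵀ * B := by simp
  obtain ⟨hc, hT, h⟩ := flBest_spec hG
  set M := (flBest (Bᵀ * B) q).1
  set c := (flBest (Bᵀ * B) q).2
  set N := c • (1 : Matrix (Fin q) (Fin q) ℚ) - (Bᵀ * B) * M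
  have h1 : N * Bᵀ = 0 := by
    rw [← self_mul_conjTranspose_eq_zero, conjTranspose_eq_transpose_of_trivial, transpose_mul,
      transpose_transpose, Matrix.mul_assoc, ← Matrix.mul_assoc Bᵀ, ← Matrix.mul_assoc, h,
      Matrix.zero_mul]
  have h2 : N *ᵥ (Bᵀ *ᵥ y) = 0 := by rw [mulVec_mulVec, h1, zero_mulVec]
  simp only [N, sub_mulVec, smul_mulVec, one_mulVec] at h2
  rw [hT, mulVec_smul, mulVec_smul, mulVec_mulVec (Bᵀ *ᵥ y), mulVec_mulVec, ← Matrix.mul_assoc,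
    ← sub_eq_zero.1 h2, smul_smul, inv_mul_cancel₀ hc, one_smul]

end Symmetric

/-! ### Linear algebra on encoded matrices -/

theorem zipWith_ofFn {α β γ : Type*} {n : ℕ} (g : α → β → γ) (a : Fin n → α) (b : Fin n → β) :
    List.zipWith g (List.ofFn a) (List.ofFn b) = List.ofFn fun i => g (a i) (b i) := by
  apply List.ext_getElem <;> simp

namespace Data

/-- The inner product of two vectors. -/
def dot (u v : Data) : Data := (u.zipWith mul v).sum

/-- The product `Bᵀ v`, for a matrix `B` given by its columns. -/
def tmul (B v : Data) : Data := B.map fun a => a.dot v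

/-- The columns of `Bᵀ B'`, for matrices given by their columns. -/
def tmulMat (B B' : Data) : Data := B'.map fun a => B.tmul a

/-- The identity matrix, with as many columns as `B` has. -/
def ident (B : Data) : Data :=
  B.iota.map fun i => B.iota.map fun j => (i.le j).mul (j.le i)

/-- One step of the Faddeev–LeVerrier recursion for the matrix `G`; the accumulator is
`(Mₖ, (k + 1, (best matrix, best coefficient)))`. -/
def flStep (G acc : Data) : Data :=
  let N := G.tmulMat acc.fst
  let c := (G.zipWith dot acc.fst).sum.div acc.snd.fst
  .pair (G.ident.zipWith (fun u w => u.zipWith (fun x y => (c.mul x).sub y) w) N)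
    (.pair (acc.snd.fst.add (.num 1)) (cond c (.pair acc.fst c) acc.snd.snd))

/-- The outcome of the Faddeev–LeVerrier recursion. -/
def flRun (G : Data) : Data :=
  (G.toList.foldl (fun acc _ => G.flStep acc)
    (.pair G.ident (.pair (.num 1) (.pair G.ident (.num 1))))).snd.snd

/-- A least squares solution for `(B, y)`. -/
def leastSquares (v : Data) : Data :=
  ((v.fst.tmulMat v.fst).flRun.fst.tmul (v.fst.tmul v.snd)).map fun x =>
    x.div (v.fst.tmulMat v.fst).flRun.snd

variable {m q r : ℕ}

theorem dot_encVec (u v : Fin m → ℚ) : dot (encVec u) (encVec v) = .num (u ⬝ᵥ v) := by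
  have : List.ofFn (fun i => Data.num (u i * v i)) = (List.ofFn fun i => u i * v i).map .num := by
    rw [List.map_ofFn]; rfl
  simp only [dot, encVec, zipWith_encList, zipWith_ofFn, mul_num, this, sum_encList_num,
    List.sum_ofFn, dotProduct]

theorem map_encVec (f : ℚ → ℚ) (g : Data → Data) (h : ∀ x, g (.num x) = .num (f x))
    (v : Fin m → ℚ) : (encVec v).map g = encVec fun i => f (v i) := by
  simp only [encVec, map_encList, List.map_ofFn]
  congr 2
  funext i
  exact h _

theorem tmul_encMatrix (B : Matrix (Fin m) (Fin q) ℚ) (v : Fin m → ℚ) :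
    tmul (encMatrix B) (encVec v) = encVec (Bᵀ *ᵥ v) := by
  simp only [tmul, encMatrix, map_encList, List.map_ofFn]
  congr 2
  funext j
  exact dot_encVec _ _

theorem tmulMat_encMatrix (B : Matrix (Fin m) (Fin q) ℚ) (B' : Matrix (Fin m) (Fin r) ℚ) :
    tmulMat (encMatrix B) (encMatrix B') = encMatrix (Bᵀ * B') := by
  conv_lhs => rw [tmulMat, encMatrix.eq_def B', map_encList, List.map_ofFn]
  conv_rhs => rw [encMatrix]
  congr 2
  funext j
  exact tmul_encMatrix B fun i => B' i j

theorem iota_encList_ofFn {n : ℕ} (f : Fin n → Data) :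
    (encList (List.ofFn f)).iota = encList (List.ofFn fun i : Fin n => .num (i : ℕ)) := by
  simp only [iota, toList_encList, List.length_ofFn]
  congr 1
  apply List.ext_getElem <;> simp

theorem ident_encMatrix (B : Matrix (Fin m) (Fin q) ℚ) :
    ident (encMatrix B) = encMatrix (1 : Matrix (Fin q) (Fin q) ℚ) := by
  simp only [ident, encMatrix, encVec, iota_encList_ofFn, map_encList, List.map_ofFn]
  congr 2
  funext j
  simp only [Function.comp]
  congr 2
  funext i
  rcases lt_trichotomy i j with h | rfl | h
  · simp [h.ne, h.le, h.not_ge]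
  · simp
  · simp [h.ne', h.le, h.not_ge]

theorem zipWith_encMatrix (f : ℚ → ℚ → ℚ) (g : Data → Data → Data)
    (h : ∀ x y, g (.num x) (.num y) = .num (f x y)) (B B' : Matrix (Fin m) (Fin q) ℚ) :
    (encMatrix B).zipWith (fun u w => u.zipWith g w) (encMatrix B') =
      encMatrix (Matrix.of fun i j => f (B i j) (B' i j)) := by
  simp only [encMatrix, encVec, zipWith_encList, zipWith_ofFn, h, Matrix.of_apply]

theorem sum_zipWith_dot (B B' : Matrix (Fin m) (Fin q) ℚ) :
    ((encMatrix B).zipWith dot (encMatrix B')).sum = .num (trace (Bᵀ * B')) := by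
  have : List.ofFn (fun j => Data.num ((fun i => B i j) ⬝ᵥ fun i => B' i j)) =
      (List.ofFn fun j => (fun i => B i j) ⬝ᵥ fun i => B' i j).map .num := by
    rw [List.map_ofFn]; rfl
  simp only [encMatrix, zipWith_encList, zipWith_ofFn, dot_encVec, this, sum_encList_num,
    List.sum_ofFn]
  rfl

theorem flStep_eq {G : Matrix (Fin q) (Fin q) ℚ} (hG : Gᵀ = G) (k : ℕ) :
    flStep (encMatrix G) (.pair (encMatrix (flMatrix G k)) (.pair (.num ((k : ℚ) + 1))
      (.pair (encMatrix (flBest G k).1) (.num (flBest G k).2)))) =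
    .pair (encMatrix (flMatrix G (k + 1))) (.pair (.num (((k + 1 : ℕ) : ℚ) + 1))
      (.pair (encMatrix (flBest G (k + 1)).1) (.num (flBest G (k + 1)).2))) := by
  have hc : ((encMatrix G).zipWith dot (encMatrix (flMatrix G k))).sum.div (.num ((k : ℚ) + 1)) =
      .num (flCoeff G k) := by
    rw [sum_zipWith_dot, div_num, hG, flCoeff]
  simp only [flStep, fst_pair, snd_pair, hc, tmulMat_encMatrix, hG, ident_encMatrix]
  rw [zipWith_encMatrix (fun x y => flCoeff G k * x - y) _ (fun x y => rfl)]
  congr 1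
  congr 1
  · simp
  · by_cases h : flCoeff G k = 0
    · simp [h, cond, flBest]
    · simp [h, cond, flBest]

theorem foldl_flStep {G : Matrix (Fin q) (Fin q) ℚ} (hG : Gᵀ = G) (l : List Data) :
    l.foldl (fun acc _ => flStep (encMatrix G) acc)
      (.pair (encMatrix G).ident (.pair (.num 1) (.pair (encMatrix G).ident (.num 1)))) =
    .pair (encMatrix (flMatrix G l.length)) (.pair (.num ((l.length : ℚ) + 1))
      (.pair (encMatrix (flBest G l.length).1) (.num (flBest G l.length).2))) := by
  induction l using List.reverseRecOn with
  | nil => simp [ident_encMatrix, flMatrix, flBest]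
  | append_singleton l x ih =>
    rw [List.foldl_append, ih, List.length_append]
    exact flStep_eq hG _

theorem length_toList_encMatrix (B : Matrix (Fin m) (Fin q) ℚ) :
    (encMatrix B).toList.length = q := by simp [encMatrix]

theorem flRun_eq {G : Matrix (Fin q) (Fin q) ℚ} (hG : Gᵀ = G) :
    flRun (encMatrix G) = .pair (encMatrix (flBest G q).1) (.num (flBest G q).2) := by
  rw [flRun, foldl_flStep hG, length_toList_encMatrix]
  rfl

theorem leastSquares_eq (B : Matrix (Fin m) (Fin q) ℚ) (y : Fin m → ℚ) :
    leastSquares (encLeastSquares B y) =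
      encVec ((flBest (Bᵀ * B) q).2⁻¹ • ((flBest (Bᵀ * B) q).1ᵀ *ᵥ (Bᵀ *ᵥ y))) := by
  have hG : (Bᵀ * B)ᵀ = Bᵀ * B := by simp
  simp only [leastSquares, encLeastSquares, fst_pair, snd_pair, tmulMat_encMatrix, flRun_eq hG,
    tmul_encMatrix]
  rw [map_encVec (fun x => x / (flBest (Bᵀ * B) q).2) _ (fun x => rfl)]
  congr 1
  funext i
  simp [div_eq_inv_mul]

end Data

/-! ### Bit sizes in the Faddeev–LeVerrier recursion -/

/-- A rational number with a common denominator `D` that is bounded in absolute value has a bounded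
height-size. -/
theorem Data.ht_num_le_of_scaled {x : ℚ} {D e f : ℕ} (hD : D ≠ 0) (hx : ∃ a : ℤ, x * D = a)
    (hx' : |x| ≤ 2 ^ e) (hD' : D ≤ 2 ^ f) : (Data.num x).ht ≤ 2 + e + f := by
  obtain ⟨a, ha⟩ := hx
  have hD0 : (D : ℚ) ≠ 0 := by exact_mod_cast hD
  have h1 : (a.natAbs : ℚ) ≤ 2 ^ (e + f) := by
    rw [Nat.cast_natAbs, Int.cast_abs, ← ha, abs_mul, pow_add, Nat.abs_cast]
    exact mul_le_mul hx' (by exact_mod_cast hD') (by positivity) (by positivity)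
  have h2 : a.natAbs ≤ 2 ^ (e + f) := by exact_mod_cast h1
  have h3 : 2 ^ (e + f) < 2 ^ (1 + e + f) := Nat.pow_lt_pow_right (by norm_num) (by omega)
  have h4 : 2 ^ f < 2 ^ (1 + e + f) := Nat.pow_lt_pow_right (by norm_num) (by omega)
  have := Data.ht_num_le_of_eq_div (q := x) (a := a) (b := D) (k := 1 + e + f)
    (by exact_mod_cast hD) (by rw [← ha]; push_cast; field_simp) (by omega)
    (by simp only [Int.natAbs_natCast]; omega)
  omega

theorem Data.ht_encList_ofFn_le {n b : ℕ} (f : Fin n → Data) (h : ∀ i, (f i).ht ≤ b) :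
    (encList (List.ofFn f)).ht ≤ 2 + n * (b + 1) := by
  rw [Data.ht_encList]
  have := List.sum_le_card_nsmul ((List.ofFn f).map fun a => a.ht + 1) (b + 1) (by
    intro x hx
    simp only [List.map_ofFn, List.mem_ofFn] at hx
    obtain ⟨i, rfl⟩ := hx
    simpa using h i)
  simp only [List.length_map, List.length_ofFn, smul_eq_mul] at this
  omega

theorem Data.ht_encMatrix_le {m q b : ℕ} (M : Matrix (Fin m) (Fin q) ℚ)
    (h : ∀ i j, (Data.num (M i j)).ht ≤ b) : (encMatrix M).ht ≤ 2 + q * (2 + m * (b + 1) + 1) :=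
  Data.ht_encList_ofFn_le _ fun j => Data.ht_encList_ofFn_le _ fun i => h i j

theorem Data.ht_le_ht_encMatrix {m q : ℕ} (M : Matrix (Fin m) (Fin q) ℚ) (i : Fin m) (j : Fin q) :
    (Data.num (M i j)).ht ≤ (encMatrix M).ht := by
  have h1 : (Data.num (M i j)).ht ≤ (encVec fun i => M i j).ht :=
    Data.ht_le_of_mem_toList (by simp [encVec])
  have h2 : (encVec fun i => M i j).ht ≤ (encMatrix M).ht :=
    Data.ht_le_of_mem_toList (by simp [encMatrix])
  exact h1.trans h2

theorem Data.le_ht_encMatrix {m q : ℕ} (M : Matrix (Fin m) (Fin q) ℚ) : q ≤ (encMatrix M).ht := by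
  have := (encMatrix M).length_toList_le
  rwa [Data.length_toList_encMatrix] at this

section Bounds

variable {q : ℕ}

/-- The entries of `Mₖ` become integers when multiplied by `Lᵏ k!`, for a common denominator `L` of
the entries of `G`, and grow at most geometrically. -/
theorem flMatrix_bounds {G : Matrix (Fin q) (Fin q) ℚ} {L : ℕ} {g : ℚ}
    (hL : ∀ i j, ∃ a : ℤ, G i j * L = a) (hg : ∀ i j, |G i j| ≤ g) (hg0 : 0 ≤ g) (k : ℕ) :
    (∀ i j, (∃ a : ℤ, flMatrix G k i j * ((L ^ k * k.factorial : ℕ) : ℚ) = a) ∧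
      |flMatrix G k i j| ≤ (2 * ((q : ℚ) + 1) ^ 2 * (g + 1)) ^ k) ∧
    (∃ a : ℤ, flCoeff G k * ((L ^ (k + 1) * (k + 1).factorial : ℕ) : ℚ) = a) ∧
      |flCoeff G k| ≤ (2 * ((q : ℚ) + 1) ^ 2 * (g + 1)) ^ (k + 1) := by
  set N : ℚ := 2 * ((q : ℚ) + 1) ^ 2 * (g + 1) with hN
  have hq0 : (0 : ℚ) ≤ q := by positivity
  have hN1 : 1 ≤ N := by nlinarith [mul_nonneg hq0 hg0, mul_nonneg (mul_nonneg hq0 hq0) hg0]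
  -- Consequences of the bounds for `Mₖ`.
  have key : ∀ k : ℕ, (∀ i j, (∃ a : ℤ, flMatrix G k i j * ((L ^ k * k.factorial : ℕ) : ℚ) = a) ∧
      |flMatrix G k i j| ≤ N ^ k) →
      (∀ i j, (∃ a : ℤ, (G * flMatrix G k) i j * ((L ^ (k + 1) * k.factorial : ℕ) : ℚ) = a) ∧
        |(G * flMatrix G k) i j| ≤ q * g * N ^ k) ∧
      (∃ a : ℤ, flCoeff G k * ((L ^ (k + 1) * (k + 1).factorial : ℕ) : ℚ) = a) ∧
      |flCoeff G k| ≤ q * q * g * N ^ k := by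
    intro k h
    have h1 : ∀ i j, (∃ a : ℤ, (G * flMatrix G k) i j * ((L ^ (k + 1) * k.factorial : ℕ) : ℚ) = a) ∧
        |(G * flMatrix G k) i j| ≤ q * g * N ^ k := by
      intro i j
      constructor
      · choose a ha using hL i
        choose b hb using fun l => (h l j).1
        refine ⟨∑ l, a l * b l, ?_⟩
        rw [Matrix.mul_apply, Finset.sum_mul]
        push_cast
        refine Finset.sum_congr rfl fun l _ => ?_
        rw [← ha, ← hb]
        push_cast
        ring
      · rw [Matrix.mul_apply]
        refine (Finset.abs_sum_le_sum_abs _ _).trans ?_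
        refine (Finset.sum_le_card_nsmul _ _ (g * N ^ k) fun l _ => ?_).trans (by simp [mul_assoc])
        rw [abs_mul]
        exact mul_le_mul (hg i l) (h l j).2 (abs_nonneg _) hg0
    refine ⟨h1, ?_, ?_⟩
    · choose a ha using fun i => (h1 i i).1
      refine ⟨∑ i, a i, ?_⟩
      have : ((k : ℚ) + 1) ≠ 0 := by positivity
      rw [flCoeff, Nat.factorial_succ, trace]
      push_cast
      simp only [← ha, ← Finset.sum_mul, Matrix.diag_apply]
      push_cast
      field_simp
    · rw [flCoeff, abs_div, abs_of_pos (by positivity : (0 : ℚ) < (k : ℚ) + 1)]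
      refine (div_le_self (abs_nonneg _) (by simp)).trans ?_
      refine (Finset.abs_sum_le_sum_abs _ _).trans ?_
      refine (Finset.sum_le_card_nsmul _ _ (q * g * N ^ k) fun l _ => (h1 l l).2).trans ?_
      simp [mul_assoc]
  have hNk : (0 : ℚ) ≤ N ^ k := by positivity
  have hcN : (q : ℚ) * q * g * N ^ k ≤ N ^ (k + 1) := by
    rw [pow_succ, mul_comm (N ^ k)]
    refine mul_le_mul_of_nonneg_right ?_ hNk
    nlinarith [mul_nonneg hq0 hg0, mul_nonneg (mul_nonneg hq0 hq0) hg0]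
  suffices h : ∀ i j, (∃ a : ℤ, flMatrix G k i j * ((L ^ k * k.factorial : ℕ) : ℚ) = a) ∧
      |flMatrix G k i j| ≤ N ^ k from ⟨h, (key k h).2.1, (key k h).2.2.trans hcN⟩
  clear hNk hcN
  induction k with
  | zero =>
    intro i j
    rw [flMatrix, Matrix.one_apply]
    split
    · exact ⟨⟨1, by simp⟩, by simp⟩
    · exact ⟨⟨0, by simp⟩, by simp⟩
  | succ k ih =>
    obtain ⟨h1, ⟨b, hb⟩, h3⟩ := key k ih
    intro i j
    obtain ⟨⟨a, ha⟩, h2⟩ := h1 i j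
    have hNk : (0 : ℚ) ≤ N ^ k := by positivity
    rw [flMatrix_succ, Matrix.sub_apply, Matrix.smul_apply, smul_eq_mul, Matrix.one_apply]
    have ha' : (G * flMatrix G k) i j * ((L ^ (k + 1) * (k + 1).factorial : ℕ) : ℚ) =
        ((a * (k + 1) : ℤ) : ℚ) := by
      push_cast [Nat.factorial_succ] at ha ⊢
      rw [← ha]
      ring
    constructor
    · rw [sub_mul, ha']
      split
      · exact ⟨b - a * (k + 1), by rw [mul_one, hb]; push_cast; ring⟩
      · exact ⟨- (a * (k + 1)), by push_cast; ring⟩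
    · have h4 : |flCoeff G k * if i = j then 1 else 0| ≤ q * q * g * N ^ k := by
        split
        · simpa using h3
        · simp only [mul_zero, abs_zero]; positivity
      refine (abs_sub _ _).trans ((add_le_add h4 h2).trans ?_)
      rw [pow_succ, mul_comm (N ^ k), ← add_mul]
      refine mul_le_mul_of_nonneg_right ?_ hNk
      nlinarith [mul_nonneg hq0 hg0, mul_nonneg (mul_nonneg hq0 hq0) hg0]

/-- The height-sizes in the recursion are polynomial in the height-size of the matrix. -/
theorem ht_flMatrix_le (G : Matrix (Fin q) (Fin q) ℚ) {k : ℕ} (hk : k ≤ q) {s : ℕ}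
    (hs : (encMatrix G).ht ≤ s) :
    (∀ i j, (Data.num (flMatrix G k i j)).ht ≤ 2 + (4 * s + 2) * (s + 1) + (s ^ 3 + s + 1) * (s + 1)) ∧
      (Data.num (flCoeff G k)).ht ≤ 2 + (4 * s + 2) * (s + 1) + (s ^ 3 + s + 1) * (s + 1) := by
  have hent : ∀ i j, |G i j| ≤ 2 ^ s ∧ (G i j).den ≤ 2 ^ s := by
    intro i j
    obtain ⟨e, he, h1, h2⟩ := Data.exists_height (G i j)
    have h3 := Data.ht_le_ht_encMatrix G i j
    have h4 : 2 ^ e ≤ 2 ^ s := Nat.pow_le_pow_right (by norm_num) (by omega)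
    refine ⟨?_, ?_⟩
    · rw [← Rat.num_div_den (G i j), abs_div, Nat.abs_cast]
      refine (div_le_self (abs_nonneg _) (by exact_mod_cast (G i j).den_pos)).trans ?_
      rw [← Int.cast_abs, ← Nat.cast_natAbs]
      exact_mod_cast h1.le.trans h4
    · rw [Int.natAbs_natCast] at h2
      omega
  have hqs : q ≤ s := (Data.le_ht_encMatrix G).trans hs
  set L : ℕ := ∏ i, ∏ j, (G i j).den with hLdef
  have hL0 : L ≠ 0 := by
    simp [hLdef, Finset.prod_ne_zero_iff]
  have hL : ∀ i j, ∃ a : ℤ, G i j * L = a := by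
    intro i j
    have h1 : (G i j).den ∣ L :=
      (Finset.dvd_prod_of_mem (fun j => (G i j).den) (Finset.mem_univ j)).trans
        (Finset.dvd_prod_of_mem (fun i => ∏ j, (G i j).den) (Finset.mem_univ i))
    obtain ⟨c, hc⟩ := h1
    refine ⟨(G i j).num * c, ?_⟩
    rw [hc]
    push_cast
    rw [← mul_assoc, Rat.mul_den_eq_num]
  have hL2 : L ≤ 2 ^ s ^ 3 := by
    have h1 : ∀ i, ∏ j, (G i j).den ≤ (2 ^ s) ^ q := fun i => by
      simpa using Finset.prod_le_pow_card Finset.univ (fun j => (G i j).den) _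
        fun j _ => (hent i j).2
    have h2 : L ≤ ((2 ^ s) ^ q) ^ q := by
      simpa using Finset.prod_le_pow_card Finset.univ (fun i => ∏ j, (G i j).den) _
        fun i _ => h1 i
    refine h2.trans ?_
    rw [← pow_mul, ← pow_mul]
    refine Nat.pow_le_pow_right (by norm_num) ?_
    calc s * (q * q) ≤ s * (s * s) := by gcongr
      _ = s ^ 3 := by ring
  obtain ⟨h1, h2, h3⟩ := flMatrix_bounds hL (fun i j => (hent i j).1) (by positivity) k
  have hs2 : s + 1 ≤ 2 ^ s := Nat.lt_two_pow_self
  -- The growth factor is at most `2 ^ (4 s + 2)`.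
  have hN : (2 * ((q : ℚ) + 1) ^ 2 * (2 ^ s + 1)) ≤ 2 ^ (4 * s + 2) := by
    have h5 : 2 * (q + 1) ^ 2 * (2 ^ s + 1) ≤ 2 ^ (4 * s + 2) := by
      calc 2 * (q + 1) ^ 2 * (2 ^ s + 1) ≤ 2 * (2 ^ s) ^ 2 * (2 ^ s + 2 ^ s) := by
            gcongr
            · omega
            · exact Nat.one_le_two_pow
        _ = 2 ^ (3 * s + 2) := by ring
        _ ≤ 2 ^ (4 * s + 2) := Nat.pow_le_pow_right (by norm_num) (by omega)
    exact_mod_cast h5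
  have hNpow : ∀ n ≤ s + 1, (2 * ((q : ℚ) + 1) ^ 2 * (2 ^ s + 1)) ^ n ≤
      2 ^ ((4 * s + 2) * (s + 1)) := fun n hn => by
    rw [pow_mul]
    refine (pow_le_pow_left₀ (by positivity) hN n).trans (pow_le_pow_right₀ ?_ hn)
    exact one_le_pow₀ (by norm_num)
  have hD : ∀ n ≤ s + 1, L ^ n * n.factorial ≤ 2 ^ ((s ^ 3 + s + 1) * (s + 1)) := fun n hn => by
    calc L ^ n * n.factorial ≤ (2 ^ s ^ 3) ^ n * (2 ^ (s + 1)) ^ n := by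
          gcongr
          refine (Nat.factorial_le_pow n).trans (Nat.pow_le_pow_left ?_ n)
          exact hn.trans (hs2.trans (Nat.pow_le_pow_right (by norm_num) (by omega)))
      _ = 2 ^ ((s ^ 3 + s + 1) * n) := by rw [← mul_pow, ← pow_add, ← pow_mul, add_assoc]
      _ ≤ _ := Nat.pow_le_pow_right (by norm_num) (by gcongr)
  have hD0 : ∀ n, L ^ n * n.factorial ≠ 0 := fun n =>
    Nat.mul_ne_zero (pow_ne_zero _ hL0) n.factorial_ne_zero
  refine ⟨fun i j => ?_, ?_⟩
  · exact Data.ht_num_le_of_scaled (hD0 k) (h1 i j).1 ((h1 i j).2.trans (hNpow k (by omega)))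
      (hD k (by omega))
  · exact Data.ht_num_le_of_scaled (hD0 (k + 1)) h2 (h3.trans (hNpow (k + 1) (by omega)))
      (hD (k + 1) (by omega))

end Bounds

/-! ### A polynomial-time algorithm for linear least squares -/

section
variable {X : ι → Set Data} {f g : Data → Data}

theorem PT.dot (hf : PT rel X f) (hg : PT rel X g) : PT rel X fun v => (f v).dot (g v) :=
  .sum (.zipWith (f := fun _ a b => a.mul b) (.mul (.fst (.snd .id)) (.snd (.snd .id))) hf hg)

theorem PT.tmul (hf : PT rel X f) (hg : PT rel X g) : PT rel X fun v => (f v).tmul (g v) := by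
  have : PTu rel fun w => w.fst.tmul w.snd :=
    .map (f := fun v a => a.dot v.snd) (.dot (.snd .id) (.snd (.fst .id))) (.fst .id)
  exact this.comp₂ hf hg

theorem PT.tmulMat (hf : PT rel X f) (hg : PT rel X g) :
    PT rel X fun v => (f v).tmulMat (g v) := by
  have : PTu rel fun w => w.fst.tmulMat w.snd :=
    .map (f := fun v a => v.fst.tmul a) (.tmul (.fst (.fst .id)) (.snd .id)) (.snd .id)
  exact this.comp₂ hf hg

theorem PT.ident (hf : PT rel X f) : PT rel X fun v => (f v).ident := by
  have : PTu rel Data.ident :=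
    .map (f := fun v i => v.iota.map fun j => (i.le j).mul (j.le i))
      (.map (f := fun w j => (w.snd.le j).mul (j.le w.snd))
        (.mul (.le (.snd (.fst .id)) (.snd .id)) (.le (.snd .id) (.snd (.fst .id))))
        (.iota (.fst .id)))
      (.iota .id)
  exact this.comp hf

theorem PT.flStep (hf : PT rel X f) (hg : PT rel X g) : PT rel X fun v => (f v).flStep (g v) := by
  have hc : PTu rel fun w => (w.fst.zipWith Data.dot w.snd.fst).sum.div w.snd.snd.fst :=
    .div (.sum (.zipWith (f := fun _ a b => a.dot b) (.dot (.fst (.snd .id)) (.snd (.snd .id)))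
      (.fst .id) (.fst (.snd .id)))) (.fst (.snd (.snd .id)))
  have : PTu rel fun w => w.fst.flStep w.snd := by
    refine .pair (.zipWith
      (f := fun w a b => a.zipWith (fun x y =>
        (((w.fst.zipWith Data.dot w.snd.fst).sum.div w.snd.snd.fst).mul x).sub y) b)
      ?_ (.ident (.fst .id)) (.tmulMat (.fst .id) (.fst (.snd .id))))
      (.pair (.add (.fst (.snd (.snd .id))) (.const _))
        (.cond hc (.pair (.fst (.snd .id)) hc) (.snd (.snd (.snd .id)))))
    exact .zipWith (f := fun w x y =>
        (((w.fst.fst.zipWith Data.dot w.fst.snd.fst).sum.div w.fst.snd.snd.fst).mul x).sub y)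
      (.sub (.mul (hc.comp (.fst (.fst .id))) (.fst (.snd .id))) (.snd (.snd .id)))
      (.fst (.snd .id)) (.snd (.snd .id))
  exact this.comp₂ hf hg

end

/-- The recursion takes polynomial time on symmetric matrices. -/
theorem PT.flRun : PT rel (fun _ : Unit => {v | ∃ (q : ℕ) (G : Matrix (Fin q) (Fin q) ℚ),
    Gᵀ = G ∧ v = encMatrix G}) Data.flRun := by
  refine .snd (.snd (.fold (f := fun v acc _ => v.flStep acc)
    (.flStep (.fst .id) (.fst (.snd .id))) .id
    (.pair (.ident .id) (.pair (.const _) (.pair (.ident .id) (.const _)))) fun _ => ?_))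
  let E : Polynomial ℕ :=
    2 + (4 * .X + 2) * (.X + 1) + (.X ^ 3 + .X + 1) * (.X + 1)
  let M : Polynomial ℕ := 2 + .X * (2 + .X * (E + 1) + 1)
  refine ⟨6 + .X + 2 * M + E, ?_⟩
  rintro v ⟨q, G, hG, rfl⟩ l₁ l₂ hl
  rw [Data.foldl_flStep hG]
  have hlen : l₁.length ≤ q := by
    have h1 := congrArg List.length hl
    rw [Data.length_toList_encMatrix] at h1
    simp at h1
    omega
  have hE : E.eval (encMatrix G).ht = 2 + (4 * (encMatrix G).ht + 2) * ((encMatrix G).ht + 1) +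
      ((encMatrix G).ht ^ 3 + (encMatrix G).ht + 1) * ((encMatrix G).ht + 1) := by
    simp [E]
  have hM : ∀ k ≤ q, (encMatrix (flMatrix G k)).ht ≤ M.eval (encMatrix G).ht := by
    intro k hk
    refine (Data.ht_encMatrix_le _ fun i j =>
      ((ht_flMatrix_le G hk le_rfl).1 i j).trans hE.ge).trans ?_
    have hq := Data.le_ht_encMatrix G
    simp only [M, Polynomial.eval_add, Polynomial.eval_mul, Polynomial.eval_X, Polynomial.eval_ofNat,
      Polynomial.eval_one]
    gcongr
  have hn : (Data.num ((l₁.length : ℚ) + 1)).ht ≤ (encMatrix G).ht + 3 := by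
    have h1 := Data.ht_num_natCast_le (l₁.length + 1)
    have h2 := Data.le_ht_encMatrix G
    push_cast at h1
    omega
  have hbest : (encMatrix (flBest G l₁.length).1).ht ≤ M.eval (encMatrix G).ht ∧
      (Data.num (flBest G l₁.length).2).ht ≤ E.eval (encMatrix G).ht := by
    obtain ⟨r, hr, -, ⟨rfl, h⟩ | ⟨s, rfl, -, h⟩⟩ := flBest_eq G l₁.length
    · rw [h]
      refine ⟨hM 0 (Nat.zero_le _), ?_⟩
      rw [Data.ht_num_one, hE]
      omega
    · rw [h]
      exact ⟨hM s (by omega), (ht_flMatrix_le G (by omega : s ≤ q) le_rfl).2.trans hE.ge⟩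
  have h1 := hM l₁.length hlen
  simp only [Data.ht_pair, Polynomial.eval_add, Polynomial.eval_mul, Polynomial.eval_X,
    Polynomial.eval_ofNat]
  omega

theorem PT.leastSquares : PT rel (fun _ : Unit => {v | ∃ (m q : ℕ) (B : Matrix (Fin m) (Fin q) ℚ)
    (y : Fin m → ℚ), v = encLeastSquares B y}) Data.leastSquares := by
  have h1 : PT rel (fun _ : Unit => {v | ∃ (m q : ℕ) (B : Matrix (Fin m) (Fin q) ℚ)
      (y : Fin m → ℚ), v = encLeastSquares B y}) fun v => (v.fst.tmulMat v.fst).flRun := by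
    refine PT.comp_on PT.flRun (.tmulMat (.fst .id) (.fst .id)) ?_
    rintro _ _ ⟨m, q, B, y, rfl⟩
    exact ⟨q, Bᵀ * B, by simp, Data.tmulMat_encMatrix B B⟩
  have h2 : PTu rel fun w => w.snd.map fun x => x.div w.fst :=
    .map (f := fun w x => x.div w.fst) (.div (.snd .id) (.fst (.fst .id))) (.snd .id)
  exact PTu.comp₂ (F := fun a b => b.map fun x => x.div a) h2 (.snd h1)
    (.tmul (.fst h1) (.tmul (.fst .id) (.snd .id)))

/-- Solutions of the normal equations are optimal. -/
theorem leastSquaresObjective_le {m q : ℕ} {B : Matrix (Fin m) (Fin q) ℚ} {y : Fin m → ℚ}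
    {z : Fin q → ℚ} (h : Bᵀ *ᵥ (B *ᵥ z) = Bᵀ *ᵥ y) (w : Fin q → ℝ) :
    leastSquaresObjective B y (fun j => (z j : ℝ)) ≤ leastSquaresObjective B y w := by
  set B' : Matrix (Fin m) (Fin q) ℝ := B.map fun a : ℚ => (a : ℝ)
  set z' : Fin q → ℝ := fun j => (z j : ℝ)
  set y' : Fin m → ℝ := fun i => (y i : ℝ)
  have h' : B'ᵀ *ᵥ (B' *ᵥ z' - y') = 0 := by
    rw [mulVec_sub, sub_eq_zero]
    funext j
    have hj := congrArg (fun x : ℚ => (x : ℝ)) (congrFun h j)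
    simp only [mulVec, dotProduct, transpose_apply] at hj ⊢
    push_cast at hj
    exact hj
  rw [leastSquaresObjective, leastSquaresObjective, EuclideanSpace.norm_eq, EuclideanSpace.norm_eq]
  refine Real.sqrt_le_sqrt ?_
  have h1 : ∀ u : Fin m → ℝ, ∑ i, ‖(WithLp.toLp 2 u : EuclideanSpace ℝ (Fin m)) i‖ ^ 2 = u ⬝ᵥ u := by
    intro u; simp [dotProduct, pow_two]
  rw [h1, h1]
  have h2 : B' *ᵥ w - y' = (B' *ᵥ z' - y') + B' *ᵥ (w - z') := by
    rw [mulVec_sub]; abel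
  have h3 : (B' *ᵥ z' - y') ⬝ᵥ (B' *ᵥ (w - z')) = 0 := by
    rw [dotProduct_mulVec, ← mulVec_transpose, h', zero_dotProduct]
  have h5 := (dotProduct_comm (B' *ᵥ (w - z')) (B' *ᵥ z' - y')).trans h3
  rw [h2, add_dotProduct, dotProduct_add, dotProduct_add, h3, h5, add_zero, zero_add]
  have h4 : 0 ≤ (B' *ᵥ (w - z')) ⬝ᵥ (B' *ᵥ (w - z')) :=
    Finset.sum_nonneg fun i _ => mul_self_nonneg _
  exact le_add_of_nonneg_right h4

/-- The vector returned by `Data.leastSquares`. -/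
def lsSolution {m q : ℕ} (B : Matrix (Fin m) (Fin q) ℚ) (y : Fin m → ℚ) : Fin q → ℚ :=
  (flBest (Bᵀ * B) q).2⁻¹ • ((flBest (Bᵀ * B) q).1ᵀ *ᵥ (Bᵀ *ᵥ y))

theorem lsSolution_optimal {m q : ℕ} (B : Matrix (Fin m) (Fin q) ℚ) (y : Fin m → ℚ)
    (w : Fin q → ℝ) :
    leastSquaresObjective B y (fun j => (lsSolution B y j : ℝ)) ≤ leastSquaresObjective B y w :=
  leastSquaresObjective_le (flBest_normal_eq B y) w

/-- `S` computes `Data.leastSquares` on all least squares problems, in time bounded by `p`. -/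
def ComputesLeastSquares (S : Program) (p : Polynomial ℕ) : Prop :=
  ∀ (m q : ℕ) (B : Matrix (Fin m) (Fin q) ℚ) (y : Fin m → ℚ), ∃ t,
    RunPlain S (encLeastSquares B y) (encVec (lsSolution B y)) t ∧
    t ≤ p.eval (encLeastSquares B y).ht

theorem exists_leastSquares_program :
    ∃ (S : Program) (p : Polynomial ℕ), ComputesLeastSquares S p := by
  obtain ⟨S, hS⟩ := PT.leastSquares (rel := fun _ _ _ => False)
  obtain ⟨p, hp⟩ := hS ()
  refine ⟨S, p, fun m q B y => ?_⟩
  obtain ⟨t, h1, h2⟩ := hp (encLeastSquares B y) ⟨m, q, B, y, rfl⟩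
  exact ⟨t, by rwa [Data.leastSquares_eq] at h1, h2⟩

/-! ### Lexicographic signs -/

section

open Filter Topology

section Lead

variable {R : Type*} [Field R] [LinearOrder R]

/-- The first nonzero entry of a list, `0` if there is none.  Its sign is the sign of the list in the
lexicographic order. -/
def lead : List R → R
  | [] => 0
  | x :: l => if x = 0 then lead l else x

theorem lead_cons_zero (l : List R) : lead (0 :: l) = lead l := by simp [lead]

theorem lead_cons_of_ne {x : R} (hx : x ≠ 0) (l : List R) : lead (x :: l) = x := by simp [lead, hx]

theorem lead_append (l m : List R) : lead (l ++ m) = if lead l = 0 then lead m else lead l := by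
  induction l with
  | nil => simp [lead]
  | cons x l ih => by_cases hx : x = 0 <;> simp [lead, hx, ih]

theorem lead_eq_zero {l : List R} (h : lead l = 0) : ∀ x ∈ l, x = 0 := by
  induction l with
  | nil => simp
  | cons x l ih =>
    by_cases hx : x = 0
    · subst hx
      rw [lead_cons_zero] at h
      simpa using ih h
    · exact absurd (lead_cons_of_ne hx l ▸ h) hx

theorem lead_eq_zero_of_forall {l : List R} (h : ∀ x ∈ l, x = 0) : lead l = 0 := by
  induction l with
  | nil => rfl
  | cons x l ih =>
    rw [h x (by simp), lead_cons_zero]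
    exact ih fun y hy => h y (by simp [hy])

theorem lead_nonneg_of_append {l m : List R} (h : 0 ≤ lead (l ++ m)) : 0 ≤ lead l := by
  rw [lead_append] at h
  split at h
  · rename_i h'; exact h'.ge
  · exact h

variable [IsStrictOrderedRing R]

theorem lead_map_mul {c : R} (hc : c ≠ 0) (l : List R) : lead (l.map (c * ·)) = c * lead l := by
  induction l with
  | nil => simp [lead]
  | cons x l ih => by_cases hx : x = 0 <;> simp [lead, hx, hc, ih]

theorem lead_add_nonneg {l m : List R} (hl : 0 ≤ lead l) (hm : 0 ≤ lead m) :
    0 ≤ lead (List.zipWith (· + ·) l m) := by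
  induction l generalizing m with
  | nil => simp [lead]
  | cons x l ih =>
    cases m with
    | nil => simp [lead]
    | cons y m =>
      by_cases hx : x = 0 <;> by_cases hy : y = 0
      · subst hx hy
        rw [lead_cons_zero] at hl hm
        simpa [lead_cons_zero] using ih hl hm
      · subst hx
        rw [lead_cons_of_ne hy] at hm
        simpa [lead_cons_of_ne hy] using hm
      · subst hy
        rw [lead_cons_of_ne hx] at hl
        simpa [lead_cons_of_ne hx] using hl
      · rw [lead_cons_of_ne hx] at hl
        rw [lead_cons_of_ne hy] at hm
        have h1 : 0 < x := lt_of_le_of_ne hl (Ne.symm hx)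
        have h2 : x + y ≠ 0 := by positivity
        rw [List.zipWith_cons_cons, lead_cons_of_ne h2]
        positivity

/-- The sign of the difference of two lists of the same length decides their lexicographic order. -/
theorem lead_sub_pos_iff {l m : List R} (h : l.length = m.length) :
    0 < lead (List.zipWith (· - ·) l m) ↔ m < l := by
  induction l generalizing m with
  | nil =>
    cases m with
    | nil => simp [lead]
    | cons _ _ => simp at h
  | cons x l ih =>
    cases m with
    | nil => simp at h
    | cons y m =>
      simp only [List.length_cons, Nat.add_right_cancel_iff] at h
      rw [List.zipWith_cons_cons, List.cons_lt_cons_iff]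
      by_cases hxy : x = y
      · subst hxy
        simp [lead_cons_zero, ih h]
      · rw [lead_cons_of_ne (sub_ne_zero.2 hxy), sub_pos]
        simp [Ne.symm hxy]

end Lead

/-- The value at `δ` of the polynomial with the given list of coefficients. -/
def evalList : List ℝ → ℝ → ℝ
  | [], _ => 0
  | x :: l, δ => x + δ * evalList l δ

theorem continuous_evalList (l : List ℝ) : Continuous (evalList l) := by
  induction l with
  | nil => exact continuous_const
  | cons x l ih => exact continuous_const.add (continuous_id.mul ih)

theorem evalList_ofFn {m : ℕ} (c : Fin m → ℝ) (δ : ℝ) :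
    evalList (List.ofFn c) δ = ∑ i, c i * δ ^ (i : ℕ) := by
  induction m with
  | zero => simp [evalList]
  | succ m ih =>
    rw [List.ofFn_succ, evalList, ih, Fin.sum_univ_succ, Finset.mul_sum]
    simp only [Fin.val_zero, pow_zero, mul_one, Fin.val_succ, pow_succ]
    congr 1
    exact Finset.sum_congr rfl fun i _ => by ring

/-- For small positive `δ` the sign of a polynomial is the sign of its first nonzero coefficient. -/
theorem eventually_sign_evalList (l : List ℝ) :
    ∀ᶠ δ in 𝓝[>] (0 : ℝ), (0 < lead l → 0 < evalList l δ) ∧ (lead l < 0 → evalList l δ < 0) := by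
  induction l with
  | nil => simp [lead]
  | cons x l ih =>
    by_cases hx : x = 0
    · subst hx
      filter_upwards [ih, self_mem_nhdsWithin] with δ h (hδ : 0 < δ)
      rw [lead_cons_zero, evalList, zero_add]
      exact ⟨fun h' => mul_pos hδ (h.1 h'), fun h' => mul_neg_of_pos_of_neg hδ (h.2 h')⟩
    · have h0 : Tendsto (evalList (x :: l)) (𝓝[>] 0) (𝓝 x) := by
        have := ((continuous_evalList (x :: l)).tendsto 0).mono_left
          (nhdsWithin_le_nhds (s := Set.Ioi (0 : ℝ)))
        simpa [evalList] using this
      rw [lead_cons_of_ne hx]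
      rcases lt_or_gt_of_ne hx with h | h
      · filter_upwards [h0.eventually_lt_const h] with δ hδ
        exact ⟨fun h' => absurd h' h.le.not_gt, fun _ => hδ⟩
      · filter_upwards [h0.eventually_const_lt h] with δ hδ
        exact ⟨fun _ => hδ, fun h' => absurd h' h.le.not_gt⟩

/-! ### Enumerating the cells of the arrangement -/

section Cover

variable {e n : ℕ}

/-- The value of the functional with coefficients `c` at the point with homogeneous coordinates `p`. -/
def val (c : Fin (e + 1) → ℚ) (p : Fin (e + 1) → ℝ) : ℝ := ∑ i, (c i : ℝ) * p i

theorem val_add (c c' : Fin (e + 1) → ℚ) (p : Fin (e + 1) → ℝ) :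
    val (c + c') p = val c p + val c' p := by
  simp [val, add_mul, Finset.sum_add_distrib]

theorem val_smul (a : ℚ) (c : Fin (e + 1) → ℚ) (p : Fin (e + 1) → ℝ) :
    val (a • c) p = a * val c p := by
  simp [val, Finset.mul_sum, mul_assoc]

theorem val_sub (c c' : Fin (e + 1) → ℚ) (p : Fin (e + 1) → ℝ) :
    val (c - c') p = val c p - val c' p := by
  simp [val, sub_mul, Finset.sum_sub_distrib]

theorem val_comb (c : Fin (e + 1) → ℚ) (a b : ℝ) (p o : Fin (e + 1) → ℝ) :
    val c (fun i => a * p i + b * o i) = a * val c p + b * val c o := by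
  simp only [val, Finset.mul_sum, ← Finset.sum_add_distrib]
  exact Finset.sum_congr rfl fun i _ => by ring

/-- The quotient `r j / h j` at the first position `j` with `h j ≠ 0`; `0` if there is none. -/
def pivotList : List ℚ → List ℚ → ℚ
  | x :: h, y :: r => if x = 0 then pivotList h r else y / x
  | _, _ => 0

theorem pivotList_ofFn {m : ℕ} (h : Fin m → ℚ) :
    (h = 0 ∧ ∀ r : Fin m → ℚ, pivotList (List.ofFn h) (List.ofFn r) = 0) ∨
      ∃ j, h j ≠ 0 ∧ ∀ r : Fin m → ℚ, pivotList (List.ofFn h) (List.ofFn r) = r j / h j := by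
  induction m with
  | zero => exact .inl ⟨Subsingleton.elim _ _, fun r => by simp [pivotList]⟩
  | succ m ih =>
    by_cases h0 : h 0 = 0
    · simp only [List.ofFn_succ, pivotList, h0, if_true]
      rcases ih fun i => h i.succ with ⟨h1, h2⟩ | ⟨j, h1, h2⟩
      · refine .inl ⟨?_, fun r => h2 fun i => r i.succ⟩
        funext i
        refine Fin.cases h0 (fun i => congrFun h1 i) i
      · exact .inr ⟨j.succ, h1, fun r => h2 fun i => r i.succ⟩
    · exact .inr ⟨0, h0, fun r => by simp [List.ofFn_succ, pivotList, h0]⟩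

/-- The multiple of the functional `h` that has to be subtracted from `r` in order to eliminate the
first variable that occurs in `h`.  The entry `0` of a functional is its constant term. -/
def pivot (h r : Fin (e + 1) → ℚ) : ℚ :=
  pivotList (List.ofFn fun i : Fin e => h i.succ) (List.ofFn fun i : Fin e => r i.succ)

theorem pivot_cases (h : Fin (e + 1) → ℚ) :
    ((∀ j : Fin e, h j.succ = 0) ∧ ∀ r, pivot h r = 0) ∨
      ∃ j : Fin e, h j.succ ≠ 0 ∧ ∀ r, pivot h r = r j.succ / h j.succ := by
  rcases pivotList_ofFn fun i : Fin e => h i.succ with ⟨h1, h2⟩ | ⟨j, h1, h2⟩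
  · exact .inl ⟨fun j => congrFun h1 j, fun r => h2 _⟩
  · exact .inr ⟨j, h1, fun r => h2 _⟩

theorem pivot_comb (h : Fin (e + 1) → ℚ) (a b : ℚ) (r s : Fin (e + 1) → ℚ) :
    pivot h (a • r + b • s) = a * pivot h r + b * pivot h s := by
  rcases pivot_cases h with ⟨-, h1⟩ | ⟨j, -, h1⟩
  · simp [h1]
  · simp only [h1, Pi.add_apply, Pi.smul_apply, smul_eq_mul]
    ring

/-- `n` affine functionals on a flat, each with the list of its derivatives in the directions into
which the flat has been pushed off, the last one first. -/
abbrev Node (e n : ℕ) : Type := Fin n → (Fin (e + 1) → ℚ) × List ℚ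

/-- Restriction of all functionals to the hyperplane `h = 0`, together with a direction that leads to
the side of this hyperplane that does not contain the base point `(δ, δ², …)`, `δ` small. -/
def child (R : Node e n) (h : Fin (e + 1) → ℚ) : Node e n := fun i =>
  ((R i).1 - pivot h (R i).1 • h, (-lead (List.ofFn h) * pivot h (R i).1) :: (R i).2)

/-- The functional that belongs to a pair of indices: the difference of two functionals, or their
sum, depending on the order of the indices; `0` for equal indices. -/
def letter (R : Node e n) (a b : Fin n) : Fin (e + 1) → ℚ :=
  (R a).1 + (if a ≤ b then (-1 : ℚ) else 1) • (R b).1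

/-- All restrictions to the hyperplanes of the pairs of indices. -/
def children (R : Node e n) : List (Node e n) :=
  (List.finRange n).flatMap fun a => (List.finRange n).map fun b => child R (letter R a b)

/-- The results of `d` successive restrictions. -/
def leaves : ℕ → Node e n → List (Node e n)
  | 0, R => [R]
  | d + 1, R => (children R).flatMap (leaves d)

theorem length_leaves (d : ℕ) (R : Node e n) : (leaves d R).length = (n ^ 2) ^ d := by
  induction d generalizing R with
  | zero => rfl
  | succ d ih =>
    have h : (children R).length = n ^ 2 := by simp [children, pow_two]
    simp only [leaves, List.length_flatMap, ih]
    rw [List.map_const', List.sum_replicate, smul_eq_mul, h]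
    exact (pow_succ' _ _).symm

/-- The combination `α u + β v` of two functionals with their derivatives, as one list. -/
def keyComb (α β : ℚ) (u v : (Fin (e + 1) → ℚ) × List ℚ) : List ℚ :=
  List.ofFn (α • u.1 + β • v.1) ++ List.zipWith (fun x y => α * x + β * y) u.2 v.2

/-- A signed sum of two of the functionals. -/
structure Pair (n : ℕ) where
  /-- The first index. -/
  a : Fin n
  /-- The second index. -/
  b : Fin n
  /-- The sign of the first functional. -/
  α : ℤˣ
  /-- The sign of the second functional. -/
  β : ℤˣ

/-- The signed sum as a functional. -/
def Pair.comb (s : Pair n) (R : Node e n) : Fin (e + 1) → ℚ :=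
  ((s.α : ℤ) : ℚ) • (R s.a).1 + ((s.β : ℤ) : ℚ) • (R s.b).1

/-- The signed sum with its derivatives. -/
def Pair.key (s : Pair n) (R : Node e n) : List ℚ :=
  keyComb ((s.α : ℤ) : ℚ) ((s.β : ℤ) : ℚ) (R s.a) (R s.b)

instance : Finite (Pair n) :=
  Finite.of_injective (fun s : Pair n => (s.a, s.b, s.α, s.β)) fun s t h => by
    cases s; cases t; simpa using h

theorem Pair.comb_child (s : Pair n) (R : Node e n) (h : Fin (e + 1) → ℚ) :
    s.comb (child R h) = s.comb R - pivot h (s.comb R) • h := by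
  rw [Pair.comb, Pair.comb, pivot_comb]
  simp only [child]
  module

theorem Pair.key_child (s : Pair n) (R : Node e n) (h : Fin (e + 1) → ℚ) :
    s.key (child R h) = List.ofFn (s.comb (child R h)) ++
      (-lead (List.ofFn h) * pivot h (s.comb R)) :: List.zipWith
        (fun x y => ((s.α : ℤ) : ℚ) * x + ((s.β : ℤ) : ℚ) * y) (R s.a).2 (R s.b).2 := by
  rw [Pair.key, keyComb, Pair.comb, Pair.comb, pivot_comb]
  simp only [child, List.zipWith_cons_cons]
  congr 2
  ring

theorem pivotList_neg (h r : List ℚ) : pivotList (h.map (-1 * ·)) r = -pivotList h r := by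
  induction h generalizing r with
  | nil => simp [pivotList]
  | cons x h ih =>
    cases r with
    | nil => simp [pivotList]
    | cons y r =>
      by_cases hx : x = 0
      · subst hx
        simpa [pivotList] using ih r
      · simp [pivotList, hx, div_neg]

theorem child_neg (R : Node e n) (h : Fin (e + 1) → ℚ) : child R (-h) = child R h := by
  have h1 : ∀ r, pivot (-h) r = -pivot h r := by
    intro r
    rw [pivot, pivot, ← pivotList_neg, List.map_ofFn]
    congr 2
    funext i
    simp
  have h2 : lead (List.ofFn (-h)) = -lead (List.ofFn h) := by
    have := lead_map_mul (R := ℚ) (c := -1) (by norm_num) (List.ofFn h)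
    rw [List.map_ofFn] at this
    simpa using this
  funext i
  simp only [child, h1, h2]
  simp

theorem Pair.child_mem (s : Pair n) (R : Node e n) (hs : s.a ≠ s.b) :
    child R (s.comb R) ∈ children R := by
  have hmem : ∀ a b, child R (letter R a b) ∈ children R := by
    intro a b
    simp only [children, List.mem_flatMap, List.mem_map]
    exact ⟨a, List.mem_finRange _, b, List.mem_finRange _, rfl⟩
  have hor : ∀ h a b, h = letter R a b ∨ h = -letter R a b → child R h ∈ children R := by
    rintro h a b (rfl | rfl)
    · exact hmem a b
    · rw [child_neg]; exact hmem a b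
  obtain ⟨a, b, α, β⟩ := s
  simp only [Pair.comb]
  rcases lt_or_gt_of_ne hs with hlt | hlt <;>
  rcases Int.units_eq_one_or α with rfl | rfl <;> rcases Int.units_eq_one_or β with rfl | rfl
  · exact hor _ b a (.inl (by simp [letter, hlt.not_ge, add_comm]))
  · exact hor _ a b (.inl (by simp [letter, hlt.le]))
  · exact hor _ a b (.inr (by simp [letter, hlt.le, add_comm]))
  · exact hor _ b a (.inr (by simp [letter, hlt.not_ge, add_comm]))
  · exact hor _ a b (.inl (by simp [letter, hlt.not_ge]))
  · exact hor _ b a (.inr (by simp [letter, hlt.le]))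
  · exact hor _ b a (.inl (by simp [letter, hlt.le, add_comm]))
  · exact hor _ a b (.inr (by simp [letter, hlt.not_ge, add_comm]))

/-- Without genuine restrictions the functionals stay as they are. -/
theorem exists_leaf_eq (hn : 0 < n) (d : ℕ) (R : Node e n) :
    ∃ L ∈ leaves d R, ∀ s : Pair n, ∃ l, s.key L = List.ofFn (s.comb R) ++ l := by
  induction d generalizing R with
  | zero => exact ⟨R, by simp [leaves], fun s => ⟨_, rfl⟩⟩
  | succ d ih =>
    have h0 : letter R ⟨0, hn⟩ ⟨0, hn⟩ = 0 := by simp [letter]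
    obtain ⟨L, hL, h⟩ := ih (child R 0)
    refine ⟨L, ?_, fun s => ?_⟩
    · rw [leaves, List.mem_flatMap]
      refine ⟨child R 0, ?_, hL⟩
      simp only [children, List.mem_flatMap, List.mem_map]
      exact ⟨⟨0, hn⟩, List.mem_finRange _, ⟨0, hn⟩, List.mem_finRange _, by rw [h0]⟩
    · obtain ⟨l, hl⟩ := h s
      exact ⟨l, by rw [hl, Pair.comb_child, smul_zero, sub_zero]⟩

/-- A signed sum that vanishes on the flat keeps its sign in all further restrictions. -/
theorem lead_key_of_comb_eq_zero (s : Pair n) (d : ℕ) (R : Node e n) (h : s.comb R = 0)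
    {L : Node e n} (hL : L ∈ leaves d R) :
    lead (s.key L) = lead (List.zipWith
      (fun x y => ((s.α : ℤ) : ℚ) * x + ((s.β : ℤ) : ℚ) * y) (R s.a).2 (R s.b).2) := by
  induction d generalizing R with
  | zero =>
    simp only [leaves, List.mem_singleton] at hL
    subst hL
    have h0 : lead (List.ofFn (s.comb L)) = 0 :=
      lead_eq_zero_of_forall (by rw [h]; simp)
    have : s.key L = List.ofFn (s.comb L) ++ _ := rfl
    rw [this, lead_append, if_pos h0]
  | succ d ih =>
    rw [leaves, List.mem_flatMap] at hL
    obtain ⟨R', hR', hL⟩ := hL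
    simp only [children, List.mem_flatMap, List.mem_map] at hR'
    obtain ⟨a, -, b, -, rfl⟩ := hR'
    set g := letter R a b
    have hp : pivot g (s.comb R) = 0 := by
      rw [h]
      rcases pivot_cases g with ⟨-, h1⟩ | ⟨j, -, h1⟩ <;> simp [h1]
    rw [ih _ (by rw [Pair.comb_child, hp, h]; simp) hL]
    have hp' := hp
    rw [Pair.comb, pivot_comb] at hp'
    simp only [child, List.zipWith_cons_cons]
    rw [show ∀ x : ℚ, ((s.α : ℤ) : ℚ) * (x * pivot g (R s.a).1) +
      ((s.β : ℤ) : ℚ) * (x * pivot g (R s.b).1) = x * (((s.α : ℤ) : ℚ) * pivot g (R s.a).1 +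
        ((s.β : ℤ) : ℚ) * pivot g (R s.b).1) from fun x => by ring, hp', mul_zero, lead_cons_zero]

open Classical in
/-- The variables that occur in some functional of the node. -/
noncomputable def freeVars (R : Node e n) : Finset (Fin e) :=
  Finset.univ.filter fun j => ∃ i, (R i).1 j.succ ≠ 0

theorem Pair.comb_apply_eq_zero (s : Pair n) {R : Node e n} {j : Fin e} (hj : j ∉ freeVars R) :
    s.comb R j.succ = 0 := by
  simp only [freeVars, Finset.mem_filter, Finset.mem_univ, true_and, not_exists, not_not] at hj
  simp [Pair.comb, hj]

theorem card_freeVars_child_lt (s : Pair n) (R : Node e n) (h : ∃ j : Fin e, s.comb R j.succ ≠ 0) :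
    (freeVars (child R (s.comb R))).card < (freeVars R).card := by
  rcases pivot_cases (s.comb R) with ⟨h1, -⟩ | ⟨j, hj, h1⟩
  · obtain ⟨j, hj⟩ := h
    exact absurd (h1 j) hj
  · refine Finset.card_lt_card (Finset.ssubset_iff_subset_ne.2 ⟨fun l hl => ?_, fun heq => ?_⟩)
    · by_contra hl'
      have h2 := s.comb_apply_eq_zero hl'
      simp only [freeVars, Finset.mem_filter, Finset.mem_univ, true_and, not_exists, not_not] at hl hl'
      obtain ⟨i, hi⟩ := hl
      simp [child, h2, hl' i] at hi
    · have h2 : j ∈ freeVars R := by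
        by_contra hj'
        exact hj (s.comb_apply_eq_zero hj')
      rw [← heq] at h2
      simp only [freeVars, Finset.mem_filter, Finset.mem_univ, true_and] at h2
      obtain ⟨i, hi⟩ := h2
      simp [child, h1, hj] at hi

theorem lead_cast (l : List ℚ) : ((lead l : ℚ) : ℝ) = lead (l.map fun x : ℚ => (x : ℝ)) := by
  induction l with
  | nil => simp [lead]
  | cons x l ih => by_cases hx : x = 0 <;> simp [lead, hx, ih]

/-- A point `(1, δ, δ², …)` with `δ > 0` at which finitely many rational functionals have the sign of
their first nonzero coefficient and finitely many real ones do not vanish unless they are zero. -/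
theorem exists_base_point {T U : Type*} [Finite T] [Finite U] (c : T → Fin (e + 1) → ℚ)
    (f : U → Fin (e + 1) → ℝ) :
    ∃ o : Fin (e + 1) → ℝ, o 0 = 1 ∧
      (∀ s, (0 < lead (List.ofFn (c s)) → 0 < val (c s) o) ∧
        (lead (List.ofFn (c s)) < 0 → val (c s) o < 0)) ∧
      ∀ u, ∑ i, f u i * o i = 0 → f u = 0 := by
  have h1 : ∀ᶠ δ in 𝓝[>] (0 : ℝ), ∀ s, (0 < lead (List.ofFn fun i => (c s i : ℝ)) →
      0 < evalList (List.ofFn fun i => (c s i : ℝ)) δ) ∧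
      (lead (List.ofFn fun i => (c s i : ℝ)) < 0 →
        evalList (List.ofFn fun i => (c s i : ℝ)) δ < 0) :=
    eventually_all.2 fun s => eventually_sign_evalList _
  have h2 : ∀ᶠ δ in 𝓝[>] (0 : ℝ), ∀ u, (0 < lead (List.ofFn (f u)) →
      0 < evalList (List.ofFn (f u)) δ) ∧
      (lead (List.ofFn (f u)) < 0 → evalList (List.ofFn (f u)) δ < 0) :=
    eventually_all.2 fun u => eventually_sign_evalList _
  obtain ⟨δ, hδ1, hδ2⟩ := (h1.and h2).exists
  refine ⟨fun i => δ ^ (i : ℕ), by simp, fun s => ?_, fun u hu => ?_⟩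
  · have h3 := hδ1 s
    rw [show (List.ofFn fun i => (c s i : ℝ)) = (List.ofFn (c s)).map fun x : ℚ => (x : ℝ) by
      rw [List.map_ofFn]; rfl, ← lead_cast, List.map_ofFn, evalList_ofFn] at h3
    exact ⟨fun h => h3.1 (by exact_mod_cast h), fun h => h3.2 (by exact_mod_cast h)⟩
  · rw [← evalList_ofFn] at hu
    have h3 : lead (List.ofFn (f u)) = 0 := by
      rcases lt_trichotomy (lead (List.ofFn (f u))) 0 with h | h | h
      · exact absurd hu ((hδ2 u).2 h).ne
      · exact h
      · exact absurd hu ((hδ2 u).1 h).ne'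
    funext i
    exact lead_eq_zero h3 _ (List.mem_ofFn.2 ⟨i, rfl⟩)

/-- The cells found by successive restrictions cover the space: for each point `p` there is a leaf
such that each signed sum of two functionals that is nonnegative at the leaf is nonnegative at `p`.

If this fails for the base point `o` of the flat, then among the hyperplanes that separate `p` from
`o` the one that is met first on the way from `p` to `o`, in the point `p'`, is the right one to
restrict to: a signed sum that is nonnegative at `p'` and negative at `p` must, by the genericity of
`o`, be a positive multiple of the one for this hyperplane, and its sign at the leaves is then given
by the direction into which they are pushed off. -/
theorem exists_leaf_cover (hn : 0 < n) (d : ℕ) (R : Node e n) (p : Fin (e + 1) → ℝ) (hp : 0 < p 0)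
    (hd : (freeVars R).card ≤ d) :
    ∃ L ∈ leaves d R, ∀ s : Pair n, s.a ≠ s.b → 0 ≤ lead (s.key L) → 0 ≤ val (s.comb R) p := by
  induction d generalizing R p with
  | zero =>
    obtain ⟨L, hL, h⟩ := exists_leaf_eq hn 0 R
    refine ⟨L, hL, fun s _ hs => ?_⟩
    obtain ⟨l, hl⟩ := h s
    rw [hl] at hs
    have hs := lead_nonneg_of_append hs
    have h0 : ∀ j : Fin e, s.comb R j.succ = 0 := fun j =>
      s.comb_apply_eq_zero (by rw [Finset.card_eq_zero.1 (Nat.le_zero.1 hd)]; simp)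
    rw [List.ofFn_succ] at hs
    have h1 : 0 ≤ s.comb R 0 := by
      by_cases h2 : s.comb R 0 = 0
      · exact h2.ge
      · rwa [lead_cons_of_ne h2] at hs
    rw [val, Fin.sum_univ_succ]
    simp only [h0, Rat.cast_zero, zero_mul, Finset.sum_const_zero, add_zero]
    have : (0 : ℝ) ≤ (s.comb R 0 : ℚ) := by exact_mod_cast h1
    positivity
  | succ d ih =>
    by_cases hcov : ∀ s : Pair n, s.a ≠ s.b → 0 ≤ lead (List.ofFn (s.comb R)) → 0 ≤ val (s.comb R) p
    · obtain ⟨L, hL, h⟩ := exists_leaf_eq hn (d + 1) R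
      refine ⟨L, hL, fun s hsab hs => ?_⟩
      obtain ⟨l, hl⟩ := h s
      rw [hl] at hs
      exact hcov s hsab (lead_nonneg_of_append hs)
    push Not at hcov
    obtain ⟨s₀, hs₀, hs₀', hs₀''⟩ := hcov
    obtain ⟨o, ho0, ho, hof⟩ := exists_base_point (fun s : Pair n => s.comb R)
      fun (u : Pair n × Pair n) i => val (u.1.comb R) p * (u.2.comb R i : ℝ) -
        val (u.2.comb R) p * (u.1.comb R i : ℝ)
    have hval0 : ∀ s : Pair n, lead (List.ofFn (s.comb R)) = 0 → ∀ x, val (s.comb R) x = 0 := by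
      intro s hs x
      have h1 : ∀ i, s.comb R i = 0 := fun i => lead_eq_zero hs _ (List.mem_ofFn.2 ⟨i, rfl⟩)
      simp [val, h1]
    -- The signed sums that are negative at `p` but not at `o`.
    let S : Set (Pair n) := {s | s.a ≠ s.b ∧ 0 ≤ val (s.comb R) o ∧ val (s.comb R) p < 0}
    have hS : S.Nonempty := by
      refine ⟨s₀, hs₀, ?_, hs₀''⟩
      rcases hs₀'.lt_or_eq with h | h
      · exact ((ho s₀).1 h).le
      · exact (hval0 s₀ h.symm o).ge
    obtain ⟨t, ⟨htab, hto, htp⟩, htmax⟩ := Set.exists_max_image S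
      (fun s => val (s.comb R) o / -val (s.comb R) p) (Set.toFinite S) hS
    set h := t.comb R with hh
    set O := val h o with hO
    set P := -val h p with hP
    have hP0 : 0 < P := by rw [hP]; linarith
    let p' : Fin (e + 1) → ℝ := fun i => O * p i + P * o i
    have hp'0 : 0 < p' 0 := by
      have : 0 ≤ O * p 0 := mul_nonneg hto hp.le
      simp only [p', ho0, mul_one]
      linarith
    have hhp' : val h p' = 0 := by
      rw [val_comb, ← hO]
      linear_combination O * hP
    have hlead : 0 < lead (List.ofFn h) := by
      rcases lt_trichotomy (lead (List.ofFn h)) 0 with h1 | h1 | h1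
      · exact absurd ((ho t).2 h1) hto.not_gt
      · exact absurd (hval0 t h1 p) htp.ne
      · exact h1
    have hpiv : ∃ j : Fin e, h j.succ ≠ 0 := by
      by_contra hcon
      push Not at hcon
      have h1 : ∀ x, val h x = (h 0 : ℝ) * x 0 := fun x => by
        rw [val, Fin.sum_univ_succ]; simp [hcon]
      rw [hO, h1, ho0, mul_one] at hto
      rw [h1] at htp
      exact absurd htp (mul_nonneg hto hp.le).not_gt
    obtain ⟨L, hL, hcover⟩ := ih (child R h) p' hp'0 (by
      have : (freeVars (child R h)).card < _ := card_freeVars_child_lt t R hpiv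
      omega)
    refine ⟨L, by rw [leaves, List.mem_flatMap]; exact ⟨_, t.child_mem R htab, hL⟩, ?_⟩
    intro s hsab hs
    have h1 := hcover s hsab hs
    rw [Pair.comb_child, val_sub, val_smul, hhp', mul_zero, sub_zero, val_comb] at h1
    by_contra hneg
    push Not at hneg
    have hso : 0 ≤ val (s.comb R) o := by
      by_contra hcon
      push Not at hcon
      nlinarith [mul_nonneg hto (neg_nonneg.2 hneg.le), mul_pos hP0 (neg_pos.2 hcon)]
    have h2 := htmax s ⟨hsab, hso, hneg⟩
    rw [div_le_div_iff₀ (neg_pos.2 hneg) hP0] at h2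
    have h3 : O * val (s.comb R) p + P * val (s.comb R) o = 0 := by
      have : O * -val (s.comb R) p = -(O * val (s.comb R) p) := by ring
      have : val (s.comb R) o * P = P * val (s.comb R) o := by ring
      apply le_antisymm <;> linarith
    -- The signed sum is a multiple of `h`.
    have h4 := hof (s, t) (by
      simp only [sub_mul, Finset.sum_sub_distrib, mul_assoc, ← Finset.mul_sum]
      change val (s.comb R) p * val h o - val h p * val (s.comb R) o = 0
      rw [← hO]
      linear_combination h3 + val (s.comb R) o * hP)
    have h5 : ∀ i, val (s.comb R) p * (h i : ℝ) = -P * (s.comb R i : ℝ) := by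
      intro i
      have := congrFun h4 i
      simp only [Pi.zero_apply] at this
      rw [hP, ← hh] at *
      linear_combination this
    obtain ⟨hc, -⟩ | ⟨j, hj, hpj⟩ := pivot_cases h
    · obtain ⟨j, hj⟩ := hpiv
      exact hj (hc j)
    have hjR : (h j.succ : ℝ) ≠ 0 := by exact_mod_cast hj
    have hquot : ((pivot h (s.comb R) : ℚ) : ℝ) = -val (s.comb R) p / P := by
      rw [hpj]
      push_cast
      rw [div_eq_div_iff hjR hP0.ne']
      linear_combination h5 j.succ
    have hpos : 0 < pivot h (s.comb R) := by
      have : (0 : ℝ) < (pivot h (s.comb R) : ℚ) := by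
        rw [hquot]; exact div_pos (neg_pos.2 hneg) hP0
      exact_mod_cast this
    have hzero : s.comb (child R h) = 0 := by
      rw [Pair.comb_child]
      funext i
      have : ((s.comb R i - pivot h (s.comb R) * h i : ℚ) : ℝ) = 0 := by
        push_cast
        rw [hquot]
        field_simp
        linear_combination h5 i
      exact_mod_cast this
    rw [lead_key_of_comb_eq_zero s d _ hzero hL] at hs
    have hkey : List.zipWith (fun x y => ((s.α : ℤ) : ℚ) * x + ((s.β : ℤ) : ℚ) * y)
        (child R h s.a).2 (child R h s.b).2 =
        (-lead (List.ofFn h) * pivot h (s.comb R)) :: List.zipWith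
          (fun x y => ((s.α : ℤ) : ℚ) * x + ((s.β : ℤ) : ℚ) * y) (R s.a).2 (R s.b).2 :=
      List.append_cancel_left (s.key_child R h)
    have hlt : -lead (List.ofFn h) * pivot h (s.comb R) < 0 := by
      rw [neg_mul]; exact neg_neg_of_pos (mul_pos hlead hpos)
    rw [hkey, lead_cons_of_ne hlt.ne] at hs
    exact absurd hs hlt.not_ge

end Cover

end

/-! ### Selecting the largest residuals -/

/-- The `m` largest elements: a set of at most `m` elements, of maximal weight among these for each
weight that is monotone. -/
theorem sum_le_sum_of_rank_lt {n : ℕ} {α : Type*} [LinearOrder α] {κ : Fin n → α}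
    (hκ : Function.Injective κ) (m : ℕ) :
    (Finset.univ.filter fun a => (Finset.univ.filter fun b => κ a < κ b).card < m).card ≤ m ∧
    ∀ w : Fin n → ℝ, (∀ a, 0 ≤ w a) → (∀ a b, κ a < κ b → w a ≤ w b) →
      ∀ T : Finset (Fin n), T.card ≤ m → ∑ i ∈ T, w i ≤
        ∑ i ∈ Finset.univ.filter fun a => (Finset.univ.filter fun b => κ a < κ b).card < m, w i := by
  set rank : Fin n → ℕ := fun a => (Finset.univ.filter fun b => κ a < κ b).card with hrank
  have hlt : ∀ a b, κ a < κ b → rank b < rank a := by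
    intro a b hab
    refine Finset.card_lt_card (Finset.ssubset_iff_of_subset ?_ |>.2 ⟨b, ?_, ?_⟩)
    · intro c hc
      simp only [Finset.mem_filter, Finset.mem_univ, true_and] at hc ⊢
      exact hab.trans hc
    · simpa using hab
    · simp
  have hlt' : ∀ a b, rank b < rank a → κ a < κ b := by
    intro a b hab
    rcases lt_trichotomy (κ a) (κ b) with h | h | h
    · exact h
    · rw [hκ h] at hab; exact absurd hab (lt_irrefl _)
    · exact absurd (hlt b a h) hab.le.not_gt
  have hinj : Function.Injective rank := by
    intro a b hab
    by_contra hne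
    rcases lt_or_gt_of_ne fun h => hne (hκ h) with h | h
    · exact (hlt a b h).ne' hab
    · exact (hlt b a h).ne hab
  have hn : ∀ a, rank a < n := fun a => by
    have : (Finset.univ.filter fun b => κ a < κ b) ⊂ Finset.univ :=
      Finset.filter_ssubset.2 ⟨a, Finset.mem_univ _, lt_irrefl _⟩
    simpa using Finset.card_lt_card this
  set S := Finset.univ.filter fun a => rank a < m with hS
  have hSm : S.card ≤ m := by
    have : (S.image rank) ⊆ Finset.range m := by
      intro x hx
      simp only [hS, Finset.mem_image, Finset.mem_filter, Finset.mem_univ, true_and] at hx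
      obtain ⟨a, ha, rfl⟩ := hx
      simpa using ha
    simpa [Finset.card_image_of_injective _ hinj] using Finset.card_le_card this
  refine ⟨hSm, fun w hw0 hw T hT => ?_⟩
  -- All ranks occur, so a set that leaves out some element has exactly `m` elements.
  have hcard : ∀ b ∉ S, S.card = m := by
    intro b hb
    have hbm : m ≤ rank b := by simpa [hS] using hb
    have himg : Finset.univ.image rank = Finset.range n := by
      refine Finset.eq_of_subset_of_card_le ?_ ?_
      · intro x hx
        obtain ⟨a, -, rfl⟩ := Finset.mem_image.1 hx
        simpa using hn a
      · rw [Finset.card_image_of_injective _ hinj]; simp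
    have : S.image rank = Finset.range m := by
      ext x
      constructor
      · intro hx
        obtain ⟨a, ha, rfl⟩ := Finset.mem_image.1 hx
        simpa [hS] using ha
      · intro hx
        have hx' : x ∈ Finset.univ.image rank := by
          rw [himg]
          have := hn b
          simp at hx ⊢
          omega
        obtain ⟨a, -, rfl⟩ := Finset.mem_image.1 hx'
        exact Finset.mem_image.2 ⟨a, by simpa [hS] using hx, rfl⟩
    rw [← Finset.card_image_of_injective S hinj, this, Finset.card_range]
  rw [← Finset.sum_sdiff (Finset.inter_subset_left : T ∩ S ⊆ T),
    ← Finset.sum_sdiff (Finset.inter_subset_right : T ∩ S ⊆ S)]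
  refine add_le_add ?_ le_rfl
  rcases (T \ (T ∩ S)).eq_empty_or_nonempty with h | h
  · rw [h, Finset.sum_empty]
    exact Finset.sum_nonneg fun i _ => hw0 i
  · obtain ⟨b, hb, hbmax⟩ := Finset.exists_max_image _ w h
    have hbS : b ∉ S := by
      simp only [Finset.mem_sdiff, Finset.mem_inter, not_and] at hb
      exact hb.2 hb.1
    have hle : (T \ (T ∩ S)).card ≤ (S \ (T ∩ S)).card := by
      have h1 := Finset.card_sdiff_add_card_eq_card (Finset.inter_subset_left : T ∩ S ⊆ T)
      have h2 := Finset.card_sdiff_add_card_eq_card (Finset.inter_subset_right : T ∩ S ⊆ S)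
      have h3 := hcard b hbS
      omega
    calc ∑ i ∈ T \ (T ∩ S), w i ≤ (T \ (T ∩ S)).card • w b := Finset.sum_le_card_nsmul _ _ _ hbmax
      _ ≤ (S \ (T ∩ S)).card • w b := nsmul_le_nsmul_left (hw0 b) hle
      _ ≤ ∑ i ∈ S \ (T ∩ S), w i := by
        refine Finset.card_nsmul_le_sum _ _ _ fun a ha => hw b a (hlt' b a ?_)
        have ha' : rank a < m := by
          have := (Finset.mem_sdiff.1 ha).1
          simpa [hS] using this
        have hb' : m ≤ rank b := by simpa [hS] using hbS
        omega

section Select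

variable {e n : ℕ}

/-- A sign as a rational number, `1` for nonnegative arguments. -/
def sgn (x : ℚ) : ℚ := 2 * (if 0 ≤ x then 1 else 0) - 1

/-- The absolute value of a functional with its derivatives, in the lexicographic order, followed by
the index `i` that breaks ties. -/
def absKey (u : (Fin (e + 1) → ℚ) × List ℚ) (i : ℕ) : List ℚ :=
  (List.ofFn u.1 ++ u.2).map (sgn (lead (List.ofFn u.1 ++ u.2)) * ·) ++ [(i : ℚ)]

/-- The number of functionals of larger absolute value. -/
def rank (L : Node e n) (a : Fin n) : ℚ :=
  ∑ b, (1 - if lead (List.zipWith (· - ·) (absKey (L b) b) (absKey (L a) a)) ≤ 0 then 1 else 0)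

/-- The indicator function of the functionals with the `t` largest absolute values. -/
def select (t : ℚ) (L : Node e n) (a : Fin n) : ℚ := if rank L a + 1 ≤ t then 1 else 0

theorem exists_sign (x : ℚ) : ∃ ε : ℤˣ, sgn x = ((ε : ℤ) : ℚ) ∧ 0 ≤ ((ε : ℤ) : ℚ) * x := by
  by_cases h : 0 ≤ x
  · exact ⟨1, by simp [sgn, h]; norm_num, by simpa⟩
  · exact ⟨-1, by simp [sgn, h], by simpa using (not_le.1 h).le⟩

theorem keyComb_eq (α β : ℚ) (u v : (Fin (e + 1) → ℚ) × List ℚ) :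
    keyComb α β u v = List.zipWith (fun x y => α * x + β * y) (List.ofFn u.1 ++ u.2)
      (List.ofFn v.1 ++ v.2) := by
  rw [List.zipWith_append (by simp), zipWith_ofFn]
  rfl

theorem length_absKey (u : (Fin (e + 1) → ℚ) × List ℚ) (i : ℕ) :
    (absKey u i).length = e + 1 + u.2.length + 1 := by
  simp [absKey]
  omega

theorem length_snd_leaves {d q : ℕ} {R L : Node e n} (hR : ∀ i, (R i).2.length = q)
    (hL : L ∈ leaves d R) (i : Fin n) : (L i).2.length = q + d := by
  induction d generalizing R q with
  | zero =>
    simp only [leaves, List.mem_singleton] at hL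
    rw [hL, hR, add_zero]
  | succ d ih =>
    rw [leaves, List.mem_flatMap] at hL
    obtain ⟨R', hR', hL⟩ := hL
    simp only [children, List.mem_flatMap, List.mem_map] at hR'
    obtain ⟨a, -, b, -, rfl⟩ := hR'
    rw [ih (q := q + 1) (fun i => by simp [child, hR i]) hL]
    omega

/-- The order of the absolute values at a leaf that covers the point `p` is the order at `p`. -/
theorem sq_val_le_of_absKey_lt {d q : ℕ} {R L : Node e n} {p : Fin (e + 1) → ℝ}
    (hR : ∀ i, (R i).2.length = q) (hL : L ∈ leaves d R)
    (hcov : ∀ s : Pair n, s.a ≠ s.b → 0 ≤ lead (s.key L) → 0 ≤ val (s.comb R) p) {a b : Fin n}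
    (hab : absKey (L a) a < absKey (L b) b) : val (R a).1 p ^ 2 ≤ val (R b).1 p ^ 2 := by
  have hne : b ≠ a := by rintro rfl; exact lt_irrefl _ hab
  have hlen : (absKey (L b) b).length = (absKey (L a) a).length := by
    simp [length_absKey, length_snd_leaves hR hL]
  obtain ⟨α, hα, hα'⟩ := exists_sign (lead (List.ofFn (L a).1 ++ (L a).2))
  obtain ⟨β, hβ, hβ'⟩ := exists_sign (lead (List.ofFn (L b).1 ++ (L b).2))
  have hα0 : ((α : ℤ) : ℚ) ≠ 0 := by simp
  have hβ0 : ((β : ℤ) : ℚ) ≠ 0 := by simp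
  have h1 := (lead_sub_pos_iff hlen).2 hab
  rw [absKey, absKey, List.zipWith_append (by simp [length_snd_leaves hR hL]), hα, hβ,
    List.zipWith_map] at h1
  have h2 := lead_nonneg_of_append h1.le
  have h3 := hcov ⟨b, a, β, -α⟩ hne (by
    rw [Pair.key, keyComb_eq]
    have : (fun x y : ℚ => ((β : ℤ) : ℚ) * x + (((-α : ℤˣ) : ℤ) : ℚ) * y) =
        fun x y => ((β : ℤ) : ℚ) * x - ((α : ℤ) : ℚ) * y := by
      funext x y
      push_cast
      ring
    rw [this]
    exact h2)
  have h4 := hcov ⟨b, a, β, α⟩ hne (by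
    rw [Pair.key, keyComb_eq]
    have := lead_add_nonneg (l := (List.ofFn (L b).1 ++ (L b).2).map (((β : ℤ) : ℚ) * ·))
      (m := (List.ofFn (L a).1 ++ (L a).2).map (((α : ℤ) : ℚ) * ·))
      (by rwa [lead_map_mul hβ0]) (by rwa [lead_map_mul hα0])
    rwa [List.zipWith_map] at this)
  simp only [Pair.comb, val_add, val_smul] at h3 h4
  have e1 : (((α : ℤ) : ℚ) : ℝ) ^ 2 = 1 := by
    rcases Int.units_eq_one_or α with rfl | rfl <;> simp
  have e2 : (((β : ℤ) : ℚ) : ℝ) ^ 2 = 1 := by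
    rcases Int.units_eq_one_or β with rfl | rfl <;> simp
  have e3 : (((-α : ℤˣ) : ℤ) : ℚ) = -((α : ℤ) : ℚ) := by push_cast; ring
  rw [e3] at h3
  push_cast at h3 h4 e1 e2
  nlinarith [mul_nonneg h3 h4]

theorem select_spec {d q : ℕ} {R L : Node e n} (hR : ∀ i, (R i).2.length = q)
    (hL : L ∈ leaves d R) (m : ℕ) :
    ∑ a, select m L a ≤ m ∧ ∀ p : Fin (e + 1) → ℝ,
      (∀ s : Pair n, s.a ≠ s.b → 0 ≤ lead (s.key L) → 0 ≤ val (s.comb R) p) →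
      ∀ T : Finset (Fin n), T.card ≤ m → ∑ i ∈ T, val (R i).1 p ^ 2 ≤
        ∑ i ∈ Finset.univ.filter fun a => select m L a ≠ 0, val (R i).1 p ^ 2 := by
  have hlen : ∀ a b : Fin n, (absKey (L a) a).length = (absKey (L b) b).length := fun a b => by
    simp [length_absKey, length_snd_leaves hR hL]
  have hinj : Function.Injective fun a : Fin n => absKey (L a) a := by
    intro a b hab
    have h1 : List.length [((a : ℕ) : ℚ)] = List.length [((b : ℕ) : ℚ)] := rfl
    have := (List.append_inj' hab h1).2
    simpa [Fin.ext_iff] using this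
  have hrank : ∀ a, rank L a =
      ((Finset.univ.filter fun b : Fin n => absKey (L a) a < absKey (L b) b).card : ℚ) := by
    intro a
    rw [rank, Finset.card_filter]
    push_cast
    refine Finset.sum_congr rfl fun b _ => ?_
    have h' := lead_sub_pos_iff (hlen b a)
    by_cases h : absKey (L a) a < absKey (L b) b
    · rw [if_pos h, if_neg (h'.2 h).not_ge, sub_zero]
    · rw [if_neg h, if_pos (not_lt.1 fun h'' => h (h'.1 h'')), sub_self]
  have hsel : ∀ a, select m L a = if (Finset.univ.filter fun b : Fin n =>
      absKey (L a) a < absKey (L b) b).card < m then 1 else 0 := by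
    intro a
    rw [select, hrank]
    congr 1
    rw [← Nat.succ_le_iff, Nat.succ_eq_add_one]
    exact_mod_cast rfl
  obtain ⟨h1, h2⟩ := sum_le_sum_of_rank_lt hinj m
  constructor
  · simp only [hsel]
    rw [Finset.sum_boole, Nat.cast_le]
    convert h1
  · intro p hcov T hT
    have := h2 (fun i => val (R i).1 p ^ 2) (fun i => sq_nonneg _)
      (fun a b hab => sq_val_le_of_absKey_lt hR hL hcov hab) T hT
    simp only [hsel, ne_eq, ite_eq_right_iff, one_ne_zero, imp_false, not_not]
    convert this

end Select

/-! ### The candidate supports -/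

section Masks

variable {n k : ℕ}

/-- All vectors of length `k` with entries `0` and `1`. -/
def zeroOneVecs : (k : ℕ) → List (Fin k → ℚ)
  | 0 => [0]
  | k + 1 => (zeroOneVecs k).map (Fin.cons (α := fun _ => ℚ) 0) ++
      (zeroOneVecs k).map (Fin.cons (α := fun _ => ℚ) 1)

theorem length_zeroOneVecs (k : ℕ) : (zeroOneVecs k).length = 2 ^ k := by
  induction k with
  | zero => rfl
  | succ k ih => simp [zeroOneVecs, ih, pow_succ]; ring

theorem mem_zeroOneVecs {J : Fin k → ℚ} : J ∈ zeroOneVecs k ↔ ∀ j, J j = 0 ∨ J j = 1 := by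
  induction k with
  | zero => simp [zeroOneVecs, Subsingleton.elim J 0]
  | succ k ih =>
    refine Fin.consCases (fun x J => ?_) J
    simp only [zeroOneVecs, List.mem_append, List.mem_map, Fin.cons_inj, Fin.forall_fin_succ,
      Fin.cons_zero, Fin.cons_succ, ← ih]
    constructor
    · rintro (⟨J', h, rfl, rfl⟩ | ⟨J', h, rfl, rfl⟩)
      · exact ⟨.inl rfl, h⟩
      · exact ⟨.inr rfl, h⟩
    · rintro ⟨rfl | rfl, h⟩
      · exact .inl ⟨J, h, rfl, rfl⟩
      · exact .inr ⟨J, h, rfl, rfl⟩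

/-- The vector `J` if its sum is at most `σ`, and otherwise `0`. -/
def capSum (σ : ℕ) (J : Fin k → ℚ) : Fin k → ℚ := fun j => (if ∑ j, J j ≤ σ then 1 else 0) * J j

/-- The residuals `b - C z - μ c`, as functionals of `-μ` and `-z`, where only the columns of `C`
marked by `J` are used, and where residuals in rows with a zero diagonal entry of `A` are replaced
by `0`. -/
def rootMatrix (A : Matrix (Fin n) (Fin n) ℚ) (C : Matrix (Fin n) (Fin k) ℚ) (c b : Fin n → ℚ)
    (J : Fin k → ℚ) : Matrix (Fin n) (Fin (k + 1 + 1)) ℚ :=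
  Matrix.of fun i => Fin.cons (A i i / A i i * b i)
    (Fin.cons (A i i / A i i * c i) fun j => A i i / A i i * (J j * C i j))

/-- The node with the rows of `rootMatrix`. -/
def rootNode (A : Matrix (Fin n) (Fin n) ℚ) (C : Matrix (Fin n) (Fin k) ℚ) (c b : Fin n → ℚ)
    (J : Fin k → ℚ) : Node (k + 1) n := fun i => (rootMatrix A C c b J i, [])

/-- The indicator function of the support that consists of the columns of `C` marked by `J`, and of
columns of `A` for the largest residuals. -/
def maskOf (σ : ℕ) (J : Fin k → ℚ) (L : Node (k + 1) n) : Fin (n + k) → ℚ :=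
  Fin.append (select ((σ : ℚ) - ∑ j, J j) L) J

/-- The indicator functions of the candidate supports.  The zero vector is listed because there are no
leaves when `n = 0`. -/
def masks (A : Matrix (Fin n) (Fin n) ℚ) (C : Matrix (Fin n) (Fin k) ℚ) (c b : Fin n → ℚ) (σ : ℕ) :
    List (Fin (n + k) → ℚ) :=
  0 :: ((zeroOneVecs k).map (capSum σ)).flatMap fun J =>
    (leaves (k + 1) (rootNode A C c b J)).map (maskOf σ J)

variable {A : Matrix (Fin n) (Fin n) ℚ} {C : Matrix (Fin n) (Fin k) ℚ} {c b : Fin n → ℚ} {σ : ℕ}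

theorem length_masks :
    (masks A C c b σ).length = 1 + 2 ^ k * n ^ (2 * (k + 1)) := by
  simp only [masks, List.length_cons, List.length_flatMap, List.length_map, length_leaves]
  rw [List.map_const', List.sum_replicate, List.length_map, length_zeroOneVecs, smul_eq_mul,
    ← pow_mul, add_comm]

theorem capSum_cases {J : Fin k → ℚ} (hJ : J ∈ zeroOneVecs k) :
    (∀ j, capSum σ J j = 0 ∨ capSum σ J j = 1) ∧ ∃ m : ℕ, (σ : ℚ) - ∑ j, capSum σ J j = m := by
  rw [mem_zeroOneVecs] at hJ
  by_cases h : ∑ j, J j ≤ (σ : ℚ)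
  · have h1 : capSum σ J = J := by funext j; simp [capSum, h]
    rw [h1]
    refine ⟨hJ, σ - (Finset.univ.filter fun j => J j = 1).card, ?_⟩
    have h2 : ∑ j, J j = ((Finset.univ.filter fun j => J j = 1).card : ℚ) := by
      rw [Finset.card_filter]
      push_cast
      refine Finset.sum_congr rfl fun j _ => ?_
      rcases hJ j with h | h <;> simp [h]
    rw [h2] at h ⊢
    rw [Nat.cast_sub (by exact_mod_cast h)]
  · have h1 : capSum σ J = 0 := by funext j; simp [capSum, h]
    rw [h1]
    exact ⟨fun j => .inl rfl, σ, by simp⟩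

theorem masks_spec {f : Fin (n + k) → ℚ} (hf : f ∈ masks A C c b σ) :
    (∀ i, f i = 0 ∨ f i = 1) ∧ ∑ i, f i ≤ σ := by
  rw [masks, List.mem_cons] at hf
  rcases hf with rfl | hf
  · exact ⟨fun i => .inl rfl, by simp⟩
  · simp only [List.mem_flatMap, List.mem_map] at hf
    obtain ⟨_, ⟨J, hJ, rfl⟩, L, hL, rfl⟩ := hf
    obtain ⟨h1, m, hm⟩ := capSum_cases (σ := σ) hJ
    have h2 := (select_spec (q := 0) (fun i => rfl) hL m).1
    constructor
    · intro i
      refine Fin.addCases (fun i => ?_) (fun j => ?_) i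
      · rw [maskOf, Fin.append_left, select]
        split <;> simp
      · rw [maskOf, Fin.append_right]
        exact h1 j
    · rw [Fin.sum_univ_add]
      simp only [maskOf, Fin.append_left, Fin.append_right, hm]
      linarith

theorem objective_sq (M : Matrix (Fin n) (Fin k) ℚ) (c b : Fin n → ℚ) (x : Fin k → ℝ) (μ : ℝ) :
    objective M c b x μ = Real.sqrt (∑ i, (∑ j, (M i j : ℝ) * x j + μ * c i - b i) ^ 2) := by
  rw [objective, EuclideanSpace.norm_eq]
  simp [mulVec, dotProduct]

theorem sum_blockRow (hA : A.IsDiag) (x : Fin (n + k) → ℝ) (i : Fin n) :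
    ∑ j, (blockRow A C i j : ℝ) * x j =
      A i i * x (Fin.castAdd k i) + ∑ j, (C i j : ℝ) * x (Fin.natAdd n j) := by
  rw [Fin.sum_univ_add]
  congr 1
  · rw [Finset.sum_eq_single i]
    · simp [blockRow]
    · intro j _ hj
      simp [blockRow, hA hj.symm]
    · simp
  · simp [blockRow]

theorem ncard_support (x : Fin (n + k) → ℝ) :
    (Function.support x).ncard = (Finset.univ.filter fun i => x (Fin.castAdd k i) ≠ 0).card +
      (Finset.univ.filter fun j => x (Fin.natAdd n j) ≠ 0).card := by
  have h : Function.support x = ↑(Finset.univ.filter fun i => x i ≠ 0) := by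
    ext i; simp
  rw [h, Set.ncard_coe_finset, Finset.card_filter, Fin.sum_univ_add, Finset.card_filter,
    Finset.card_filter]

/-- Each feasible point is dominated by a point supported in one of the candidate supports. -/
theorem exists_mask (hA : A.IsDiag) (y : Fin (n + k) → ℝ) (ν : ℝ)
    (hy : (Function.support y).ncard ≤ σ) :
    ∃ f ∈ masks A C c b σ, ∃ x : Fin (n + k) → ℝ, (∀ i, f i = 0 → x i = 0) ∧
      objective (blockRow A C) c b x ν ≤ objective (blockRow A C) c b y ν := by
  rcases Nat.eq_zero_or_pos n with rfl | hn
  · exact ⟨0, by simp [masks], 0, fun _ _ => rfl, by simp [objective_sq]⟩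
  set z : Fin k → ℝ := fun j => y (Fin.natAdd n j) with hz
  set J : Fin k → ℚ := fun j => if z j ≠ 0 then 1 else 0 with hJdef
  set m : ℕ := σ - (Finset.univ.filter fun j => z j ≠ 0).card with hm
  rw [ncard_support] at hy
  change _ + (Finset.univ.filter fun j => z j ≠ 0).card ≤ σ at hy
  have hJ : J ∈ zeroOneVecs k := by
    rw [mem_zeroOneVecs]
    intro j
    by_cases h : z j = 0 <;> simp [J, h]
  have hsumJ : ∑ j, J j = ((Finset.univ.filter fun j => z j ≠ 0).card : ℚ) := by
    rw [Finset.sum_boole]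
  have hcap : capSum σ J = J := by
    have : ∑ j, J j ≤ (σ : ℚ) := by
      rw [hsumJ]
      exact_mod_cast (Nat.le_add_left _ _).trans hy
    funext j; simp [capSum, this]
  have hmJ : (σ : ℚ) - ∑ j, J j = m := by
    rw [hsumJ, hm, Nat.cast_sub ((Nat.le_add_left _ _).trans hy)]
  let p : Fin (k + 1 + 1) → ℝ := Fin.cons 1 (Fin.cons (-ν) fun j => -z j)
  obtain ⟨L, hL, hcov⟩ := exists_leaf_cover hn (k + 1) (rootNode A C c b J) p (by simp [p])
    ((Finset.card_le_univ _).trans (by simp))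
  have hsel := (select_spec (q := 0) (fun i => rfl) hL m).2 p hcov
    (Finset.univ.filter fun i => y (Fin.castAdd k i) ≠ 0) (by omega)
  -- The residuals.
  let r : Fin n → ℝ := fun i => b i - ν * c i - ∑ j, (C i j : ℝ) * z j
  have hval : ∀ i, val (rootNode A C c b J i).1 p = (A i i / A i i : ℚ) * r i := by
    intro i
    simp only [val, rootNode, rootMatrix, Matrix.of_apply, Fin.sum_univ_succ, Fin.cons_zero,
      Fin.cons_succ, p, r]
    push_cast
    rw [mul_sub, mul_sub, Finset.mul_sum, ← sub_eq_zero]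
    have : ∀ j, (A i i / A i i : ℝ) * (J j * C i j) * -z j =
        -((A i i / A i i : ℝ) * (C i j * z j)) := by
      intro j
      by_cases h : z j = 0 <;> simp [J, h]
      ring
    simp only [this, Finset.sum_neg_distrib]
    ring
  have hfun : ∀ i, val (rootNode A C c b J i).1 p ^ 2 = if A i i = 0 then 0 else r i ^ 2 := by
    intro i
    rw [hval]
    by_cases h : A i i = 0 <;> simp [h]
  simp only [hfun] at hsel
  refine ⟨maskOf σ J L, ?_, Fin.append (fun i => if select m L i ≠ 0 then r i / A i i else 0) z,
    ?_, ?_⟩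
  · rw [masks]
    refine List.mem_cons_of_mem _ (List.mem_flatMap.2 ⟨J, ?_, ?_⟩)
    · exact List.mem_map.2 ⟨J, hJ, hcap⟩
    · exact List.mem_map.2 ⟨L, hL, rfl⟩
  · intro i
    refine Fin.addCases (fun i => ?_) (fun j => ?_) i
    · rw [maskOf, hmJ, Fin.append_left, Fin.append_left]
      intro h
      simp [h]
    · rw [maskOf, Fin.append_right, Fin.append_right]
      intro h
      by_contra hne
      simp [J, hne] at h
  · rw [objective_sq, objective_sq]
    refine Real.sqrt_le_sqrt ?_
    simp only [sum_blockRow hA, Fin.append_left, Fin.append_right]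
    have h1 : ∀ i, ((A i i : ℝ) * (if select m L i ≠ 0 then r i / A i i else 0) +
        ∑ j, (C i j : ℝ) * z j + ν * c i - b i) ^ 2 =
        r i ^ 2 - if select m L i ≠ 0 then (if A i i = 0 then 0 else r i ^ 2) else 0 := by
      intro i
      by_cases h : select m L i = 0
      · simp only [h, ne_eq, not_true, if_false, r]
        ring
      · by_cases hAi : A i i = 0
        · simp only [h, hAi, ne_eq, not_false_iff, if_true, r]
          simp
          ring
        · have : (A i i : ℝ) ≠ 0 := by exact_mod_cast hAi
          simp only [h, hAi, ne_eq, not_false_iff, if_true, if_false]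
          rw [mul_div_cancel₀ _ this, sub_self]
          simp only [r]
          ring
    have h2 : ∀ i, r i ^ 2 - (if y (Fin.castAdd k i) ≠ 0 then (if A i i = 0 then 0 else r i ^ 2)
        else 0) ≤ ((A i i : ℝ) * y (Fin.castAdd k i) + ∑ j, (C i j : ℝ) * y (Fin.natAdd n j) +
          ν * c i - b i) ^ 2 := by
      intro i
      have e1 : (A i i : ℝ) * y (Fin.castAdd k i) + ∑ j, (C i j : ℝ) * y (Fin.natAdd n j) +
          ν * c i - b i = (A i i : ℝ) * y (Fin.castAdd k i) - r i := by
        simp only [r, z]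
        ring
      rw [e1]
      by_cases h : y (Fin.castAdd k i) = 0
      · simp [h]
      · by_cases hAi : A i i = 0
        · simp [hAi]
        · simp only [h, hAi, ne_eq, not_false_iff, if_true, if_false, sub_self]
          positivity
    refine le_trans (le_of_eq (Finset.sum_congr rfl fun i _ => h1 i)) (le_trans ?_
      (Finset.sum_le_sum fun i _ => h2 i))
    rw [Finset.sum_sub_distrib, Finset.sum_sub_distrib, ← Finset.sum_filter, ← Finset.sum_filter]
    exact sub_le_sub_left hsel _

end Masks

/-! ### Enumerating the candidate supports by a program -/

/-- A list of rational numbers as data. -/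
def encRats (l : List ℚ) : Data := encList (l.map .num)

theorem encVec_eq {m : ℕ} (v : Fin m → ℚ) : encVec v = encRats (List.ofFn v) := by
  rw [encVec, encRats, List.map_ofFn]; rfl

/-- A node as the list of its functionals with their indices. -/
def encNode {e n : ℕ} (L : Node e n) : Data :=
  encList (List.ofFn fun i : Fin n =>
    .pair (.num (i : ℕ)) (.pair (encVec (L i).1) (encRats (L i).2)))

namespace Data

/-- The rows of the matrix with the given columns; `c` is any list with an entry for each row. -/
def transpose (c cols : Data) : Data :=
  cols.reverse.toList.foldl (fun acc col => col.zipWith .pair acc) (c.map fun _ => .num 0)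

/-- The program for `SubsetSelection.pivot`. -/
def pivot (h r : Data) : Data :=
  let w := (h.snd.zipWith .pair r.snd).toList.foldl (fun acc x => cond acc.fst acc x)
    (.pair (.num 0) (.num 0))
  w.snd.div w.fst

/-- The program for one functional of `SubsetSelection.child`. -/
def childItem (h u : Data) : Data :=
  .pair u.fst (.pair (u.snd.fst.zipWith (fun x y => x.sub ((pivot h u.snd.fst).mul y)) h)
    (.pair (((num 0).sub h.lead).mul (pivot h u.snd.fst)) u.snd.snd))

/-- The program for `SubsetSelection.letter`. -/
def letter (u v : Data) : Data :=
  u.snd.fst.zipWith (fun x y => x.add (((num 1).sub ((num 2).mul (u.fst.le v.fst))).mul y)) v.snd.fst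

/-- The program for `SubsetSelection.children`. -/
def children (R : Data) : Data :=
  (R.map fun u => R.map fun v => R.map fun w => childItem (letter u v) w).flatten

/-- One level of restrictions, for a list of pairs of a vector `J` and a node. -/
def level (l : Data) : Data :=
  (l.map fun w => (children w.snd).map fun c => .pair w.fst c).flatten

/-- The program for `SubsetSelection.absKey`. -/
def absKey (u : Data) : Data :=
  let key := u.snd.fst.append u.snd.snd
  (key.map fun x => (((num 2).mul ((num 0).le key.lead)).sub (num 1)).mul x).append
    (.pair u.fst (.num 0))

/-- The program for `SubsetSelection.select`. -/
def select (t L : Data) : Data :=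
  (L.map absKey).map fun ka => le (add (sum ((L.map absKey).map fun kb =>
    (num 1).sub ((kb.zipWith sub ka).lead.le (num 0)))) (num 1)) t

/-- The program for `SubsetSelection.maskOf`. -/
def maskOf (s w : Data) : Data := (select (s.sub w.fst.sum) w.snd).append w.fst

/-- The program for `SubsetSelection.zeroOneVecs`. -/
def zeroOneVecs (l : Data) : Data :=
  l.toList.foldl (fun acc _ => (acc.map fun J => .pair (.num 0) J).append
    (acc.map fun J => .pair (.num 1) J)) (.pair (.num 0) (.num 0))

/-- The program for `SubsetSelection.capSum`. -/
def capSum (s J : Data) : Data := J.map fun x => (J.sum.le s).mul x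

/-- The program for `SubsetSelection.rootNode`; `d` lists the diagonal entries of `A`, and `C` the
columns of `C`. -/
def rootNode (d C c b J : Data) : Data :=
  c.iota.zipWith (fun i row => .pair i (.pair row (.num 0)))
    (transpose c ((Data.pair b (.pair c (J.zipWith (fun x col => col.map fun y => x.mul y) C))).map
      fun col => d.zipWith (fun a y => (a.div a).mul y) col))

/-- The columns of `C` in the input `(M, (c, (b, σ)))`. -/
def colsC (v : Data) : Data := v.snd.fst.dropLen v.fst

/-- The diagonal entries of `A` in the input `(M, (c, (b, σ)))`, computed as column sums. -/
def diagA (v : Data) : Data := v.snd.fst.zipWith (fun _ col => col.sum) v.fst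

/-- The pairs of a vector `J` and its root node. -/
def roots (v : Data) : Data :=
  ((zeroOneVecs (colsC v)).map fun J => capSum v.snd.snd.snd J).map fun J =>
    .pair J (rootNode (diagA v) (colsC v) v.snd.fst v.snd.snd.fst J)

/-- The program for `SubsetSelection.masks`. -/
def masks (v : Data) : Data :=
  .pair (v.fst.map fun _ => .num 0)
    (((Data.pair (.num 0) (colsC v)).toList.foldl (fun acc _ => level acc) (roots v)).map
      fun w => maskOf v.snd.snd.snd w)

theorem ht_zip_le (a b : Data) : (a.zipWith .pair b).ht ≤ a.ht + b.ht := by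
  induction a generalizing b with
  | num q => simp [zipWith, encList, ht_num_zero]; have := two_le_ht b; omega
  | pair x a _ ih =>
    cases b with
    | num q => simp [zipWith, encList, ht_num_zero]; have := two_le_ht x; omega
    | pair y b =>
      have := ih b
      simp [zipWith, encList] at this ⊢
      omega

end Data

section
variable {X : ι → Set Data} {f g h : Data → Data}

theorem PT.transpose (hf : PT rel X f) (hg : PT rel X g) :
    PT rel X fun v => (f v).transpose (g v) :=
  .fold_add (f := fun _ acc col => col.zipWith .pair acc)
    (.zip (.snd (.snd .id)) (.fst (.snd .id)))
    ⟨.X, fun v acc x => by have := x.ht_zip_le acc; simp; omega⟩ hg.reverse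
    (.map (f := fun _ _ => .num 0) (.const _) hf)

theorem PT.pivot (hf : PT rel X f) (hg : PT rel X g) : PT rel X fun v => (f v).pivot (g v) := by
  have h1 : PT rel X fun v => ((f v).snd.zipWith .pair (g v).snd).toList.foldl
      (fun acc x => Data.cond acc.fst acc x) (.pair (.num 0) (.num 0)) :=
    .fold_add (f := fun _ acc x => Data.cond acc.fst acc x)
      (.cond (.fst (.fst (.snd .id))) (.fst (.snd .id)) (.snd (.snd .id)))
      ⟨.X, fun v acc x => by have := Data.ht_cond_le acc.fst acc x; simp; omega⟩
      (.zip (.snd hf) (.snd hg)) (.const _)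
  exact .div (.snd h1) (.fst h1)

theorem PT.childItem (hf : PT rel X f) (hg : PT rel X g) :
    PT rel X fun v => (f v).childItem (g v) := by
  have : PTu rel fun w => w.fst.childItem w.snd :=
    .pair (.fst (.snd .id)) (.pair (.zipWith
      (f := fun w x y => x.sub ((w.fst.pivot w.snd.snd.fst).mul y))
      (.sub (.fst (.snd .id)) (.mul (.pivot (.fst (.fst .id)) (.fst (.snd (.snd (.fst .id)))))
        (.snd (.snd .id))))
      (.fst (.snd (.snd .id))) (.fst .id))
      (.pair (.mul (.sub (.const _) (.lead (.fst .id))) (.pivot (.fst .id) (.fst (.snd (.snd .id)))))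
        (.snd (.snd (.snd .id)))))
  exact this.comp₂ hf hg

theorem PT.letter (hf : PT rel X f) (hg : PT rel X g) :
    PT rel X fun v => (f v).letter (g v) := by
  have : PTu rel fun w => w.fst.letter w.snd :=
    .zipWith (f := fun w x y => x.add
        (((Data.num 1).sub ((Data.num 2).mul (w.fst.fst.le w.snd.fst))).mul y))
      (.add (.fst (.snd .id)) (.mul (.sub (.const _) (.mul (.const _)
        (.le (.fst (.fst (.fst .id))) (.fst (.snd (.fst .id)))))) (.snd (.snd .id))))
      (.fst (.snd (.fst .id))) (.fst (.snd (.snd .id)))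
  exact this.comp₂ hf hg

theorem PT.children (hf : PT rel X f) : PT rel X fun v => (f v).children := by
  have h1 : PTu rel fun w => w.fst.fst.map fun x => Data.childItem (w.fst.snd.letter w.snd) x :=
    .map (f := fun w x => Data.childItem (w.fst.snd.letter w.snd) x)
      (.childItem (.letter (.snd (.fst (.fst .id))) (.snd (.fst .id))) (.snd .id))
      (.fst (.fst .id))
  have h2 : PTu rel fun w => w.fst.map fun v => w.fst.map fun x =>
      Data.childItem (w.snd.letter v) x :=
    .map (f := fun w v => w.fst.map fun x => Data.childItem (w.snd.letter v) x) h1 (.fst .id)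
  have h3 : PTu rel Data.children :=
    .flatten (.map (f := fun R u => R.map fun v => R.map fun w => Data.childItem (u.letter v) w)
      h2 .id)
  exact h3.comp hf

theorem PT.level (hf : PT rel X f) : PT rel X fun v => (f v).level := by
  have h1 : PTu rel fun w => w.snd.snd.children.map fun c => .pair w.snd.fst c :=
    .map (f := fun w c => .pair w.snd.fst c) (.pair (.fst (.snd (.fst .id))) (.snd .id))
      (.children (.snd (.snd .id)))
  have h2 : PTu rel Data.level :=
    .flatten (.map (f := fun _ w => w.snd.children.map fun c => .pair w.fst c) h1 .id)
  exact h2.comp hf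

theorem PT.absKey (hf : PT rel X f) : PT rel X fun v => (f v).absKey := by
  have hkey : PTu rel fun u => u.snd.fst.append u.snd.snd :=
    .append (.fst (.snd .id)) (.snd (.snd .id))
  have : PTu rel Data.absKey :=
    .append (.map (f := fun u x => (((Data.num 2).mul ((Data.num 0).le
        (u.snd.fst.append u.snd.snd).lead)).sub (Data.num 1)).mul x)
      (.mul (.sub (.mul (.const _) (.le (.const _) (.lead (hkey.comp (.fst .id))))) (.const _))
        (.snd .id)) hkey) (.pair (.fst .id) (.const _))
  exact this.comp hf

theorem PT.select (hf : PT rel X f) (hg : PT rel X g) :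
    PT rel X fun v => (f v).select (g v) := by
  have h0 : PTu rel fun w => w.snd.map Data.absKey :=
    .map (f := fun _ u => u.absKey) (.absKey (.snd .id)) (.snd .id)
  have h1 : PTu rel fun w => (w.fst.snd.map Data.absKey).map fun kb =>
      (Data.num 1).sub ((kb.zipWith Data.sub w.snd).lead.le (Data.num 0)) :=
    .map (f := fun w kb => (Data.num 1).sub ((kb.zipWith Data.sub w.snd).lead.le (Data.num 0)))
      (.sub (.const _) (.le (.lead (.zipWith (f := fun _ x y => x.sub y)
        (.sub (.fst (.snd .id)) (.snd (.snd .id))) (.snd .id) (.snd (.fst .id)))) (.const _)))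
      (h0.comp (.fst .id))
  have h2 : PTu rel fun w => w.fst.select w.snd :=
    .map (f := fun w ka => Data.le (Data.add (Data.sum ((w.snd.map Data.absKey).map fun kb =>
      (Data.num 1).sub ((kb.zipWith Data.sub ka).lead.le (Data.num 0)))) (Data.num 1)) w.fst)
      (.le (.add (.sum h1) (.const _)) (.fst (.fst .id))) h0
  exact h2.comp₂ hf hg

theorem PT.maskOf (hf : PT rel X f) (hg : PT rel X g) : PT rel X fun v => (f v).maskOf (g v) :=
  .append (.select (.sub hf (.sum (.fst hg))) (.snd hg)) (.fst hg)

theorem PT.capSum (hf : PT rel X f) (hg : PT rel X g) : PT rel X fun v => (f v).capSum (g v) := by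
  have : PTu rel fun w => w.fst.capSum w.snd :=
    .map (f := fun w x => (w.snd.sum.le w.fst).mul x)
      (.mul (.le (.sum (.snd (.fst .id))) (.fst (.fst .id))) (.snd .id)) (.snd .id)
  exact this.comp₂ hf hg

theorem PTu.colsC : PTu rel Data.colsC := .dropLen (.fst (.snd .id)) (.fst .id)

theorem PTu.diagA : PTu rel Data.diagA :=
  .zipWith (f := fun _ _ col => col.sum) (.sum (.snd (.snd .id))) (.fst (.snd .id)) (.fst .id)

theorem PTu.rootNode : PTu rel fun w => Data.rootNode (Data.diagA w.fst) (Data.colsC w.fst)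
    w.fst.snd.fst w.fst.snd.snd.fst w.snd := by
  have h1 : PTu rel fun w => w.snd.snd.map fun y => w.snd.fst.mul y :=
    .map (f := fun w y => w.snd.fst.mul y) (.mul (.fst (.snd (.fst .id))) (.snd .id))
      (.snd (.snd .id))
  have h2 : PTu rel fun w => w.snd.zipWith (fun x col => col.map fun y => x.mul y)
      (Data.colsC w.fst) :=
    .zipWith (f := fun _ x col => col.map fun y => x.mul y) h1 (.snd .id) (colsC.comp (.fst .id))
  have h3 : PTu rel fun w => (Data.diagA w.fst.fst).zipWith (fun a y => (a.div a).mul y) w.snd :=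
    .zipWith (f := fun _ a y => (a.div a).mul y)
      (.mul (.div (.fst (.snd .id)) (.fst (.snd .id))) (.snd (.snd .id)))
      (diagA.comp (.fst (.fst .id))) (.snd .id)
  exact .zipWith (f := fun _ i row => .pair i (.pair row (.num 0)))
    (.pair (.fst (.snd .id)) (.pair (.snd (.snd .id)) (.const _)))
    (.iota (.fst (.snd (.fst .id))))
    (.transpose (.fst (.snd (.fst .id)))
      (.map (f := fun w col => (Data.diagA w.fst).zipWith (fun a y => (a.div a).mul y) col) h3
        (.pair (.fst (.snd (.snd (.fst .id)))) (.pair (.fst (.snd (.fst .id))) h2))))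

/-- The candidate supports are computed in polynomial time when the number of columns of `C` is
bounded. -/
theorem PT.masks (hX : ∀ i, ∃ K : ℕ, ∀ v ∈ X i, (Data.colsC v).toList.length ≤ K) :
    PT rel X Data.masks := by
  have h1 : PT rel X fun v => Data.zeroOneVecs (Data.colsC v) :=
    .fold_bounded (f := fun _ acc _ => (acc.map fun J => .pair (.num 0) J).append
        (acc.map fun J => .pair (.num 1) J))
      (.append (.map (f := fun _ J => .pair (.num 0) J) (.pair (.const _) (.snd .id))
        (.fst (.snd .id)))
        (.map (f := fun _ J => .pair (.num 1) J) (.pair (.const _) (.snd .id)) (.fst (.snd .id))))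
      (PTu.colsC.on X) (.const _) hX
  have h2 : PT rel X Data.roots :=
    .map (f := fun v J => .pair J (Data.rootNode (Data.diagA v) (Data.colsC v) v.snd.fst
        v.snd.snd.fst J))
      (.pair (.snd .id) PTu.rootNode)
      (.map (f := fun v J => Data.capSum v.snd.snd.snd J)
        (.capSum (.snd (.snd (.snd (.fst .id)))) (.snd .id)) h1)
  have h3 : PT rel X fun v => (Data.pair (.num 0) (Data.colsC v)).toList.foldl
      (fun acc _ => Data.level acc) (Data.roots v) :=
    .fold_bounded (f := fun _ acc _ => Data.level acc) (.level (.fst (.snd .id)))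
      (.pair (.const _) (PTu.colsC.on X)) h2 fun i => by
        obtain ⟨K, hK⟩ := hX i
        exact ⟨K + 1, fun v hv => by simpa using hK v hv⟩
  exact .pair (.map (f := fun _ _ => .num 0) (.const _) (.fst .id))
    (.map (f := fun v w => Data.maskOf v.snd.snd.snd w)
      (.maskOf (.snd (.snd (.snd (.fst .id)))) (.snd .id)) h3)

end

/-! ### Correctness of the enumeration -/

theorem encRats_cons (x : ℚ) (l : List ℚ) : encRats (x :: l) = .pair (.num x) (encRats l) := rfl

theorem encRats_append (l m : List ℚ) : encRats (l ++ m) = (encRats l).append (encRats m) := by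
  simp [encRats, Data.append]

theorem toList_encRats (l : List ℚ) : (encRats l).toList = l.map .num := by
  rw [encRats, Data.toList_encList]

/-- A list of pairs of a vector and a node as data. -/
def encPairs {k e n : ℕ} (l : List ((Fin k → ℚ) × Node e n)) : Data :=
  encList (l.map fun w => .pair (encVec w.1) (encNode w.2))

namespace Data

variable {m n k e : ℕ}

theorem map_encRats (f : ℚ → ℚ) (g : Data → Data) (h : ∀ x, g (.num x) = .num (f x))
    (l : List ℚ) : (encRats l).map g = encRats (l.map f) := by
  simp [encRats, Data.map, Function.comp_def, h]

theorem zipWith_encRats (f : ℚ → ℚ → ℚ) (g : Data → Data → Data)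
    (h : ∀ x y, g (.num x) (.num y) = .num (f x y)) (l l' : List ℚ) :
    (encRats l).zipWith g (encRats l') = encRats (List.zipWith f l l') := by
  simp [encRats, Data.zipWith, List.zipWith_map, List.map_zipWith, h]

theorem zipWith_encVec (f : ℚ → ℚ → ℚ) (g : Data → Data → Data)
    (h : ∀ x y, g (.num x) (.num y) = .num (f x y)) (u v : Fin m → ℚ) :
    (encVec u).zipWith g (encVec v) = encVec fun i => f (u i) (v i) := by
  rw [encVec_eq, encVec_eq, zipWith_encRats f g h, zipWith_ofFn, ← encVec_eq]

theorem lead_encRats (l : List ℚ) : (encRats l).lead = .num (SubsetSelection.lead l) := by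
  rw [Data.lead, toList_encRats]
  have h : ∀ (l : List ℚ) (x : ℚ), (l.map Data.num).foldl (fun a x => cond a a x) (.num x) =
      .num (if x = 0 then SubsetSelection.lead l else x) := by
    intro l
    induction l with
    | nil => intro x; simp [SubsetSelection.lead]
    | cons y l ih =>
      intro x
      have h1 : cond (.num x) (.num x) (.num y) = .num (if x = 0 then y else x) := by
        by_cases hx : x = 0 <;> simp [hx, cond]
      rw [List.map_cons, List.foldl_cons, h1, ih]
      by_cases hx : x = 0 <;> simp [hx, SubsetSelection.lead]
  simp [h l 0]

theorem sum_encVec (v : Fin m → ℚ) : (encVec v).sum = .num (∑ i, v i) := by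
  rw [encVec_eq, encRats, sum_encList_num, List.sum_ofFn]

/-- The columns are put in front of the rows one by one, beginning with the last one. -/
theorem transpose_encMatrix (c : Fin m → ℚ) (M : Matrix (Fin m) (Fin n) ℚ) :
    (encVec c).transpose (encMatrix M) = encMatrix Mᵀ := by
  rw [transpose, encMatrix, reverse_encList, toList_encList, List.foldl_reverse]
  induction n with
  | zero =>
    rw [encVec, map_encList, List.map_ofFn, encMatrix]
    rfl
  | succ n ih =>
    have h := ih (Matrix.of fun i j => M i j.succ)
    simp only [Matrix.of_apply] at h
    rw [List.ofFn_succ, List.foldr_cons, h]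
    simp only [encMatrix, encVec, zipWith_encList, zipWith_ofFn, List.ofFn_succ, encList]
    rfl

theorem pivot_encVec (h r : Fin (e + 1) → ℚ) :
    (encVec h).pivot (encVec r) = .num (SubsetSelection.pivot h r) := by
  have h1 : ∀ v : Fin (e + 1) → ℚ, (encVec v).snd = encRats (List.ofFn fun i : Fin e => v i.succ) := by
    intro v
    rw [encVec_eq, List.ofFn_succ]
    rfl
  have key : ∀ (l l' : List ℚ) (x y : ℚ) (w : Data),
      w = ((encRats l).zipWith .pair (encRats l')).toList.foldl
        (fun acc x => cond acc.fst acc x) (.pair (.num x) (.num y)) →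
      w.snd.div w.fst = .num (if x = 0 then pivotList l l' else y / x) := by
    intro l
    induction l with
    | nil =>
      rintro l' x y _ rfl
      by_cases hx : x = 0 <;> simp [Data.zipWith, encRats, encList, hx, pivotList]
    | cons a l ih =>
      intro l' x y w hw
      cases l' with
      | nil =>
        subst hw
        by_cases hx : x = 0 <;> simp [Data.zipWith, encRats, encList, hx, pivotList]
      | cons b l' =>
        have h2 : cond (.num x) (.pair (.num x) (.num y)) (.pair (.num a) (.num b)) =
            .pair (.num (if x = 0 then a else x)) (.num (if x = 0 then b else y)) := by
          by_cases hx : x = 0 <;> simp [hx, cond]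
        simp only [Data.zipWith, toList_encList, encRats_cons, toList_pair, List.zipWith_cons_cons,
          List.foldl_cons, fst_pair, h2] at hw ih
        rw [ih l' _ _ w hw]
        by_cases hx : x = 0 <;> simp [hx, pivotList]
  rw [Data.pivot, h1, h1]
  exact (key _ _ 0 0 _ rfl).trans (by simp [SubsetSelection.pivot])

theorem childItem_eq (h : Fin (e + 1) → ℚ) (i : ℕ) (u : (Fin (e + 1) → ℚ) × List ℚ) :
    (encVec h).childItem (.pair (.num i) (.pair (encVec u.1) (encRats u.2))) =
      .pair (.num i) (.pair (encVec (u.1 - SubsetSelection.pivot h u.1 • h))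
        (encRats ((-SubsetSelection.lead (List.ofFn h) * SubsetSelection.pivot h u.1) :: u.2))) := by
  simp only [childItem, fst_pair, snd_pair, pivot_encVec, encRats_cons]
  rw [zipWith_encVec (fun x y => x - SubsetSelection.pivot h u.1 * y) _ (fun x y => rfl)]
  rw [encVec_eq h, lead_encRats]
  simp
  rfl

theorem letter_eq (R : Node e n) (a b : Fin n) :
    Data.letter (.pair (.num (a : ℕ)) (.pair (encVec (R a).1) (encRats (R a).2)))
      (.pair (.num (b : ℕ)) (.pair (encVec (R b).1) (encRats (R b).2))) =
      encVec (SubsetSelection.letter R a b) := by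
  simp only [Data.letter, fst_pair, snd_pair, le_num, sub_num, mul_num]
  rw [zipWith_encVec (fun x y => x + (1 - 2 * (if ((a : ℕ) : ℚ) ≤ ((b : ℕ) : ℚ) then 1 else 0)) * y)
    _ (fun x y => rfl)]
  congr 1
  funext i
  by_cases h : a ≤ b
  · have h' : ((a : ℕ) : ℚ) ≤ ((b : ℕ) : ℚ) := by exact_mod_cast h
    simp only [h, h', SubsetSelection.letter, if_true, Pi.add_apply, Pi.smul_apply, smul_eq_mul]
    norm_num
  · have h' : ¬ ((a : ℕ) : ℚ) ≤ ((b : ℕ) : ℚ) := by exact_mod_cast h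
    simp only [h, h', SubsetSelection.letter, if_false, Pi.add_apply, Pi.smul_apply, smul_eq_mul]
    norm_num

theorem flatten_encList (l : List (List Data)) :
    (encList (l.map encList)).flatten = encList l.flatten := by
  simp [Data.flatten, List.flatMap_map, List.flatMap_id']

theorem children_encNode (R : Node e n) :
    (encNode R).children = encList ((SubsetSelection.children R).map encNode) := by
  have h : ∀ a b, (encNode R).map (Data.childItem (Data.letter
      (.pair (.num (a : Fin n)) (.pair (encVec (R a).1) (encRats (R a).2)))
      (.pair (.num (b : Fin n)) (.pair (encVec (R b).1) (encRats (R b).2))))) =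
      encNode (child R (SubsetSelection.letter R a b)) := by
    intro a b
    rw [encNode, encNode, map_encList, List.map_ofFn]
    congr 2
    funext i
    simp only [Function.comp, letter_eq, childItem_eq]
    rfl
  have h2 : ∀ g : Data → Data, (encNode R).map g = encList ((List.finRange n).map fun a =>
      g (.pair (.num (a : Fin n)) (.pair (encVec (R a).1) (encRats (R a).2)))) := by
    intro g
    rw [encNode, map_encList, List.map_ofFn, List.ofFn_eq_map]
    rfl
  rw [Data.children, h2]
  simp only [h2 (fun v => (encNode R).map fun w => _)]
  have h3 := fun a b => h a b
  simp only [h3]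
  have := flatten_encList ((List.finRange n).map fun a => (List.finRange n).map fun b =>
    encNode (child R (SubsetSelection.letter R a b)))
  rw [List.map_map] at this
  exact this.trans (by simp [SubsetSelection.children, List.flatMap_def, Function.comp_def])

theorem level_encPairs (l : List ((Fin k → ℚ) × Node e n)) :
    (encPairs l).level = encPairs (l.flatMap fun w =>
      (SubsetSelection.children w.2).map (Prod.mk w.1)) := by
  simp only [Data.level, encPairs, map_encList, List.map_map, Data.flatten, toList_encList,
    List.flatMap_map, children_encNode, Function.comp_def, snd_pair, fst_pair, List.map_flatMap]

/-- Restricting level by level gives the leaves in the order of the recursion for `leaves`. -/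
theorem foldl_level {α : Type*} (d : List α) (l : List ((Fin k → ℚ) × Node e n)) :
    d.foldl (fun acc _ => Data.level acc) (encPairs l) =
      encPairs (l.flatMap fun w => (leaves d.length w.2).map (Prod.mk w.1)) := by
  induction d generalizing l with
  | nil => simp [leaves]
  | cons x d ih =>
    rw [List.foldl_cons, level_encPairs, ih]
    simp [leaves, List.flatMap_assoc, List.flatMap_map, List.map_flatMap]

theorem absKey_eq (i : ℕ) (u : (Fin (e + 1) → ℚ) × List ℚ) :
    Data.absKey (.pair (.num i) (.pair (encVec u.1) (encRats u.2))) =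
      encRats (SubsetSelection.absKey u i) := by
  simp only [Data.absKey, fst_pair, snd_pair, encVec_eq, ← encRats_append, lead_encRats]
  rw [map_encRats (sgn (SubsetSelection.lead (List.ofFn u.1 ++ u.2)) * ·) _ (fun x => by simp [sgn])]
  rw [SubsetSelection.absKey, encRats_append]
  rfl

theorem select_encNode (t : ℚ) (L : Node e n) :
    Data.select (.num t) (encNode L) = encVec (SubsetSelection.select t L) := by
  have h1 : (encNode L).map Data.absKey =
      encList (List.ofFn fun a => encRats (SubsetSelection.absKey (L a) a)) := by
    rw [encNode, map_encList, List.map_ofFn]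
    simp only [Function.comp_def, absKey_eq]
  rw [Data.select, h1, map_encList, List.map_ofFn, encVec]
  congr 2
  funext a
  have h2 : (encList (List.ofFn fun a => encRats (SubsetSelection.absKey (L a) a))).map (fun kb =>
      (num 1).sub ((kb.zipWith Data.sub (encRats (SubsetSelection.absKey (L a) a))).lead.le (num 0))) =
      encVec fun b => 1 - if SubsetSelection.lead (List.zipWith (· - ·)
        (SubsetSelection.absKey (L b) b) (SubsetSelection.absKey (L a) a)) ≤ 0 then 1 else 0 := by
    rw [map_encList, List.map_ofFn, encVec]
    congr 2
    funext b
    simp only [Function.comp, zipWith_encRats (· - ·) Data.sub sub_num, lead_encRats, le_num, sub_num]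
  simp only [Function.comp]
  rw [h2, sum_encVec, add_num, le_num]
  rfl

theorem append_encVec (u : Fin m → ℚ) (v : Fin n → ℚ) :
    (encVec u).append (encVec v) = encVec (Fin.append u v) := by
  rw [encVec_eq, encVec_eq, encVec_eq, ← encRats_append, List.ofFn_fin_append]

theorem maskOf_eq (σ : ℕ) (J : Fin k → ℚ) (L : Node (k + 1) n) :
    Data.maskOf (.num σ) (.pair (encVec J) (encNode L)) =
      encVec (SubsetSelection.maskOf σ J L) := by
  simp only [Data.maskOf, fst_pair, snd_pair, sum_encVec, sub_num, select_encNode, append_encVec]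
  rfl

theorem zeroOneVecs_eq (l : List Data) :
    Data.zeroOneVecs (encList l) = encList ((SubsetSelection.zeroOneVecs l.length).map encVec) := by
  rw [Data.zeroOneVecs, toList_encList, ← List.reverse_reverse l, List.foldl_reverse,
    List.length_reverse]
  generalize l.reverse = l
  have hc : ∀ (j : ℕ) (x : ℚ) (J : Fin j → ℚ),
      encVec (Fin.cons (α := fun _ => ℚ) x J) = .pair (.num x) (encVec J) := by
    intro j x J
    rw [encVec, List.ofFn_succ]
    rfl
  induction l with
  | nil => rfl
  | cons x l ih =>
    rw [List.foldr_cons, ih, map_encList, map_encList, append_encList]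
    simp only [List.length_cons, SubsetSelection.zeroOneVecs, List.map_append, List.map_map,
      Function.comp_def, hc]

theorem capSum_eq (σ : ℕ) (J : Fin k → ℚ) :
    Data.capSum (.num σ) (encVec J) = encVec (SubsetSelection.capSum σ J) := by
  rw [Data.capSum, map_encVec (fun x => (if ∑ j, J j ≤ (σ : ℚ) then 1 else 0) * x)]
  · rfl
  · intro x
    rw [sum_encVec, le_num, mul_num]

theorem rootNode_eq (A : Matrix (Fin n) (Fin n) ℚ) (C : Matrix (Fin n) (Fin k) ℚ) (c b : Fin n → ℚ)
    (J : Fin k → ℚ) : Data.rootNode (encVec fun i => A i i) (encMatrix C) (encVec c) (encVec b)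
      (encVec J) = encNode (SubsetSelection.rootNode A C c b J) := by
  have h1 : (encVec J).zipWith (fun x col => col.map fun y => x.mul y) (encMatrix C) =
      encMatrix (Matrix.of fun i j => J j * C i j) := by
    simp only [encVec, encMatrix, zipWith_encList, zipWith_ofFn, map_encList, List.map_ofFn]
    rfl
  have h2 : Data.pair (encVec b) (.pair (encVec c) (encMatrix (Matrix.of fun i j => J j * C i j))) =
      encMatrix (Matrix.of fun i : Fin n => Fin.cons (α := fun _ => ℚ) (b i)
        (Fin.cons (α := fun _ => ℚ) (c i) fun j => J j * C i j)) := by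
    conv_rhs => rw [encMatrix, List.ofFn_succ, List.ofFn_succ]
    rfl
  have h3 : (encMatrix (Matrix.of fun i : Fin n => Fin.cons (α := fun _ => ℚ) (b i)
        (Fin.cons (α := fun _ => ℚ) (c i) fun j => J j * C i j))).map (fun col =>
        (encVec fun i => A i i).zipWith (fun a y => (a.div a).mul y) col) =
      encMatrix (rootMatrix A C c b J) := by
    rw [encMatrix, map_encList, List.map_ofFn, encMatrix]
    congr 2
    funext j
    rw [Function.comp, zipWith_encVec (fun a y => a / a * y) _ (fun x y => rfl)]
    congr 1
    funext i
    refine Fin.cases ?_ (fun j => Fin.cases ?_ (fun j => ?_) j) j <;> rfl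
  rw [Data.rootNode, h1, h2, h3, transpose_encMatrix, encMatrix, encVec, iota_encList_ofFn,
    zipWith_encList, zipWith_ofFn, encNode]
  rfl

variable (A : Matrix (Fin n) (Fin n) ℚ) (C : Matrix (Fin n) (Fin k) ℚ) (c b : Fin n → ℚ) (σ : ℕ)

theorem encMatrix_blockRow : encMatrix (blockRow A C) =
    encList ((List.ofFn fun j => encVec fun i => A i j) ++
      List.ofFn fun j => encVec fun i => C i j) := by
  rw [encMatrix, ← List.ofFn_fin_append]
  congr 2
  funext j
  refine Fin.addCases (fun j => ?_) (fun j => ?_) j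
  · simp [blockRow]
  · simp [blockRow]

theorem colsC_encInstance : (encInstance (blockRow A C) c b σ).colsC = encMatrix C := by
  rw [colsC, encInstance, snd_pair, fst_pair, fst_pair, encMatrix_blockRow, encVec, dropLen_encList,
    List.drop_left' (by simp), encMatrix]

theorem diagA_encInstance (hA : A.IsDiag) :
    (encInstance (blockRow A C) c b σ).diagA = encVec fun i => A i i := by
  rw [diagA, encInstance, snd_pair, fst_pair, fst_pair, encMatrix_blockRow, encVec, zipWith_encList,
    ← List.append_nil (List.ofFn fun i => num (c i)), List.zipWith_append (by simp),
    List.zipWith_nil_left, List.append_nil, zipWith_ofFn, encVec]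
  congr 2
  funext i
  rw [sum_encVec, Finset.sum_eq_single i (fun j _ hj => hA hj) (by simp)]

theorem masks_encInstance (hA : A.IsDiag) : (encInstance (blockRow A C) c b σ).masks =
    encList ((SubsetSelection.masks A C c b σ).map encVec) := by
  have h1 : (encInstance (blockRow A C) c b σ).roots =
      encPairs (((SubsetSelection.zeroOneVecs k).map (SubsetSelection.capSum σ)).map fun J =>
        (J, SubsetSelection.rootNode A C c b J)) := by
    have hz : Data.zeroOneVecs (encMatrix C) =
        encList ((SubsetSelection.zeroOneVecs k).map encVec) := by
      have := zeroOneVecs_eq (List.ofFn fun j => encVec fun i => C i j)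
      rwa [List.length_ofFn] at this
    rw [roots, colsC_encInstance, diagA_encInstance A C c b σ hA, hz, map_encList, map_encList,
      encPairs]
    simp only [encInstance, snd_pair, fst_pair, List.map_map, Function.comp_def, capSum_eq,
      rootNode_eq A]
  have h2 : (Data.pair (num 0) (encMatrix C)).toList.length = k + 1 := by
    simp [encMatrix]
  rw [masks, h1, colsC_encInstance, foldl_level, h2, encPairs, map_encList, SubsetSelection.masks,
    List.map_cons, encList]
  congr 1
  · simp only [encInstance, fst_pair, encMatrix, map_encList, List.map_ofFn]
    rfl
  · simp only [encInstance, snd_pair, List.map_flatMap, List.flatMap_map, List.map_map,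
      Function.comp_def, maskOf_eq]

end Data

/-! ### Restriction to a support -/

section Restrict

variable {m d : ℕ}

/-- The indices where `f` does not vanish, in increasing order. -/
def supportList (f : Fin d → ℚ) : List (Fin d) := (List.finRange d).filter fun i => f i ≠ 0

/-- The enumeration of the indices where `f` does not vanish. -/
def supportEmb (f : Fin d → ℚ) : Fin (supportList f).length ↪ Fin d :=
  ⟨(supportList f).get, ((List.nodup_finRange d).filter _).injective_get⟩

theorem range_supportEmb (f : Fin d → ℚ) : Set.range (supportEmb f) = {i | f i ≠ 0} := by
  ext i
  have : i ∈ Set.range (supportList f).get ↔ i ∈ supportList f := by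
    rw [Set.range_list_get]; rfl
  change i ∈ Set.range (supportList f).get ↔ _
  rw [this]
  simp [supportList]

theorem length_supportList_le {f : Fin d → ℚ} (hf : ∀ i, f i = 0 ∨ f i = 1) {σ : ℕ}
    (h : ∑ i, f i ≤ σ) : (supportList f).length ≤ σ := by
  have h1 : (supportList f).length = (Finset.univ.filter fun i => f i ≠ 0).card := by
    have := Set.ncard_range_of_injective (supportEmb f).injective
    rw [range_supportEmb, Nat.card_eq_fintype_card, Fintype.card_fin] at this
    rw [← this, ← Set.ncard_coe_finset]
    simp
  have h2 : ∑ i, f i = ((Finset.univ.filter fun i => f i ≠ 0).card : ℚ) := by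
    rw [Finset.card_filter]
    push_cast
    refine Finset.sum_congr rfl fun i _ => ?_
    rcases hf i with h | h <;> simp [h]
  rw [h1]
  rw [h2] at h
  exact_mod_cast h

/-- The vector with the entries of `z`, except for the last one, in the positions `s`, and `0`
elsewhere. -/
def extendZero {r : ℕ} (s : Fin r ↪ Fin d) (z : Fin (r + 1) → ℚ) (i : Fin d) : ℚ :=
  ∑ j, if i = s j then z j.castSucc else 0

theorem extendZero_apply {r : ℕ} (s : Fin r ↪ Fin d) (z : Fin (r + 1) → ℚ) (j : Fin r) :
    extendZero s z (s j) = z j.castSucc := by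
  simp [extendZero]

theorem extendZero_of_notMem {r : ℕ} (s : Fin r ↪ Fin d) (z : Fin (r + 1) → ℚ) {i : Fin d}
    (hi : i ∉ Set.range s) : extendZero s z i = 0 :=
  Finset.sum_eq_zero fun j _ => if_neg fun h => hi ⟨j, h.symm⟩

/-- Dropping variables that are zero does not change the objective. -/
theorem objective_eq_restrict {r : ℕ} (M : Matrix (Fin m) (Fin d) ℚ) (c b : Fin m → ℚ)
    (s : Fin r ↪ Fin d) {x : Fin d → ℝ} {μ : ℝ} (hx : ∀ i ∉ Set.range s, x i = 0) :
    objective M c b x μ = leastSquaresObjective (restrictCols M c s) b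
      (Fin.snoc (α := fun _ => ℝ) (fun j => x (s j)) μ) := by
  rw [objective, leastSquaresObjective]
  congr 2
  funext i
  have : ∑ j, (M i j : ℝ) * x j = ∑ j, (M i (s j) : ℝ) * x (s j) := by
    rw [← Finset.sum_map Finset.univ s fun j => (M i j : ℝ) * x j]
    symm
    refine Finset.sum_subset (Finset.subset_univ _) fun j _ hj => ?_
    rw [hx j (by simpa using hj), mul_zero]
  simp [mulVec, dotProduct, Fin.sum_univ_castSucc, restrictCols, this]
  ring

/-- The square of the least squares objective, for rational arguments. -/
def residualSq {m q : ℕ} (B : Matrix (Fin m) (Fin q) ℚ) (y : Fin m → ℚ) (z : Fin q → ℚ) : ℚ :=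
  (B *ᵥ z - y) ⬝ᵥ (B *ᵥ z - y)

theorem leastSquaresObjective_eq_sqrt {m q : ℕ} (B : Matrix (Fin m) (Fin q) ℚ) (y : Fin m → ℚ)
    (z : Fin q → ℚ) : leastSquaresObjective B y (fun j => (z j : ℝ)) =
      Real.sqrt (residualSq B y z : ℚ) := by
  rw [leastSquaresObjective, EuclideanSpace.norm_eq, residualSq]
  congr 1
  simp [dotProduct, mulVec, pow_two]

variable (M : Matrix (Fin m) (Fin d) ℚ) (c b : Fin m → ℚ) (f : Fin d → ℚ)

/-- The least squares solution on the support of `f`; its last entry belongs to `c`. -/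
def maskSolution : Fin ((supportList f).length + 1) → ℚ :=
  lsSolution (restrictCols M c (supportEmb f)) b

/-- The squared objective at the least squares solution on the support of `f`. -/
def maskValue : ℚ := residualSq (restrictCols M c (supportEmb f)) b (maskSolution M c b f)

/-- The least squares solution on the support of `f`, extended by zero. -/
def maskPoint : Fin d → ℚ := extendZero (supportEmb f) (maskSolution M c b f)

/-- The coefficient of `c` in the least squares solution on the support of `f`. -/
def maskCoeff : ℚ := maskSolution M c b f (Fin.last _)

theorem objective_maskPoint : objective M c b (fun i => (maskPoint M c b f i : ℝ))
    (maskCoeff M c b f : ℝ) = Real.sqrt (maskValue M c b f : ℚ) := by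
  rw [objective_eq_restrict M c b (supportEmb f) fun i hi => by
    rw [maskPoint, extendZero_of_notMem _ _ hi, Rat.cast_zero], maskValue,
    ← leastSquaresObjective_eq_sqrt]
  congr 1
  funext j
  refine Fin.lastCases ?_ (fun j => ?_) j
  · simp [maskCoeff]
  · simp [maskPoint, extendZero_apply]

theorem sqrt_maskValue_le {x : Fin d → ℝ} {μ : ℝ} (hx : ∀ i, f i = 0 → x i = 0) :
    Real.sqrt (maskValue M c b f : ℚ) ≤ objective M c b x μ := by
  rw [objective_eq_restrict M c b (supportEmb f) fun i hi => hx i (by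
    simpa [range_supportEmb] using hi), maskValue, ← leastSquaresObjective_eq_sqrt]
  exact lsSolution_optimal _ _ _

theorem maskValue_le : maskValue M c b f ≤ b ⬝ᵥ b := by
  have h1 := sqrt_maskValue_le M c b f (x := fun _ => 0) (μ := 0) fun _ _ => rfl
  rw [objective_sq] at h1
  have h2 := (Real.sqrt_le_sqrt_iff (by positivity)).1 h1
  have h3 : ((maskValue M c b f : ℚ) : ℝ) ≤ ((b ⬝ᵥ b : ℚ) : ℝ) := by
    refine h2.trans (le_of_eq ?_)
    simp [dotProduct, pow_two]
  exact_mod_cast h3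

end Restrict

/-! ### The main loop -/

namespace Data

/-- The entries `(f i, (i, column i))` with `f i ≠ 0`, for the input `v` and the vector `f`. -/
def chosen (v f : Data) : Data := (f.zipWith .pair (v.fst.iota.zipWith .pair v.fst)).filter fst

/-- The least squares problem on the support of `f`. -/
def restriction (v f : Data) : Data :=
  .pair (((chosen v f).map fun x => x.snd.snd).append (.pair v.snd.fst (.num 0))) v.snd.snd.fst

/-- The residual sum of squares of `z` in the least squares problem `u`. -/
def residualSq (u z : Data) : Data :=
  let res := ((transpose u.snd u.fst).tmul z).zipWith sub u.snd
  res.dot res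

/-- The program for `SubsetSelection.extendZero`: an entry of `z` for each entry of `l`; the
last entry of `z` has no partner in `l` and is dropped. -/
def extendZero (v l z : Data) : Data :=
  v.fst.iota.map fun i => (l.zipWith (fun x y => ((i.le x.snd.fst).mul (x.snd.fst.le i)).mul y) z).sum

/-- The value and the point that belong to the solution `z` on the support of `f`. -/
def candidate (v f z : Data) : Data :=
  .pair (residualSq (restriction v f) z) (.pair (extendZero v (chosen v f) z) z.last)

/-- One step of the search for the best candidate. -/
def improve (v acc f : Data) : Data :=
  let w := candidate v f (restriction v f).leastSquares
  cond (w.fst.le acc.fst) w acc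

/-- The start of the search: the value at zero, which no candidate exceeds, and a placeholder for the
point, which the first candidate replaces. -/
def start (v : Data) : Data := .pair (v.snd.snd.fst.dot v.snd.snd.fst) (.num 0)

/-- The best candidate. -/
def search (v : Data) : Data := (v.masks.toList.foldl v.improve v.start).snd

variable {m d : ℕ}

section
variable (M : Matrix (Fin m) (Fin d) ℚ) (c b : Fin m → ℚ) (σ : ℕ) (f : Fin d → ℚ)

theorem chosen_encInstance : chosen (encInstance M c b σ) (encVec f) =
    encList ((supportList f).map fun i => .pair (.num (f i))
      (.pair (.num (i : ℕ)) (encVec fun l => M l i))) := by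
  rw [chosen, encInstance, fst_pair, encMatrix, iota_encList_ofFn, encVec.eq_def f, zipWith_encList,
    zipWith_ofFn, zipWith_encList, zipWith_ofFn, Data.filter, toList_encList, List.ofFn_eq_map,
    List.filter_map, supportList]
  congr 2

theorem restriction_encInstance : restriction (encInstance M c b σ) (encVec f) =
    encLeastSquares (restrictCols M c (supportEmb f)) b := by
  rw [restriction, chosen_encInstance, encLeastSquares, map_encList, List.map_map]
  congr 1
  rw [encMatrix, List.ofFn_succ', append, toList_encList, List.concat_eq_append]
  congr 2
  · apply List.ext_getElem
    · simp
    · intro i h1 h2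
      simp [restrictCols, supportEmb]
      rfl
  · simp [encInstance, restrictCols]

theorem residualSq_encLeastSquares {q : ℕ} (B : Matrix (Fin m) (Fin q) ℚ) (z : Fin q → ℚ) :
    residualSq (encLeastSquares B b) (encVec z) = .num (SubsetSelection.residualSq B b z) := by
  simp only [residualSq, encLeastSquares, fst_pair, snd_pair, transpose_encMatrix, tmul_encMatrix,
    zipWith_encVec (· - ·) Data.sub sub_num, dot_encVec, Matrix.transpose_transpose]
  rfl

theorem extendZero_encInstance (z : Fin ((supportList f).length + 1) → ℚ) :
    extendZero (encInstance M c b σ) (chosen (encInstance M c b σ) (encVec f)) (encVec z) =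
      encVec (SubsetSelection.extendZero (supportEmb f) z) := by
  rw [extendZero, chosen_encInstance, encInstance, fst_pair, encMatrix, iota_encList_ofFn,
    map_encList, List.map_ofFn, encVec.eq_def (SubsetSelection.extendZero _ z)]
  congr 2
  funext i
  have h : (encList ((supportList f).map fun i => .pair (.num (f i))
      (.pair (.num (i : ℕ)) (encVec fun l => M l i)))).zipWith (fun x y =>
        (((num (i : ℕ)).le x.snd.fst).mul (x.snd.fst.le (num (i : ℕ)))).mul y) (encVec z) =
      encVec fun j => if i = supportEmb f j then z j.castSucc else 0 := by
    rw [encVec, zipWith_encList, encVec]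
    congr 1
    apply List.ext_getElem
    · simp
    · intro j h1 h2
      have hj : j < (supportList f).length := by simpa using h2
      have e : supportEmb f ⟨j, hj⟩ = (supportList f)[j] := rfl
      simp only [List.getElem_zipWith, List.getElem_map, List.getElem_ofFn, snd_pair, fst_pair,
        le_num, mul_num, e, Nat.cast_le, Fin.val_fin_le]
      congr 1
      rcases lt_trichotomy i (supportList f)[j] with h | h | h
      · simp [h.ne, h.le, h.not_ge]
      · simp [h]
      · simp [h.ne', h.le, h.not_ge]
  simp only [Function.comp]
  rw [h, sum_encVec]
  rfl

theorem last_encVec (z : Fin (d + 1) → ℚ) : (encVec z).last = .num (z (Fin.last d)) := by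
  rw [Data.last, encVec, toList_encList, List.ofFn_succ', List.concat_eq_append, List.foldl_append]
  rfl

theorem candidate_encInstance : candidate (encInstance M c b σ) (encVec f)
    (restriction (encInstance M c b σ) (encVec f)).leastSquares =
      .pair (.num (maskValue M c b f)) (encSolution (maskPoint M c b f) (maskCoeff M c b f)) := by
  have h : (encLeastSquares (restrictCols M c (supportEmb f)) b).leastSquares =
      encVec (maskSolution M c b f) := leastSquares_eq _ _
  rw [candidate, restriction_encInstance, h, residualSq_encLeastSquares, extendZero_encInstance,
    last_encVec]
  rfl

/-- The search finds the best value.  After at least one candidate the accumulator holds one of the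
candidates, so its size does not depend on the number of steps. -/
theorem foldl_improve (ms : List (Fin d → ℚ)) :
    (ms = [] ∧ (ms.map encVec).foldl (improve (encInstance M c b σ)) (encInstance M c b σ).start =
      (encInstance M c b σ).start) ∨
    ∃ f ∈ ms, (∀ g ∈ ms, maskValue M c b f ≤ maskValue M c b g) ∧
      (ms.map encVec).foldl (improve (encInstance M c b σ)) (encInstance M c b σ).start =
        .pair (.num (maskValue M c b f)) (encSolution (maskPoint M c b f) (maskCoeff M c b f)) := by
  have hstep : ∀ (q : ℚ) (w : Data) (g : Fin d → ℚ),
      improve (encInstance M c b σ) (.pair (.num q) w) (encVec g) =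
        if maskValue M c b g ≤ q then .pair (.num (maskValue M c b g))
          (encSolution (maskPoint M c b g) (maskCoeff M c b g)) else .pair (.num q) w := by
    intro q w g
    rw [improve, candidate_encInstance, fst_pair, fst_pair, le_num]
    by_cases h : maskValue M c b g ≤ q <;> simp [h, cond]
  have hstart : (encInstance M c b σ).start = .pair (.num (b ⬝ᵥ b)) (.num 0) := by
    rw [start, encInstance, snd_pair, snd_pair, fst_pair, dot_encVec]
  induction ms using List.reverseRecOn with
  | nil => exact .inl ⟨rfl, rfl⟩
  | append_singleton ms g ih =>
    right
    rw [List.map_append, List.foldl_append]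
    rcases ih with ⟨rfl, h⟩ | ⟨f, hf, hmin, h⟩
    · refine ⟨g, by simp, by simp, ?_⟩
      rw [h, hstart, List.map_cons, List.map_nil, List.foldl_cons, List.foldl_nil, hstep,
        if_pos (maskValue_le M c b g)]
    · rw [h, List.map_cons, List.map_nil, List.foldl_cons, List.foldl_nil, hstep]
      by_cases hg : maskValue M c b g ≤ maskValue M c b f
      · refine ⟨g, by simp, ?_, if_pos hg⟩
        intro g' hg'
        rcases List.mem_append.1 hg' with h' | h'
        · exact hg.trans (hmin g' h')
        · rw [List.mem_singleton.1 h']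
      · refine ⟨f, by simp [hf], ?_, if_neg hg⟩
        intro g' hg'
        rcases List.mem_append.1 hg' with h' | h'
        · exact hmin g' h'
        · rw [List.mem_singleton.1 h']
          exact (not_le.1 hg).le

end

end Data

theorem PTu.chosen : PTu rel fun w => w.fst.chosen w.snd :=
  .filter (f := fun _ x => x.fst) (.fst (.snd .id))
    (.zip (.snd .id) (.zip (.iota (.fst (.fst .id))) (.fst (.fst .id))))

theorem PTu.restriction : PTu rel fun w => w.fst.restriction w.snd :=
  .pair (.append (.map (f := fun _ x => x.snd.snd) (.snd (.snd (.snd .id))) PTu.chosen)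
    (.pair (.fst (.snd (.fst .id))) (.const _))) (.fst (.snd (.snd (.fst .id))))

theorem PTu.residualSq : PTu rel fun w => w.fst.residualSq w.snd := by
  have : PTu rel fun w => ((w.fst.snd.transpose w.fst.fst).tmul w.snd).zipWith Data.sub w.fst.snd :=
    .zipWith (f := fun _ x y => x.sub y) (.sub (.fst (.snd .id)) (.snd (.snd .id)))
      (.tmul (.transpose (.snd (.fst .id)) (.fst (.fst .id))) (.snd .id)) (.snd (.fst .id))
  exact .dot this this

theorem PTu.extendZero : PTu rel fun w => w.fst.extendZero w.snd.fst w.snd.snd :=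
  .map (f := fun w i => (w.snd.fst.zipWith (fun x y =>
      ((i.le x.snd.fst).mul (x.snd.fst.le i)).mul y) w.snd.snd).sum)
    (.sum (.zipWith (f := fun w x y =>
        ((w.snd.le x.snd.fst).mul (x.snd.fst.le w.snd)).mul y)
      (.mul (.mul (.le (.snd (.fst .id)) (.fst (.snd (.fst (.snd .id)))))
        (.le (.fst (.snd (.fst (.snd .id)))) (.snd (.fst .id)))) (.snd (.snd .id)))
      (.fst (.snd (.fst .id))) (.snd (.snd (.fst .id)))))
    (.iota (.fst (.fst .id)))

theorem PTu.candidate : PTu rel fun w => w.fst.candidate w.snd.fst w.snd.snd :=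
  .pair (PTu.comp₂ (F := Data.residualSq) PTu.residualSq
      (PTu.comp₂ (F := Data.restriction) PTu.restriction (.fst .id) (.fst (.snd .id)))
      (.snd (.snd .id)))
    (.pair (PTu.comp₃ (F := Data.extendZero) PTu.extendZero (.fst .id)
      (PTu.comp₂ (F := Data.chosen) PTu.chosen (.fst .id) (.fst (.snd .id))) (.snd (.snd .id)))
      (.last (.snd (.snd .id))))

/-! ### The algorithm -/

/-- Calling the subroutine is computing `Data.leastSquares`. -/
theorem PTC.call {ι : Type} {S : Program} {p : Polynomial ℕ} (hS : ComputesLeastSquares S p) :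
    PTC (RunPlain S) (fun _ : ι => {v | ∃ (m q : ℕ) (B : Matrix (Fin m) (Fin q) ℚ)
      (y : Fin m → ℚ), v = encLeastSquares B y}) Data.leastSquares
      (fun v => [(v, v.leastSquares)]) := by
  refine ⟨.call, fun i => ⟨1 + 2 * .X + 2 * p, ?_⟩⟩
  rintro _ ⟨m, q, B, y, rfl⟩
  obtain ⟨t, h1, h2⟩ := hS m q B y
  have h3 : (encLeastSquares B y).leastSquares = encVec (lsSolution B y) := Data.leastSquares_eq B y
  rw [← h3] at h1
  refine ⟨_, .call h1, ?_⟩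
  have h4 := h1.size_le.2
  have h5 := (encLeastSquares B y).size_le_ht
  simp only [Polynomial.eval_add, Polynomial.eval_mul, Polynomial.eval_one, Polynomial.eval_ofNat,
    Polynomial.eval_X]
  omega

theorem PTC.congr_calls {rel : Data → Data → ℕ → Prop} {ι : Type} {X : ι → Set Data}
    {f : Data → Data} {cf cf' : Data → List (Data × Data)} (h : PTC rel X f cf)
    (hc : ∀ v, cf v = cf' v) : PTC rel X f cf' :=
  funext hc ▸ h

/-- The calls of a fold whose step makes calls that do not depend on the accumulator. -/
theorem foldCalls_eq_flatMap (f : Data → Data → Data → Data) (cf : Data → List (Data × Data))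
    (g : Data → List (Data × Data)) (v : Data) (hg : ∀ a x, cf (.pair v (.pair a x)) = g x)
    (l : List Data) (a : Data) : foldCalls f cf v l a = l.flatMap g := by
  induction l generalizing a with
  | nil => rfl
  | cons x l ih => rw [foldCalls, hg, ih, List.flatMap_cons]

/-- The inputs with `k` columns in the block `C`. -/
def inputs (k : ℕ) : Set Data :=
  {v | ∃ (n : ℕ) (A : Matrix (Fin n) (Fin n) ℚ) (C : Matrix (Fin n) (Fin k) ℚ) (c b : Fin n → ℚ)
    (σ : ℕ), A.IsDiag ∧ v = encInstance (blockRow A C) c b σ}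

/-- The arguments of `Data.improve` that occur, paired up. -/
def improveInputs (k : ℕ) : Set Data :=
  {w | ∃ (n : ℕ) (A : Matrix (Fin n) (Fin n) ℚ) (C : Matrix (Fin n) (Fin k) ℚ) (c b : Fin n → ℚ)
    (σ : ℕ) (a : Data) (f : Fin (n + k) → ℚ),
    w = .pair (encInstance (blockRow A C) c b σ) (.pair a (encVec f))}

/-- The subroutine call for the vector `f`. -/
def restrictionCall (v f : Data) : Data × Data := (v.restriction f, (v.restriction f).leastSquares)

section
variable {S : Program} {p : Polynomial ℕ}

theorem PTC.candidate (hS : ComputesLeastSquares S p) :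
    PTC (RunPlain S) improveInputs (fun w => w.fst.candidate w.snd.snd (w.fst.restriction w.snd.snd).leastSquares)
    (fun w => [restrictionCall w.fst w.snd.snd]) := by
  have h1 : PT (RunPlain S) improveInputs fun w => w.fst.restriction w.snd.snd :=
    PTu.comp₂ (F := Data.restriction) PTu.restriction (.fst .id) (.snd (.snd .id))
  have h2 := PTC.seq (PTC.call (ι := ℕ) hS) h1 (by
    rintro k _ ⟨n, A, C, c, b, σ, a, f, rfl⟩
    exact ⟨_, _, _, _, Data.restriction_encInstance (blockRow A C) c b σ f⟩)
  have h3 := PTC.mk_pair (PT.id (rel := RunPlain S) (X := improveInputs)) h2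
  have h4 : PTu (RunPlain S) fun w => w.fst.fst.candidate w.fst.snd.snd w.snd :=
    PTu.comp₃ (F := Data.candidate) PTu.candidate (.fst (.fst .id)) (.snd (.snd (.fst .id)))
      (.snd .id)
  have h5 := PTC.seq (h4.on fun _ : ℕ => Set.univ) h3 fun _ _ _ => trivial
  simp only [Data.fst_pair, Data.snd_pair, List.append_nil, List.nil_append] at h5
  exact h5

theorem PTC.improve (hS : ComputesLeastSquares S p) :
    PTC (RunPlain S) improveInputs (fun w => w.fst.improve w.snd.fst w.snd.snd)
    (fun w => [restrictionCall w.fst w.snd.snd]) := by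
  have h1 := PTC.mk_pair (PT.id (rel := RunPlain S) (X := improveInputs)) (PTC.candidate hS)
  have h2 : PTu (RunPlain S) fun w => Data.cond (w.snd.fst.le w.fst.snd.fst.fst) w.snd
      w.fst.snd.fst :=
    .cond (.le (.fst (.snd .id)) (.fst (.fst (.snd (.fst .id))))) (.snd .id) (.fst (.snd (.fst .id)))
  have h3 := PTC.seq (h2.on fun _ : ℕ => Set.univ) h1 fun _ _ _ => trivial
  simp only [Data.fst_pair, Data.snd_pair, List.append_nil, List.nil_append] at h3
  exact h3

/-- The search runs in polynomial time on the inputs with a fixed number of columns in the block `C`,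
with one subroutine call for each mask. -/
theorem PTC.search (hS : ComputesLeastSquares S p) :
    PTC (RunPlain S) inputs Data.search (fun v => v.masks.toList.map (restrictionCall v)) := by
  have hmasks : PT (RunPlain S) inputs Data.masks := PT.masks fun k => ⟨k, by
    rintro _ ⟨n, A, C, c, b, σ, -, rfl⟩
    rw [Data.colsC_encInstance]
    simp [encMatrix]⟩
  have hstart : PT (RunPlain S) inputs Data.start :=
    .pair (.dot (.fst (.snd (.snd .id))) (.fst (.snd (.snd .id)))) (.const _)
  have h := PTC.fold (Y := improveInputs) (f := Data.improve) (PTC.improve hS) hmasks hstart ?_ ?_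
  · have h' : PTu (RunPlain S) fun w => w.snd := .snd .id
    refine (PTC.seq (h'.on fun _ => Set.univ) h fun _ _ _ => trivial).congr_calls fun v => ?_
    rw [List.append_nil, foldCalls_eq_flatMap _ _ (fun x => [restrictionCall v x]) v
      (fun a x => rfl), ← List.map_eq_flatMap]
  · rintro k _ ⟨n, A, C, c, b, σ, hA, rfl⟩ l₁ x l₂ hl
    rw [Data.masks_encInstance A C c b σ hA, Data.toList_encList] at hl
    obtain ⟨f, -, rfl⟩ := List.mem_map.1 (show x ∈ (masks A C c b σ).map encVec by simp [hl])
    exact ⟨n, A, C, c, b, σ, _, f, rfl⟩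
  · intro k
    obtain ⟨pm, hpm⟩ := PTC.ht_le hmasks k
    obtain ⟨ps, hps⟩ := PTC.ht_le hstart k
    obtain ⟨pc, hpc⟩ := PTC.ht_le (PTC.candidate hS) k
    refine ⟨ps + pc.comp (4 + .X + pm), ?_⟩
    rintro _ ⟨n, A, C, c, b, σ, hA, rfl⟩ l₁ l₂ hl
    have h1 := hpm _ ⟨n, A, C, c, b, σ, hA, rfl⟩
    have h2 := hps _ ⟨n, A, C, c, b, σ, hA, rfl⟩
    have hmem : ∀ x ∈ l₁, x.ht ≤ pm.eval (encInstance (blockRow A C) c b σ).ht := fun x hx =>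
      (Data.ht_le_of_mem_toList (by rw [hl]; simp [hx])).trans h1
    rw [Data.masks_encInstance A C c b σ hA, Data.toList_encList] at hl
    obtain ⟨ms, ms', -, rfl, -⟩ := List.map_eq_append_iff.1 hl
    simp only [Polynomial.eval_add, Polynomial.eval_comp]
    rcases Data.foldl_improve (blockRow A C) c b σ ms with ⟨-, h⟩ | ⟨f, hf, -, h⟩
    · rw [h]; omega
    · rw [h, ← Data.candidate_encInstance (blockRow A C) c b σ f]
      have h3 := hpc _ (⟨n, A, C, c, b, σ, .num 0, f, rfl⟩ : .pair (encInstance (blockRow A C) c b σ)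
        (.pair (.num 0) (encVec f)) ∈ improveInputs k)
      have h4 := hmem _ (List.mem_map_of_mem hf)
      have h5 := poly_mono pc (show (Data.pair (encInstance (blockRow A C) c b σ)
        (.pair (.num 0) (encVec f))).ht ≤ 4 + (encInstance (blockRow A C) c b σ).ht +
          pm.eval (encInstance (blockRow A C) c b σ).ht by
        simp only [Data.ht_pair, Data.ht_num_zero]; omega)
      simp only [Data.fst_pair, Data.snd_pair] at h3
      simp only [Polynomial.eval_ofNat, Polynomial.eval_X]
      omega

end

/-- The best of the solutions on the candidate supports is optimal. -/
theorem isOptimal_maskPoint {n k : ℕ} {A : Matrix (Fin n) (Fin n) ℚ} {C : Matrix (Fin n) (Fin k) ℚ}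
    {c b : Fin n → ℚ} {σ : ℕ} (hA : A.IsDiag) {f : Fin (n + k) → ℚ} (hf : f ∈ masks A C c b σ)
    (hmin : ∀ g ∈ masks A C c b σ,
      maskValue (blockRow A C) c b f ≤ maskValue (blockRow A C) c b g) :
    IsOptimal (blockRow A C) c b σ (fun j => (maskPoint (blockRow A C) c b f j : ℝ))
      (maskCoeff (blockRow A C) c b f) := by
  constructor
  · have h1 : Function.support (fun j => (maskPoint (blockRow A C) c b f j : ℝ)) ⊆
        Set.range (supportEmb f) := by
      intro i hi
      by_contra h
      exact hi (by simp only [maskPoint, extendZero_of_notMem _ _ h, Rat.cast_zero])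
    refine (Set.ncard_le_ncard h1 (Set.finite_range _)).trans ?_
    rw [Set.ncard_range_of_injective (supportEmb f).injective, Nat.card_eq_fintype_card,
      Fintype.card_fin]
    exact length_supportList_le (masks_spec hf).1 (masks_spec hf).2
  · intro y ν hy
    obtain ⟨g, hg, x, hx, hxy⟩ := exists_mask (A := A) (C := C) (c := c) (b := b) hA y ν hy
    rw [objective_maskPoint]
    refine (Real.sqrt_le_sqrt ?_).trans ((sqrt_maskValue_le (blockRow A C) c b g hx).trans hxy)
    exact_mod_cast hmin g hg

end SubsetSelection

/-- There are a polynomial-time linear least squares algorithm `S` and an algorithm `P` using `S` as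
its subroutine that solves Subset Selection for `M = (A | C)` with `A` diagonal: for each fixed number
`k` of columns of `C` the total time is polynomial in the bit size of the input, and
`O(2 ^ k * n ^ (2 * (k + 1)))` linear least squares problems are solved. -/
theorem theorem2 :
    ∃ S P : SubsetSelection.Program, SubsetSelection.SolvesLeastSquaresInPolyTime S ∧
      ∃ K : ℕ, ∀ k : ℕ, ∃ p : Polynomial ℕ,
        ∀ (n : ℕ) (A : Matrix (Fin n) (Fin n) ℚ) (C : Matrix (Fin n) (Fin k) ℚ)
          (c b : Fin n → ℚ) (σ : ℕ), A.IsDiag →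
          ∃ (x : Fin (n + k) → ℚ) (μ : ℚ) (t : ℕ)
            (l : List (SubsetSelection.Data × SubsetSelection.Data)),
            SubsetSelection.RunWith S P
              (SubsetSelection.encInstance (SubsetSelection.blockRow A C) c b σ)
              (SubsetSelection.encSolution x μ) t l ∧
            SubsetSelection.IsOptimal (SubsetSelection.blockRow A C) c b σ
              (fun j => (x j : ℝ)) (μ : ℝ) ∧
            t ≤ p.eval
              (SubsetSelection.encInstance (SubsetSelection.blockRow A C) c b σ).size ∧
            (1 ≤ n → l.length ≤ K * (2 ^ k * n ^ (2 * (k + 1)))) ∧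
            SubsetSelection.CallsAreRestrictions (SubsetSelection.blockRow A C) c b σ l ∧
            SubsetSelection.ObtainedFromCalls (SubsetSelection.blockRow A C) c b l x μ := by
  open SubsetSelection in
  obtain ⟨S, p, hS⟩ := exists_leastSquares_program
  obtain ⟨P, hP⟩ := PTC.search hS
  refine ⟨S, P, ⟨p, fun m q B y => ?_⟩, 2, fun k => ?_⟩
  · obtain ⟨t, h1, h2⟩ := hS m q B y
    exact ⟨lsSolution B y, t, h1, h2.trans (poly_mono p (Data.ht_le_size _)),
      lsSolution_optimal B y⟩
  obtain ⟨p', hp'⟩ := hP k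
  refine ⟨p', fun n A C c b σ hA => ?_⟩
  obtain ⟨t, h1, h2⟩ := hp' _ ⟨n, A, C, c, b, σ, hA, rfl⟩
  have hcall : ∀ f, restrictionCall (encInstance (blockRow A C) c b σ) (encVec f) =
      (encLeastSquares (restrictCols (blockRow A C) c (supportEmb f)) b,
        encVec (maskSolution (blockRow A C) c b f)) := by
    intro f
    rw [restrictionCall, Data.restriction_encInstance]
    exact congrArg _ (Data.leastSquares_eq _ _)
  have hmasks := Data.masks_encInstance A C c b σ hA
  rw [Data.search, hmasks, Data.toList_encList] at h1
  rcases Data.foldl_improve (blockRow A C) c b σ (masks A C c b σ) with ⟨h, -⟩ | ⟨f, hf, hmin, h⟩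
  · -- There is at least the zero mask.
    simp [masks] at h
  rw [h, Data.snd_pair] at h1
  simp only [hmasks, Data.toList_encList, List.map_map] at h1
  refine ⟨_, _, t, _, h1, isOptimal_maskPoint hA hf hmin,
    h2.trans (poly_mono p' (Data.ht_le_size _)), fun hn => ?_, ?_, ?_⟩
  · have : 1 ≤ 2 ^ k * n ^ (2 * (k + 1)) := Nat.mul_pos (by positivity) (pow_pos hn _)
    rw [List.length_map, length_masks]
    omega
  · intro e he
    obtain ⟨g, hg, rfl⟩ := List.mem_map.1 he
    refine ⟨_, supportEmb g, length_supportList_le (masks_spec hg).1 (masks_spec hg).2, ?_⟩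
    rw [Function.comp, hcall]
  · refine ⟨_, supportEmb f, maskSolution (blockRow A C) c b f, ?_, fun j => ?_, fun i hi => ?_, rfl⟩
    · exact List.mem_map.2 ⟨f, hf, hcall f⟩
    · exact extendZero_apply _ _ j
    · exact extendZero_of_notMem _ _ hi
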